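/- **Setting.** Let $A$ be a nonunital associative ring, embedded as a two-sided ideal in a unital ring $R$ (for instance $R=\tilde A=\mathbb{Z}\ltimes A$, where $R/A=\mathbb{Z}$, or $R=k\ltimes A$ if $A$ is an algebra over a field $k$). Modules are left $R$-modules. * A module $M$ is *h-unitary* if $\mathrm{Tor}^R_n(R/A,M)=0$ for all $n\ge 0$. $\mathfrak{M}(A)$ is the full subcategory of h-unitary modules, and $\mathcal{F}$ is the class of h-unitary modules that are flat over $R$. * $\mathbb{C}(\mathfrak{M}(A))$ is the full subcategory of the category of unbounded cochain complexes of $R$-modules formed by the complexes $M=(M^i,\delta^i)_{i\in\mathbb{Z}}$ such that $\ker\delta^i$, $M^i$ and $\mathrm{Im}\,\delta^i$ are h-unitary for all $i$. * Exact sequences in $\mathfrak{M}(A)$ and in $\mathbb{C}(\mathfrak{M}(A))$ are the short exact sequences of $R$-modules, respectively of complexes of $R$-modules, all of whose terms lie in the subcategory. $\mathrm{Ext}^1$ denotes the Yoneda $\mathrm{Ext}^1$ relative to these sequences; thus $\mathrm{Ext}^1(X,Y)=0$ means that every such sequence $0\to Y\to E\to X\to 0$ splits. For a class $\mathcal{D}$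 of objects, $\mathcal{D}^\perp=\{Y:\mathrm{Ext}^1(D,Y)=0\ \forall D\in\mathcal{D}\}$ and ${}^\perp\mathcal{D}=\{X:\mathrm{Ext}^1(X,D)=0\ \forall D\in\mathcal{D}\}$, taken within the subcategory. $\mathcal{C}=\mathcal{F}^\perp$ in $\mathfrak{M}(A)$. * $\widetilde{\mathcal{C}}$ is the class of complexes $C$ in $\mathbb{C}(\mathfrak{M}(A))$ that are exact and satisfy $Z_nC=\ker\delta^n\in\mathcal{C}$ for all $n$. $dg\widetilde{\mathcal{F}}$ is the class of complexes $F$ in $\mathbb{C}(\mathfrak{M}(A))$ such that $F^n\in\mathcal{F}$ for all $n$ and the complex of abelian groups $\mathrm{Hom}(F,C)$ is exact for every $C\in\widetilde{\mathcal{C}}$. $S^m(F)$ is the complex with $F$ in degree $m$ and $0$ elsewhere. * An *h-unitary flat generator* is a module $G\in\mathcal{F}$ such that every h-unitary module is a homomorphic image of a direct sum of copies of $G$. **Theorem.** In $\mathbb{C}(\mathfrak{M}(A))$ the pair $(dg\widetilde{\mathcal{F}},\widetilde{\mathcal{C}})$ is a complete cotorsion pair, that is: 1. $(dg\widetilde{\mathcal{F}})^\perp=\widetilde{\mathcal{C}}$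 and ${}^\perp\widetilde{\mathcal{C}}=dg\widetilde{\mathcal{F}}$; 2. for every complex $Y$ in $\mathbb{C}(\mathfrak{M}(A))$ there are short exact sequences $0\to Y\to C\to F\to 0$ and $0\to C'\to F'\to Y\to 0$ with $F,F'\in dg\widetilde{\mathcal{F}}$ and $C,C'\in\widetilde{\mathcal{C}}$. Moreover, an h-unitary flat generator exists. For every h-unitary flat generator $G$ and every cardinal $\aleph\ge\max\{|G|,\aleph_0\}$, let $\mathcal{S}_\aleph$ be a set of representatives of the isomorphism classes of h-unitary flat modules of cardinality at most $\aleph$. Then the pair is cogenerated by the set $\mathcal{L}=\{S^m(F):m\in\mathbb{Z},\ F\in\mathcal{S}_\aleph\cup\{G\}\}$: one has $\mathcal{L}\subseteq dg\widetilde{\mathcal{F}}$ and $\mathcal{L}^\perp=(dg\widetilde{\mathcal{F}})^\perp$. -/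

import Mathlib

open CategoryTheory CategoryTheory.Limits MulOpposite
open scoped TensorProduct Cardinal

universe w v u

namespace HUnitary

/-! Tensor products over a ring that need not be commutative, flatness and `Tor`. -/

section Tensor

variable {R : Type u} [Ring R]

/-- The subgroup of `N ⊗[ℤ] M` generated by the elements `n r ⊗ m - n ⊗ r m`, where `N` is a
right and `M` a left `R`-module. -/
def balancedRelations (N : Type w) (M : Type v) [AddCommGroup N] [Module Rᵐᵒᵖ N]
    [AddCommGroup M] [Module R M] : AddSubgroup (N ⊗[ℤ] M) :=
  AddSubgroup.closure
    {x | ∃ (n : N) (r : R) (m : M), x = (op r • n) ⊗ₜ[ℤ] m - n ⊗ₜ[ℤ] (r • m)}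

/-- The tensor product `N ⊗_R M` of a right `R`-module `N` and a left `R`-module `M`. -/
abbrev BalancedTensor (N : Type w) (M : Type v) [AddCommGroup N] [Module Rᵐᵒᵖ N]
    [AddCommGroup M] [Module R M] : Type (max w v) :=
  (N ⊗[ℤ] M) ⧸ balancedRelations (R := R) N M

/-- The map `f ⊗ g : N ⊗_R M → N' ⊗_R M'`. -/
def balancedMap {N N' : Type w} {M M' : Type v} [AddCommGroup N] [Module Rᵐᵒᵖ N]
    [AddCommGroup N'] [Module Rᵐᵒᵖ N'] [AddCommGroup M] [Module R M]
    [AddCommGroup M'] [Module R M'] (f : N →ₗ[Rᵐᵒᵖ] N') (g : M →ₗ[R] M') :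
    BalancedTensor (R := R) N M →+ BalancedTensor (R := R) N' M' :=
  QuotientAddGroup.map _ _
    (TensorProduct.map f.toAddMonoidHom.toIntLinearMap
      g.toAddMonoidHom.toIntLinearMap).toAddMonoidHom (by
    rw [balancedRelations, AddSubgroup.closure_le]
    rintro _ ⟨n, r, m, rfl⟩
    refine AddSubgroup.subset_closure ⟨f n, r, g m, ?_⟩
    simp)

section

variable {N : Type w} {M M' M'' : Type v} [AddCommGroup N] [Module Rᵐᵒᵖ N]
  [AddCommGroup M] [Module R M] [AddCommGroup M'] [Module R M']
  [AddCommGroup M''] [Module R M'']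

theorem balancedTensor_hom_ext {X : Type*} [AddGroup X]
    {f g : BalancedTensor (R := R) N M →+ X}
    (h : ∀ (n : N) (m : M), f (QuotientAddGroup.mk (n ⊗ₜ[ℤ] m)) =
      g (QuotientAddGroup.mk (n ⊗ₜ[ℤ] m))) : f = g := by
  ext x
  induction x using TensorProduct.induction_on with
  | zero => exact (map_zero f).trans (map_zero g).symm
  | tmul n m => exact h n m
  | add x y hx hy =>
    exact (map_add f _ _).trans ((congrArg₂ (· + ·) hx hy).trans (map_add g _ _).symm)

theorem balancedMap_id :
    balancedMap (R := R) (LinearMap.id : N →ₗ[Rᵐᵒᵖ] N) (LinearMap.id : M →ₗ[R] M) =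
      AddMonoidHom.id _ :=
  balancedTensor_hom_ext fun _ _ => rfl

theorem balancedMap_comp (g : M →ₗ[R] M') (h : M' →ₗ[R] M'') :
    balancedMap (R := R) (LinearMap.id : N →ₗ[Rᵐᵒᵖ] N) (h ∘ₗ g) =
      (balancedMap LinearMap.id h).comp (balancedMap LinearMap.id g) :=
  balancedTensor_hom_ext fun _ _ => rfl

theorem balancedMap_add (g h : M →ₗ[R] M') :
    balancedMap (R := R) (LinearMap.id : N →ₗ[Rᵐᵒᵖ] N) (g + h) =
      balancedMap LinearMap.id g + balancedMap LinearMap.id h :=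
  balancedTensor_hom_ext fun n m =>
    congrArg (fun t : N ⊗[ℤ] M' => (QuotientAddGroup.mk t : BalancedTensor (R := R) N M'))
      (TensorProduct.tmul_add n (g m) (h m))

end

/-- The functor `N ⊗_R -` from left `R`-modules to abelian groups. -/
def tensorFunctor (N : Type w) [AddCommGroup N] [Module Rᵐᵒᵖ N] :
    ModuleCat.{v} R ⥤ AddCommGrpCat.{max w v} where
  obj M := AddCommGrpCat.of (BalancedTensor (R := R) N M)
  map g := AddCommGrpCat.ofHom (balancedMap LinearMap.id g.hom)
  map_id M := by rw [ModuleCat.hom_id, balancedMap_id]; rfl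
  map_comp g h := by rw [ModuleCat.hom_comp, balancedMap_comp]; rfl

instance (N : Type w) [AddCommGroup N] [Module Rᵐᵒᵖ N] :
    (tensorFunctor.{w, v, u} (R := R) N).Additive where
  map_add {_ _ g h} := congrArg AddCommGrpCat.ofHom (balancedMap_add g.hom h.hom)

/-- A left `R`-module `M` is flat if `- ⊗_R M` preserves injections of right `R`-modules. -/
def IsFlat (M : ModuleCat.{u} R) : Prop :=
  ∀ (N N' : ModuleCat.{u} Rᵐᵒᵖ) (f : N →ₗ[Rᵐᵒᵖ] N'), Function.Injective f →
    Function.Injective (balancedMap (R := R) f (LinearMap.id : M →ₗ[R] M))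

/-- `Tor_n^R(N, M)` for a right `R`-module `N` and a left `R`-module `M`: the `n`-th left derived
functor of `N ⊗_R -`, applied to `M`. -/
noncomputable def tor (N : ModuleCat.{u} Rᵐᵒᵖ) (n : ℕ) (M : ModuleCat.{u} R) :
    AddCommGrpCat.{u} :=
  ((tensorFunctor.{u, u, u} (R := R) N).leftDerived n).obj M

end Tensor

/-! Yoneda `Ext¹`, orthogonal classes and cotorsion pairs in a full subcategory `Q` of an abelian
category, with respect to the short exact sequences of the ambient category whose three terms
lie in `Q`. -/

section Cotorsion

variable {𝓐 : Type*} [Category 𝓐] [Abelian 𝓐]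

/-- `Ext¹_Q(X, Y) = 0`: every short exact sequence `0 → Y → E → X → 0` with terms in `Q` splits
(`X` and `Y` are taken in `Q`). -/
def ExtOneVanishes (Q : ObjectProperty 𝓐) (X Y : 𝓐) : Prop :=
  ∀ (E : 𝓐) (f : Y ⟶ E) (g : E ⟶ X) (w : f ≫ g = 0), Q E →
    (ShortComplex.mk f g w).ShortExact → Nonempty (ShortComplex.mk f g w).Splitting

/-- The class `D^⊥` of all `Y` in `Q` with `Ext¹_Q(X, Y) = 0` for all `X` in `D`. -/
def rightPerp (Q D : ObjectProperty 𝓐) : ObjectProperty 𝓐 :=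
  fun Y => Q Y ∧ ∀ X, D X → ExtOneVanishes Q X Y

/-- The class `^⊥D` of all `X` in `Q` with `Ext¹_Q(X, Y) = 0` for all `Y` in `D`. -/
def leftPerp (Q D : ObjectProperty 𝓐) : ObjectProperty 𝓐 :=
  fun X => Q X ∧ ∀ Y, D Y → ExtOneVanishes Q X Y

/-- `(F, C)` is a cotorsion pair in `Q`. -/
structure IsCotorsionPair (Q F C : ObjectProperty 𝓐) : Prop where
  rightPerp_eq : rightPerp Q F = C
  leftPerp_eq : leftPerp Q C = F

/-- For every `Y` in `Q` there is an exact sequence `0 → Y → C → F → 0`. -/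
def HasEnoughInjectives (Q F C : ObjectProperty 𝓐) : Prop :=
  ∀ Y, Q Y → ∃ S : ShortComplex 𝓐, S.ShortExact ∧ S.X₁ = Y ∧ C S.X₂ ∧ F S.X₃

/-- For every `Z` in `Q` there is an exact sequence `0 → C → F → Z → 0`. -/
def HasEnoughProjectives (Q F C : ObjectProperty 𝓐) : Prop :=
  ∀ Z, Q Z → ∃ S : ShortComplex 𝓐, S.ShortExact ∧ C S.X₁ ∧ F S.X₂ ∧ S.X₃ = Z

/-- `(F, C)` is a complete cotorsion pair in `Q`. -/
structure IsCompleteCotorsionPair (Q F C : ObjectProperty 𝓐) : Prop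
    extends IsCotorsionPair Q F C where
  enoughInjectives : HasEnoughInjectives Q F C
  enoughProjectives : HasEnoughProjectives Q F C

/-- The pair `(F, F^⊥)` in `Q` is cogenerated by the class `S ⊆ F`, which has only a set of
isomorphism classes. -/
structure IsCogeneratedBySet (Q F S : ObjectProperty 𝓐) : Prop where
  le : S ≤ F
  essentiallySmall : ObjectProperty.EssentiallySmall.{w} S
  perp_eq : rightPerp Q S = rightPerp Q F

end Cotorsion

/-! A nonunital ring `A` as a two-sided ideal of a unital ring `R`. For a given nonunital ring
one may take `R = Unitization ℤ A`, the ring `ℤ ⋉ A` obtained by adjoining a unit, with the ideal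
of the elements of vanishing `ℤ`-component; then the right `R`-module `R ⧸ A` is `ℤ`. -/

section Modules

variable {R : Type u} [Ring R] (A : Ideal R) [A.IsTwoSided]

/-- The right `R`-module `R ⧸ A`. -/
noncomputable def quotientRight : ModuleCat.{u} Rᵐᵒᵖ :=
  (ModuleCat.restrictScalars (RingHom.op (Ideal.Quotient.mk A))).obj
    (ModuleCat.of (R ⧸ A)ᵐᵒᵖ (R ⧸ A))

/-- The h-unitary left modules: `Tor_n^R(R ⧸ A, M) = 0` for all `n ≥ 0`. -/
def hUnitary : ObjectProperty (ModuleCat.{u} R) :=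
  fun M => ∀ n : ℕ, IsZero (tor (quotientRight A) n M)

/-- The h-unitary flat modules. -/
def hUnitaryFlat : ObjectProperty (ModuleCat.{u} R) :=
  fun M => hUnitary A M ∧ IsFlat M

/-- The h-unitary cotorsion modules. -/
def hUnitaryCotorsion : ObjectProperty (ModuleCat.{u} R) :=
  rightPerp (hUnitary A) (hUnitaryFlat A)

/-- `G` is an h-unitary flat generator: every h-unitary module is the homomorphic image of a
direct sum of copies of `G`. -/
structure IsFlatGenerator (G : ModuleCat.{u} R) : Prop where
  mem : hUnitaryFlat A G
  generates : ∀ M : ModuleCat.{u} R, hUnitary A M →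
    ∃ (ι : Type u) (p : (ι →₀ G) →ₗ[R] M), Function.Surjective p

/-- The module of cycles `Z_i K = ker (K^i → K^{i+1})`. -/
def cyclesModule (K : CochainComplex (ModuleCat.{u} R) ℤ) (i : ℤ) : ModuleCat.{u} R :=
  ModuleCat.of R (LinearMap.ker (K.d i (i + 1)).hom)

/-- The image of the differential `K^i → K^{i+1}`. -/
def imageModule (K : CochainComplex (ModuleCat.{u} R) ℤ) (i : ℤ) : ModuleCat.{u} R :=
  ModuleCat.of R (LinearMap.range (K.d i (i + 1)).hom)

/-- The category of unbounded complexes of h-unitary modules: those complexes for which every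
`0 → ker δ^i → K^i → im δ^i → 0` is an exact sequence of h-unitary modules. -/
def hUnitaryComplex : ObjectProperty (CochainComplex (ModuleCat.{u} R) ℤ) :=
  fun K => ∀ i : ℤ, hUnitary A (cyclesModule K i) ∧ hUnitary A (K.X i) ∧
    hUnitary A (imageModule K i)

/-- The exact complexes with h-unitary cotorsion cycles. -/
def cotorsionComplex : ObjectProperty (CochainComplex (ModuleCat.{u} R) ℤ) :=
  fun K => hUnitaryComplex A K ∧ K.Acyclic ∧ ∀ i : ℤ, hUnitaryCotorsion A (cyclesModule K i)

/-- The dg-h-unitary flat complexes. -/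
def dgFlatComplex : ObjectProperty (CochainComplex (ModuleCat.{u} R) ℤ) :=
  fun F => hUnitaryComplex A F ∧ (∀ i : ℤ, hUnitaryFlat A (F.X i)) ∧
    ∀ K, cotorsionComplex A K → (CochainComplex.HomComplex F K).Acyclic

/-- The sphere complexes `S^m(F)`, where `m ∈ ℤ` and `F` is either an h-unitary flat module of
cardinality at most `κ` or the module `G`. -/
def sphereComplex (G : ModuleCat.{u} R) (κ : Cardinal.{u}) :
    ObjectProperty (CochainComplex (ModuleCat.{u} R) ℤ) :=
  fun K => ∃ (m : ℤ) (F : ModuleCat.{u} R), ((hUnitaryFlat A F ∧ #F ≤ κ) ∨ F = G) ∧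
    Nonempty (K ≅ (CochainComplex.singleFunctor (ModuleCat.{u} R) m).obj F)

end Modules

end HUnitary

/-! Everything is reduced to the vanishing of Ext. With `N⁺ = Hom_ℤ(N, ℚ/ℤ)`, the adjunction `(N ⊗_R
M)⁺ ≅ Hom_R(M, N⁺)` turns `Tor_n(N, M) = 0` into `Ext^n(M, N⁺) = 0`. So `M` is flat iff `Ext¹(M, N⁺)
= 0` for all `N`, and h-unitary iff `Ext^n(M, (R/A)⁺) = 0` for all `n`. Two-out-of-three for
h-unitary modules follows, and a flat module is h-unitary as soon as `AM = M`, because its higher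
Tor vanishes.

Enough flat objects come from telescopes. If `AM = M`, writing each `m` as a combination with
coefficients in `A` gives an endomorphism `σ` of `R^(M)` over `M`; the direct limit of its iterates
is flat and unital and maps onto `M`. Applied to a sum of small unital modules, this yields a
generator.

The cardinal `κ` bounds `|G|` but not `|R|`, so ordinary purification is not available. It is
replaced by two facts: a span of `κ` elements in an h-unitary module has at most `κ` elements, being
contained in an image of `κ` copies of `G`; and `κ` many coefficient rows, read off from one
telescope, control all linear combinations in all h-unitary modules. Hence h-unitary flat modules
have small pure submodules with flat quotient, and by Zorn the small ones detect cotorsion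
(`IsFlatGenerator.extVanishes_one`). The small object argument then gives special cotorsion
preenvelopes of modules (`exists_cotorsion_embedding`).

For complexes, a preenvelope of `Y` is built in two moves. All cohomology is killed by adjoining
flat modules `ω` times (`exists_acyclic_extension`); then the cycles of the resulting acyclic
complex are embedded in cotorsion modules and glued by a horseshoe argument
(`exists_cotorsionComplex_extension`). Both moves lie in a class defined by left lifting properties,
hence closed under composition and colimits, and its cokernels are dg-flat. Precovers follow by
Salce's pushout from a surjection of a contractible complex, and `^⊥C̃ = dgF̃` follows by a retract
argument.

For cogeneration the relative Ext matters: only extensions inside the subcategory split. To show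
that a cycle `x` of `Y ∈ L^⊥` is a boundary, an extension of a sphere by `Y` is needed whose
boundaries stay h-unitary. `IsFlatGenerator.exists_small_submodule` supplies a small partial sum of
copies of `G` that hits the class of `x` and has h-unitary image in cohomology. Once `Y` is acyclic,
relative and absolute Ext into `Y` agree, and spheres detect that the cycles are cotorsion. -/

namespace HUnitary

/-! ### Character modules, and Tor as a dual of Ext. -/

section Dual

variable {R : Type u} [Ring R]

/-- The character group of a right `R`-module, a left `R`-module. -/
def RightDual (N : Type w) [AddCommGroup N] : Type w := N →+ AddCircle (1 : ℚ)

namespace RightDual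

variable {N N' N'' : Type w} [AddCommGroup N] [AddCommGroup N'] [AddCommGroup N'']

instance : AddCommGroup (RightDual N) := inferInstanceAs (AddCommGroup (N →+ AddCircle (1 : ℚ)))

instance : FunLike (RightDual N) N (AddCircle (1 : ℚ)) :=
  inferInstanceAs (FunLike (N →+ AddCircle (1 : ℚ)) N (AddCircle (1 : ℚ)))

instance : AddMonoidHomClass (RightDual N) N (AddCircle (1 : ℚ)) :=
  inferInstanceAs (AddMonoidHomClass (N →+ AddCircle (1 : ℚ)) N (AddCircle (1 : ℚ)))

@[ext] theorem ext {f g : RightDual N} (h : ∀ x, f x = g x) : f = g := DFunLike.ext _ _ h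

@[simp] theorem add_apply (f g : RightDual N) (n : N) : (f + g) n = f n + g n := rfl

@[simp] theorem zero_apply (n : N) : (0 : RightDual N) n = 0 := rfl

variable [Module Rᵐᵒᵖ N] [Module Rᵐᵒᵖ N'] [Module Rᵐᵒᵖ N'']

instance : Module R (RightDual N) where
  smul r f := AddMonoidHom.comp f (DistribSMul.toAddMonoidHom N (op r))
  one_smul f := ext fun n => congrArg f (by simp)
  mul_smul r s f := ext fun n => congrArg f (by simp [mul_smul])
  smul_zero r := rfl
  smul_add r f g := rfl
  add_smul r s f := ext fun n => (congrArg f (by simp [add_smul])).trans (map_add f _ _)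
  zero_smul f := ext fun n => (congrArg f (by simp)).trans (map_zero f)

@[simp] theorem smul_apply (r : R) (f : RightDual N) (n : N) : (r • f) n = f (op r • n) := rfl

/-- The transpose of a map of right modules. -/
def map (f : N →ₗ[Rᵐᵒᵖ] N') : RightDual N' →ₗ[R] RightDual N where
  toFun φ := AddMonoidHom.comp φ f.toAddMonoidHom
  map_add' _ _ := rfl
  map_smul' r φ := ext fun n => congrArg φ (f.map_smul (op r) n).symm

@[simp] theorem map_apply (f : N →ₗ[Rᵐᵒᵖ] N') (φ : RightDual N') (n : N) :
    map f φ n = φ (f n) := rfl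

end RightDual

theorem exists_character_extension {B C : Type w} [AddCommGroup B] [AddCommGroup C] (g : B →+ C)
    (hg : Function.Injective g) (χ : B →+ AddCircle (1 : ℚ)) :
    ∃ ξ : C →+ AddCircle (1 : ℚ), ∀ b, ξ (g b) = χ b := by
  obtain ⟨ξ, h⟩ := CharacterModule.dual_surjective_of_injective g.toIntLinearMap hg χ
  exact ⟨ξ, fun b => DFunLike.congr_fun h b⟩

theorem RightDual.map_surjective {N N' : Type w} [AddCommGroup N] [AddCommGroup N']
    [Module Rᵐᵒᵖ N] [Module Rᵐᵒᵖ N'] (f : N →ₗ[Rᵐᵒᵖ] N') (hf : Function.Injective f) :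
    Function.Surjective (RightDual.map f) := fun φ => by
  obtain ⟨ξ, h⟩ := exists_character_extension f.toAddMonoidHom hf φ
  exact ⟨ξ, RightDual.ext h⟩

/-- `ℚ/ℤ` is an injective cogenerator of abelian groups, so dualizing both preserves and reflects
exactness. -/
theorem character_exact_iff {A B C : Type w} [AddCommGroup A] [AddCommGroup B] [AddCommGroup C]
    (f : A →+ B) (g : B →+ C) :
    (∀ b, g b = 0 → ∃ a, f a = b) ↔
      ∀ χ : B →+ AddCircle (1 : ℚ), (∀ a, χ (f a) = 0) →
        ∃ ξ : C →+ AddCircle (1 : ℚ), ∀ b, ξ (g b) = χ b := by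
  constructor
  · intro h χ hχ
    have hk : g.ker ≤ χ.ker := fun b hb => by
      obtain ⟨a, rfl⟩ := h b hb
      exact hχ a
    obtain ⟨ξ, hξ⟩ := exists_character_extension (QuotientAddGroup.kerLift g)
      (QuotientAddGroup.kerLift_injective g) (QuotientAddGroup.lift g.ker χ hk)
    exact ⟨ξ, fun b => hξ (QuotientAddGroup.mk b)⟩
  · intro h b hb
    by_contra hne
    have hb' : (QuotientAddGroup.mk b : B ⧸ f.range) ≠ 0 := fun h0 =>
      hne ((QuotientAddGroup.eq_zero_iff b).1 h0)
    obtain ⟨c, hc⟩ := CharacterModule.exists_character_apply_ne_zero_of_ne_zero hb'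
    obtain ⟨ξ, hξ⟩ := h (AddMonoidHom.comp c (QuotientAddGroup.mk' f.range)) (fun a => by
      have : (QuotientAddGroup.mk (f a) : B ⧸ f.range) = 0 :=
        (QuotientAddGroup.eq_zero_iff _).2 ⟨a, rfl⟩
      exact (congrArg c this).trans (map_zero c))
    apply hc
    rw [← map_zero ξ, ← hb]
    exact (hξ b).symm

section Adjunction

variable {N : Type w} {M : Type v} [AddCommGroup N] [Module Rᵐᵒᵖ N] [AddCommGroup M] [Module R M]

/-- The pairing `N ⊗_R M → P` attached to a balanced biadditive map. -/
def balancedLift {P : Type*} [AddCommGroup P] (f : N →+ M →+ P)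
    (hf : ∀ n (r : R) m, f (op r • n) m = f n (r • m)) : BalancedTensor (R := R) N M →+ P :=
  QuotientAddGroup.lift _ (TensorProduct.liftAddHom f (fun r m n => by simp)) (by
    rw [balancedRelations, AddSubgroup.closure_le]
    rintro _ ⟨n, r, m, rfl⟩
    change _ = _
    rw [map_sub, TensorProduct.liftAddHom_tmul, TensorProduct.liftAddHom_tmul, hf, sub_self])

@[simp] theorem balancedLift_mk {P : Type*} [AddCommGroup P] (f : N →+ M →+ P)
    (hf : ∀ n (r : R) m, f (op r • n) m = f n (r • m)) (n : N) (m : M) :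
    balancedLift f hf (QuotientAddGroup.mk (n ⊗ₜ[ℤ] m)) = f n m := rfl

theorem balanced_smul (n : N) (r : R) (m : M) :
    (QuotientAddGroup.mk ((op r • n) ⊗ₜ[ℤ] m) : BalancedTensor (R := R) N M) =
      QuotientAddGroup.mk (n ⊗ₜ[ℤ] (r • m)) := by
  rw [QuotientAddGroup.eq_iff_sub_mem]
  exact AddSubgroup.subset_closure ⟨n, r, m, rfl⟩

/-- The adjunction between the tensor product and the character dual. -/
def curryDual (φ : BalancedTensor (R := R) N M →+ AddCircle (1 : ℚ)) : M →ₗ[R] RightDual N where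
  toFun m := AddMonoidHom.mk' (fun n => φ (QuotientAddGroup.mk (n ⊗ₜ[ℤ] m))) (fun a b => by
    rw [TensorProduct.add_tmul, QuotientAddGroup.mk_add, map_add])
  map_add' a b := RightDual.ext fun n => (congrArg φ (by
    rw [TensorProduct.tmul_add, QuotientAddGroup.mk_add])).trans (map_add φ _ _)
  map_smul' r m := RightDual.ext fun n => congrArg φ (balanced_smul n r m).symm

/-- The inverse of `curryDual`. -/
def uncurryDual (ψ : M →ₗ[R] RightDual N) : BalancedTensor (R := R) N M →+ AddCircle (1 : ℚ) :=
  balancedLift (AddMonoidHom.mk' (fun n => AddMonoidHom.mk' (fun m => ψ m n) (fun a b => by simp))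
    (fun a b => by ext m; exact map_add (ψ m) a b)) (fun n r m => by simp)

theorem uncurryDual_curryDual (φ : BalancedTensor (R := R) N M →+ AddCircle (1 : ℚ)) :
    uncurryDual (curryDual φ) = φ :=
  balancedTensor_hom_ext fun _ _ => rfl

end Adjunction

/-- The character module of a right module as an object of the category of left modules. -/
abbrev dualModule (N : ModuleCat.{u} Rᵐᵒᵖ) : ModuleCat.{u} R := ModuleCat.of R (RightDual N)

/-- Dualize: a map of abelian groups is injective iff every character extends along it, and the
adjunction rewrites characters of tensor products as linear maps into character modules. -/
theorem isFlat_iff_lifts (M : ModuleCat.{u} R) :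
    IsFlat M ↔ ∀ (N N' : ModuleCat.{u} Rᵐᵒᵖ) (f : N →ₗ[Rᵐᵒᵖ] N'), Function.Injective f →
      ∀ φ : M →ₗ[R] RightDual N, ∃ ψ : M →ₗ[R] RightDual N', RightDual.map f ∘ₗ ψ = φ := by
  refine forall_congr' fun N => forall_congr' fun N' => forall_congr' fun f =>
    imp_congr_right fun _ => ?_
  constructor
  · intro h φ
    obtain ⟨ξ, hξ⟩ := exists_character_extension _ h (uncurryDual φ)
    refine ⟨curryDual ξ, LinearMap.ext fun m => RightDual.ext fun n => ?_⟩
    exact hξ (QuotientAddGroup.mk (n ⊗ₜ[ℤ] m))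
  · intro h
    rw [injective_iff_map_eq_zero]
    intro t ht
    refine CharacterModule.eq_zero_of_character_apply fun c => ?_
    obtain ⟨ψ, hψ⟩ := h (curryDual c)
    have : AddMonoidHom.comp (uncurryDual ψ) (balancedMap f LinearMap.id) = c := by
      rw [← uncurryDual_curryDual (R := R) c, ← hψ]
      exact balancedTensor_hom_ext fun _ _ => rfl
    rw [← this]
    change uncurryDual ψ (balancedMap f LinearMap.id t) = 0
    rw [ht, map_zero]

-- The character dual of `N ⊗ P`, for a projective resolution `P` of `M`, is `Hom(P, N⁺)`, whose
-- cohomology computes Ext.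
open Abelian in
theorem isZero_tor_iff (N : ModuleCat.{u} Rᵐᵒᵖ) (n : ℕ) (M : ModuleCat.{u} R) :
    IsZero (tor N n M) ↔ Subsingleton (Ext.{u} M (dualModule N) n) := by
  let P : ProjectiveResolution M := projectiveResolution M
  -- The subtraction `n - 1` is truncated: for `n = 0` the outgoing differential is `d 0 0 = 0`, so
  -- the condition forces `χ = 0`.
  have key : IsZero (tor N n M) ↔ ∀ χ : P.complex.X n →ₗ[R] RightDual N,
      χ ∘ₗ (P.complex.d (n + 1) n).hom = 0 → ∃ ξ : P.complex.X (n - 1) →ₗ[R] RightDual N,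
        ξ ∘ₗ (P.complex.d n (n - 1)).hom = χ := by
    rw [tor, (P.isoLeftDerivedObj (tensorFunctor N) n).isZero_iff]
    change IsZero (HomologicalComplex.homology _ n) ↔ _
    rw [← HomologicalComplex.exactAt_iff_isZero_homology,
      HomologicalComplex.exactAt_iff' _ (n + 1) n (n - 1) (by simp) (by cases n <;> simp),
      ShortComplex.ab_exact_iff]
    refine (character_exact_iff
      (balancedMap (LinearMap.id : N →ₗ[Rᵐᵒᵖ] N) (P.complex.d (n + 1) n).hom)
      (balancedMap (LinearMap.id : N →ₗ[Rᵐᵒᵖ] N) (P.complex.d n (n - 1)).hom)).trans ?_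
    constructor
    · intro h χ hχ
      obtain ⟨ξ, hξ⟩ := h (uncurryDual χ) (fun a => by
        have : AddMonoidHom.comp (uncurryDual χ)
            (balancedMap LinearMap.id (P.complex.d (n + 1) n).hom) = 0 :=
          balancedTensor_hom_ext fun x m =>
            DFunLike.congr_fun (LinearMap.congr_fun hχ m) x
        exact DFunLike.congr_fun this a)
      refine ⟨curryDual ξ, LinearMap.ext fun m => RightDual.ext fun x => ?_⟩
      exact hξ (QuotientAddGroup.mk (x ⊗ₜ[ℤ] m))
    · intro h χ hχ
      obtain ⟨ξ, hξ⟩ := h (curryDual χ) (LinearMap.ext fun m => RightDual.ext fun x =>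
        hχ (QuotientAddGroup.mk (x ⊗ₜ[ℤ] m)))
      refine ⟨uncurryDual ξ, fun b => ?_⟩
      have : AddMonoidHom.comp (uncurryDual ξ)
          (balancedMap LinearMap.id (P.complex.d n (n - 1)).hom) = χ := by
        rw [← uncurryDual_curryDual (R := R) χ, ← hξ]
        exact balancedTensor_hom_ext fun _ _ => rfl
      exact DFunLike.congr_fun this b
  rw [key]
  obtain _ | n := n
  · have h0 : ∀ χ : P.complex.X 0 →ₗ[R] RightDual N,
        (∃ ξ : P.complex.X (0 - 1) →ₗ[R] RightDual N,
          ξ ∘ₗ (P.complex.d 0 (0 - 1)).hom = χ) ↔ χ = 0 := fun χ => by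
      have : P.complex.d 0 (0 - 1) = 0 := P.complex.shape _ _ (by simp)
      rw [this]
      exact ⟨fun ⟨ξ, h⟩ => h ▸ by simp, fun h => ⟨0, by simp [h]⟩⟩
    simp only [h0]
    rw [Ext.homEquiv₀.subsingleton_congr]
    constructor
    · intro h
      refine subsingleton_of_forall_eq 0 fun f => ?_
      let p : P.complex.X 0 ⟶ M := P.π.f 0
      have hp : P.complex.d 1 0 ≫ p = 0 := P.complex_d_comp_π_f_zero
      have : Epi p := inferInstanceAs (Epi (P.π.f 0))
      have h1 := h (p ≫ f).hom (by
        rw [← ModuleCat.hom_comp, reassoc_of% hp, zero_comp, ModuleCat.hom_zero])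
      have h2 : p ≫ f = 0 := ModuleCat.hom_ext h1
      exact (cancel_epi p).1 (h2.trans comp_zero.symm)
    · intro h χ hχ
      have w : P.complex.d 1 0 ≫ ModuleCat.ofHom χ = 0 := ModuleCat.hom_ext hχ
      have ex := P.exact₀
      obtain ⟨l, hl⟩ := ex.desc' (ModuleCat.ofHom χ) w
      have hl0 : l = 0 := Subsingleton.elim (α := M ⟶ dualModule N) _ _
      have h2 : ModuleCat.ofHom χ = 0 := by rw [← hl, hl0, comp_zero]
      exact ModuleCat.hom_ext_iff.1 h2
  · constructor
    · intro h
      refine subsingleton_of_forall_eq 0 fun α => ?_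
      obtain ⟨f, hf, rfl⟩ := P.extMk_surjective α (n + 2) rfl
      rw [P.extMk_eq_zero_iff f (n + 2) rfl hf n rfl]
      obtain ⟨ξ, hξ⟩ := h f.hom (by rw [← ModuleCat.hom_comp, hf]; rfl)
      exact ⟨ModuleCat.ofHom ξ, ModuleCat.hom_ext hξ⟩
    · intro h χ hχ
      have w : P.complex.d (n + 2) (n + 1) ≫ ModuleCat.ofHom χ = 0 := ModuleCat.hom_ext hχ
      obtain ⟨g, hg⟩ := (P.extMk_eq_zero_iff (ModuleCat.ofHom χ) (n + 2) rfl w n rfl).1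
        (Subsingleton.elim _ _)
      exact ⟨g.hom, ModuleCat.hom_ext_iff.1 hg⟩

end Dual

end HUnitary

namespace HUnitary

/-! ### Long exact sequences and dimension shifting for the vanishing of Ext. -/

section ExtVanishing

open Abelian

variable {R : Type u} [Ring R]

variable (R) in
/-- The vanishing of `Ext^n_R(M, N)`. -/
def ExtVanishes (n : ℕ) (M N : Type u) [AddCommGroup M] [Module R M] [AddCommGroup N]
    [Module R N] : Prop :=
  Subsingleton (Ext.{u} (ModuleCat.of R M) (ModuleCat.of R N) n)

variable {M₁ M₂ M₃ : Type u} [AddCommGroup M₁] [Module R M₁] [AddCommGroup M₂] [Module R M₂]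
  [AddCommGroup M₃] [Module R M₃] {f : M₁ →ₗ[R] M₂} {g : M₂ →ₗ[R] M₃}

theorem moduleCat_shortExact (hf : Function.Injective f) (hfg : Function.Exact f g)
    (hg : Function.Surjective g) :
    (ShortComplex.mk (ModuleCat.ofHom f) (ModuleCat.ofHom g)
      (ModuleCat.hom_ext (LinearMap.ext hfg.apply_apply_eq_zero))).ShortExact where
  exact := (ShortComplex.ShortExact.moduleCat_exact_iff_function_exact _).2 hfg
  mono_f := (ModuleCat.mono_iff_injective _).2 hf
  epi_g := (ModuleCat.epi_iff_surjective _).2 hg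

variable {N : Type u} [AddCommGroup N] [Module R N]

theorem ExtVanishes.eq_zero {n : ℕ} (h : ExtVanishes R n M₁ N)
    (x : Ext.{u} (ModuleCat.of R M₁) (ModuleCat.of R N) n) : x = 0 :=
  @Subsingleton.elim _ h _ _

theorem extVanishes_iff_zero {n : ℕ} : ExtVanishes R n M₁ N ↔
    ∀ x : Ext.{u} (ModuleCat.of R M₁) (ModuleCat.of R N) n, x = 0 :=
  ⟨fun h x => h.eq_zero x, fun h => ⟨fun x y => (h x).trans (h y).symm⟩⟩

theorem ExtVanishes.mid (hf : Function.Injective f) (hfg : Function.Exact f g)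
    (hg : Function.Surjective g) {n : ℕ} (h₁ : ExtVanishes R n M₁ N)
    (h₃ : ExtVanishes R n M₃ N) : ExtVanishes R n M₂ N :=
  extVanishes_iff_zero.2 fun x => by
    obtain ⟨y, rfl⟩ := Ext.contravariant_sequence_exact₂ (moduleCat_shortExact hf hfg hg) _ x
      (h₁.eq_zero _)
    rw [h₃.eq_zero y, Ext.comp_zero]

theorem ExtVanishes.left (hf : Function.Injective f) (hfg : Function.Exact f g)
    (hg : Function.Surjective g) {n : ℕ} (h₂ : ExtVanishes R n M₂ N)
    (h₃ : ExtVanishes R (n + 1) M₃ N) : ExtVanishes R n M₁ N :=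
  extVanishes_iff_zero.2 fun x => by
    obtain ⟨y, rfl⟩ := Ext.contravariant_sequence_exact₁ (moduleCat_shortExact hf hfg hg) _ x
      (add_comm 1 n) (h₃.eq_zero _)
    rw [h₂.eq_zero y, Ext.comp_zero]

theorem ExtVanishes.right_succ (hf : Function.Injective f) (hfg : Function.Exact f g)
    (hg : Function.Surjective g) {n : ℕ} (h₁ : ExtVanishes R n M₁ N)
    (h₂ : ExtVanishes R (n + 1) M₂ N) : ExtVanishes R (n + 1) M₃ N :=
  extVanishes_iff_zero.2 fun x => by
    obtain ⟨y, rfl⟩ := Ext.contravariant_sequence_exact₃ (moduleCat_shortExact hf hfg hg) _ x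
      (h₂.eq_zero _) (add_comm 1 n)
    rw [h₁.eq_zero y, Ext.comp_zero]

theorem ExtVanishes.cov_left (hf : Function.Injective f) (hfg : Function.Exact f g)
    (hg : Function.Surjective g) {n : ℕ} (h₃ : ExtVanishes R n N M₃)
    (h₂ : ExtVanishes R (n + 1) N M₂) : ExtVanishes R (n + 1) N M₁ :=
  extVanishes_iff_zero.2 fun x => by
    obtain ⟨y, rfl⟩ := Ext.covariant_sequence_exact₁ _ (moduleCat_shortExact hf hfg hg) x
      (h₂.eq_zero _) rfl
    rw [h₃.eq_zero y, Ext.zero_comp]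

theorem ExtVanishes.cov_right (hf : Function.Injective f) (hfg : Function.Exact f g)
    (hg : Function.Surjective g) {n : ℕ} (h₂ : ExtVanishes R n N M₂)
    (h₁ : ExtVanishes R (n + 1) N M₁) : ExtVanishes R n N M₃ :=
  extVanishes_iff_zero.2 fun x => by
    obtain ⟨y, rfl⟩ := Ext.covariant_sequence_exact₃ _ (moduleCat_shortExact hf hfg hg) x
      rfl (h₁.eq_zero _)
    rw [h₂.eq_zero y, Ext.zero_comp]

theorem ExtVanishes.cov_mid (hf : Function.Injective f) (hfg : Function.Exact f g)
    (hg : Function.Surjective g) {n : ℕ} (h₁ : ExtVanishes R n N M₁)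
    (h₃ : ExtVanishes R n N M₃) : ExtVanishes R n N M₂ :=
  extVanishes_iff_zero.2 fun x => by
    obtain ⟨y, rfl⟩ := Ext.covariant_sequence_exact₂ _ (moduleCat_shortExact hf hfg hg) x
      (h₃.eq_zero _)
    rw [h₁.eq_zero y, Ext.zero_comp]

theorem extVanishes_zero_iff : ExtVanishes R 0 M₁ N ↔ ∀ φ : M₁ →ₗ[R] N, φ = 0 := by
  refine (Ext.homEquiv₀.subsingleton_congr).trans ⟨fun h φ => ?_, fun h => ?_⟩
  · exact congrArg ModuleCat.Hom.hom
      (Subsingleton.elim (ModuleCat.ofHom φ) (0 : ModuleCat.of R M₁ ⟶ ModuleCat.of R N))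
  · exact subsingleton_of_forall_eq 0 fun φ => ModuleCat.hom_ext (h φ.hom)

theorem ExtVanishes.of_linearEquiv_left {n : ℕ} (h : ExtVanishes R n M₁ N) (e : M₁ ≃ₗ[R] M₂) :
    ExtVanishes R n M₂ N :=
  extVanishes_iff_zero.2 fun x => by
    have h0 := h.eq_zero ((Ext.mk₀ (ModuleCat.ofHom e.toLinearMap)).comp x (zero_add n))
    have : x = (Ext.mk₀ (ModuleCat.ofHom e.symm.toLinearMap)).comp
        ((Ext.mk₀ (ModuleCat.ofHom e.toLinearMap)).comp x (zero_add n)) (zero_add n) := by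
      rw [Ext.mk₀_comp_mk₀_assoc, ← ModuleCat.ofHom_comp, LinearEquiv.comp_coe,
        LinearEquiv.symm_trans_self, LinearEquiv.refl_toLinearMap, ModuleCat.ofHom_id,
        Ext.mk₀_id_comp]
    rw [this, h0, Ext.comp_zero]

theorem ExtVanishes.of_retract {n : ℕ} (h : ExtVanishes R n M₁ N) (i : M₂ →ₗ[R] M₁)
    (r : M₁ →ₗ[R] M₂) (hr : r ∘ₗ i = LinearMap.id) : ExtVanishes R n M₂ N :=
  extVanishes_iff_zero.2 fun x => by
    have h0 := h.eq_zero ((Ext.mk₀ (ModuleCat.ofHom r)).comp x (zero_add n))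
    have : x = (Ext.mk₀ (ModuleCat.ofHom i)).comp
        ((Ext.mk₀ (ModuleCat.ofHom r)).comp x (zero_add n)) (zero_add n) := by
      rw [Ext.mk₀_comp_mk₀_assoc, ← ModuleCat.ofHom_comp, hr, ModuleCat.ofHom_id,
        Ext.mk₀_id_comp]
    rw [this, h0, Ext.comp_zero]

/-- If `Ext¹(N, M₁) = 0`, then maps from `N` lift along epimorphisms with kernel `M₁`. -/
theorem ExtVanishes.exists_lift (h : ExtVanishes R 1 N M₁) (hf : Function.Injective f)
    (hfg : Function.Exact f g) (hg : Function.Surjective g) (v : N →ₗ[R] M₃) :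
    ∃ l : N →ₗ[R] M₂, g ∘ₗ l = v := by
  obtain ⟨y, hy⟩ := Ext.covariant_sequence_exact₃ _ (moduleCat_shortExact hf hfg hg)
    (Ext.mk₀ (ModuleCat.ofHom v)) rfl (h.eq_zero _)
  obtain ⟨l, rfl⟩ := Ext.mk₀_bijective _ _ |>.2 y
  rw [Ext.mk₀_comp_mk₀] at hy
  exact ⟨l.hom, congrArg ModuleCat.Hom.hom ((Ext.mk₀_bijective _ _).1 hy)⟩

/-- If `Ext¹(M₃, N) = 0`, then maps to `N` extend along monomorphisms with cokernel `M₃`. -/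
theorem ExtVanishes.exists_extension (h : ExtVanishes R 1 M₃ N) (hf : Function.Injective f)
    (hfg : Function.Exact f g) (hg : Function.Surjective g) (φ : M₁ →ₗ[R] N) :
    ∃ ψ : M₂ →ₗ[R] N, ψ ∘ₗ f = φ := by
  obtain ⟨y, hy⟩ := Ext.contravariant_sequence_exact₁ (moduleCat_shortExact hf hfg hg) _
    (Ext.mk₀ (ModuleCat.ofHom φ)) rfl (h.eq_zero _)
  obtain ⟨l, rfl⟩ := Ext.mk₀_bijective _ _ |>.2 y
  rw [Ext.mk₀_comp_mk₀] at hy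
  exact ⟨l.hom, congrArg ModuleCat.Hom.hom ((Ext.mk₀_bijective _ _).1 hy)⟩

theorem extVanishes_one_of_lifts (hf : Function.Injective f) (hfg : Function.Exact f g)
    (hg : Function.Surjective g) (h₂ : ExtVanishes R 1 N M₂)
    (h : ∀ v : N →ₗ[R] M₃, ∃ l : N →ₗ[R] M₂, g ∘ₗ l = v) : ExtVanishes R 1 N M₁ :=
  extVanishes_iff_zero.2 fun x => by
    obtain ⟨y, rfl⟩ := Ext.covariant_sequence_exact₁ _ (moduleCat_shortExact hf hfg hg) x
      (h₂.eq_zero _) rfl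
    obtain ⟨v, rfl⟩ := Ext.mk₀_bijective _ _ |>.2 y
    obtain ⟨l, hl⟩ := h v.hom
    have : v = ModuleCat.ofHom l ≫ ModuleCat.ofHom g := ModuleCat.hom_ext hl.symm
    rw [this, ← Ext.mk₀_comp_mk₀, Ext.comp_assoc_of_second_deg_zero]
    exact (congrArg (fun z => (Ext.mk₀ (ModuleCat.ofHom l)).comp z (zero_add 1))
      (moduleCat_shortExact hf hfg hg).comp_extClass).trans (Ext.comp_zero _ _ _ _ _)

theorem extVanishes_of_injective (hN : Module.Injective R N) (n : ℕ) :
    ExtVanishes R (n + 1) M₁ N := by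
  have := Module.injective_object_of_injective_module R N
  exact extVanishes_iff_zero.2 fun x => Ext.eq_zero_of_injective x

variable (R N) in
theorem exists_injective_embedding : ∃ (I D : ModuleCat.{u} R) (i : N →ₗ[R] I) (p : I →ₗ[R] D),
    Module.Injective R I ∧ Function.Injective i ∧ Function.Exact i p ∧ Function.Surjective p := by
  let I := Injective.under (ModuleCat.of R N)
  let i : N →ₗ[R] I := (Injective.ι (ModuleCat.of R N)).hom
  refine ⟨I, ModuleCat.of R (I ⧸ LinearMap.range i), i, (LinearMap.range i).mkQ, ?_, ?_, ?_, ?_⟩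
  · exact (Module.injective_iff_injective_object R I).2 (inferInstanceAs (Injective I))
  · exact (ModuleCat.mono_iff_injective _).1 (Injective.ι_mono _)
  · exact LinearMap.exact_map_mkQ_range i
  · exact Submodule.mkQ_surjective _

/-- If every extension of `N` by `M` splits, then `Ext¹(N, M) = 0`. -/
theorem extVanishes_one_of_splits (M : Type u) [AddCommGroup M] [Module R M]
    (h : ∀ (E : Type u) [AddCommGroup E] [Module R E] (f : M →ₗ[R] E) (g : E →ₗ[R] N),
      Function.Injective f → Function.Exact f g → Function.Surjective g →
        ∃ s : N →ₗ[R] E, g ∘ₗ s = LinearMap.id) : ExtVanishes R 1 N M := by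
  obtain ⟨I, D, i, p, hI, hi, hip, hp⟩ := exists_injective_embedding R M
  refine extVanishes_one_of_lifts hi hip hp (extVanishes_of_injective hI 0) fun v => ?_
  -- The pullback of `I → D` along `v` is an extension of `N` by `M`; composing a section of it with
  -- the projection to `I` lifts `v`.
  let E : Submodule R (N × I) := LinearMap.eqLocus (v ∘ₗ LinearMap.fst R N I)
    (p ∘ₗ LinearMap.snd R N I)
  obtain ⟨s, hs⟩ := h E
    (LinearMap.codRestrict E (LinearMap.inr R N I ∘ₗ i) fun m => by
      change v 0 = p (i m)
      rw [map_zero, hip.apply_apply_eq_zero])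
    (LinearMap.fst R N I ∘ₗ E.subtype)
    (fun a b hab => hi (congrArg (fun e : E => e.1.2) hab))
    (fun e => by
      constructor
      · intro (he : e.1.1 = 0)
        have h2 : v e.1.1 = p e.1.2 := e.2
        rw [he, map_zero] at h2
        obtain ⟨m, hm⟩ := (hip _).1 h2.symm
        exact ⟨m, Subtype.ext (Prod.ext he.symm hm)⟩
      · rintro ⟨m, rfl⟩
        rfl)
    (fun n => by
      obtain ⟨x, hx⟩ := hp (v n)
      exact ⟨⟨(n, x), hx.symm⟩, rfl⟩)
  refine ⟨LinearMap.snd R N I ∘ₗ E.subtype ∘ₗ s, LinearMap.ext fun n => ?_⟩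
  have h2 : v (s n).1.1 = p (s n).1.2 := (s n).2
  have h3 : (s n).1.1 = n := LinearMap.congr_fun hs n
  rw [h3] at h2
  exact h2.symm

/-- Induction on the degree along an injective embedding of `N`: in degree one the lifts on the
summands are assembled, and higher degrees shift down to the cokernel. -/
theorem extVanishes_finsupp {n : ℕ} {ι : Type u} (h : ExtVanishes R n M₁ N) :
    ExtVanishes R n (ι →₀ M₁) N := by
  induction n generalizing N with
  | zero =>
    rw [extVanishes_zero_iff] at h ⊢
    exact fun φ => Finsupp.lhom_ext' fun i => h _
  | succ n ih =>
    obtain ⟨I, D, i, p, hI, hi, hip, hp⟩ := exists_injective_embedding R N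
    obtain _ | n := n
    · refine extVanishes_one_of_lifts hi hip hp (extVanishes_of_injective hI 0) fun v => ?_
      choose l hl using fun j : ι => h.exists_lift hi hip hp (v ∘ₗ Finsupp.lsingle j)
      refine ⟨Finsupp.lsum ℕ l, Finsupp.lhom_ext' fun j => ?_⟩
      rw [← hl j]
      ext x
      simp
    · exact ExtVanishes.cov_left hi hip hp
        (ih (ExtVanishes.cov_right hi hip hp (extVanishes_of_injective hI n) h))
        (extVanishes_of_injective hI _)

end ExtVanishing

/-! ### Flatness as orthogonality to all character modules. -/

section Flat

variable {R : Type u} [Ring R]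

theorem RightDual.map_exact {N₁ N₂ N₃ : Type u} [AddCommGroup N₁] [Module Rᵐᵒᵖ N₁]
    [AddCommGroup N₂] [Module Rᵐᵒᵖ N₂] [AddCommGroup N₃] [Module Rᵐᵒᵖ N₃]
    {f : N₁ →ₗ[Rᵐᵒᵖ] N₂} {g : N₂ →ₗ[Rᵐᵒᵖ] N₃} (hfg : Function.Exact f g) :
    Function.Exact (RightDual.map g) (RightDual.map f) := fun χ => by
  constructor
  · intro h
    obtain ⟨ξ, hξ⟩ := (character_exact_iff f.toAddMonoidHom g.toAddMonoidHom).1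
      (fun b hb => (hfg b).1 hb) χ (fun a => DFunLike.congr_fun h a)
    exact ⟨ξ, RightDual.ext hξ⟩
  · rintro ⟨ξ, rfl⟩
    ext n
    simp [hfg.apply_apply_eq_zero]

theorem RightDual.map_injective {N₁ N₂ : Type u} [AddCommGroup N₁] [Module Rᵐᵒᵖ N₁]
    [AddCommGroup N₂] [Module Rᵐᵒᵖ N₂] {f : N₁ →ₗ[Rᵐᵒᵖ] N₂} (hf : Function.Surjective f) :
    Function.Injective (RightDual.map f) := fun φ ψ h => RightDual.ext fun n => by
  obtain ⟨m, rfl⟩ := hf n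
  exact DFunLike.congr_fun h m

theorem RightDual.finsupp_ext {X : Type u} {f g : RightDual (X →₀ Rᵐᵒᵖ)}
    (h : ∀ x r, f (Finsupp.single x r) = g (Finsupp.single x r)) : f = g :=
  Finsupp.addHom_ext (f := (f : (X →₀ Rᵐᵒᵖ) →+ AddCircle (1 : ℚ))) h

theorem rightDual_finsupp_injective (X : Type u) :
    Module.Injective R (RightDual (X →₀ Rᵐᵒᵖ)) where
  out L L' _ _ _ _ i hi φ := by
    choose χ hχ using fun x : X => exists_character_extension i.toAddMonoidHom hi
      (AddMonoidHom.mk' (fun l => φ l (Finsupp.single x 1)) (fun a b => by simp))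
    let Φ (l : L') : RightDual (X →₀ Rᵐᵒᵖ) := Finsupp.liftAddHom (fun x => AddMonoidHom.mk'
      (fun r : Rᵐᵒᵖ => χ x (unop r • l)) (fun a b => by simp [add_smul]))
    have hΦ (l : L') (x : X) (r : Rᵐᵒᵖ) : Φ l (Finsupp.single x r) = χ x (unop r • l) :=
      Finsupp.liftAddHom_apply_single _ _ _
    refine ⟨{ toFun := Φ
              map_add' := fun a b => RightDual.finsupp_ext fun x r => ?_
              map_smul' := fun r a => RightDual.finsupp_ext fun x s => ?_ },
      fun l => RightDual.finsupp_ext fun x r => ?_⟩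
    · rw [RightDual.add_apply, hΦ, hΦ, hΦ, smul_add, map_add]
    · rw [RingHom.id_apply, RightDual.smul_apply, Finsupp.smul_single, hΦ, hΦ, ← mul_smul]
      rfl
    · have h1 : χ x (i (unop r • l)) = φ (unop r • l) (Finsupp.single x 1) := hχ x (unop r • l)
      change Φ (i l) _ = _
      rw [hΦ, ← map_smul, h1, map_smul, RightDual.smul_apply]
      simp

/-- Every right module is a quotient of a free one. -/
theorem exists_free_cover (N : ModuleCat.{u} Rᵐᵒᵖ) :
    ∃ (K P : ModuleCat.{u} Rᵐᵒᵖ) (k : K →ₗ[Rᵐᵒᵖ] P) (p : P →ₗ[Rᵐᵒᵖ] N),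
      Module.Injective R (RightDual P) ∧ Function.Injective k ∧ Function.Exact k p ∧
        Function.Surjective p := by
  let p : (N →₀ Rᵐᵒᵖ) →ₗ[Rᵐᵒᵖ] N := Finsupp.linearCombination Rᵐᵒᵖ id
  refine ⟨ModuleCat.of _ (LinearMap.ker p), ModuleCat.of _ (N →₀ Rᵐᵒᵖ), (LinearMap.ker p).subtype,
    p, rightDual_finsupp_injective _, Subtype.val_injective, LinearMap.exact_subtype_ker_map p,
    fun n => ⟨Finsupp.single n 1, by simp [p]⟩⟩

/-- The duals of free right modules are injective, so a free cover of `N` embeds `N⁺` in an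
injective module and lifting becomes the vanishing of `Ext¹`. Conversely, the kernel of the
transpose of an injection is the dual of its cokernel. -/
theorem isFlat_iff_extVanishes (M : ModuleCat.{u} R) :
    IsFlat M ↔ ∀ N : ModuleCat.{u} Rᵐᵒᵖ, ExtVanishes R 1 M (RightDual N) := by
  rw [isFlat_iff_lifts]
  constructor
  · intro h N
    obtain ⟨K, P, k, p, hP, hk, hkp, hp⟩ := exists_free_cover N
    exact extVanishes_one_of_lifts (RightDual.map_injective hp) (RightDual.map_exact hkp)
      (RightDual.map_surjective k hk) (extVanishes_of_injective hP 0) (h _ _ k hk)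
  · intro h N N' f hf φ
    exact (h (ModuleCat.of _ (N' ⧸ LinearMap.range f))).exists_lift
      (RightDual.map_injective (Submodule.mkQ_surjective (LinearMap.range f)))
      (RightDual.map_exact (LinearMap.exact_map_mkQ_range f))
      (RightDual.map_surjective f hf) φ

theorem IsFlat.extVanishes {M : ModuleCat.{u} R} (hM : IsFlat M) (n : ℕ)
    (N : ModuleCat.{u} Rᵐᵒᵖ) : ExtVanishes R (n + 1) M (RightDual N) := by
  induction n generalizing N with
  | zero => exact (isFlat_iff_extVanishes M).1 hM N
  | succ n ih =>
    obtain ⟨K, P, k, p, hP, hk, hkp, hp⟩ := exists_free_cover N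
    exact ExtVanishes.cov_left (RightDual.map_injective hp) (RightDual.map_exact hkp)
      (RightDual.map_surjective k hk) (ih K) (extVanishes_of_injective hP (n + 1))

end Flat

end HUnitary

namespace HUnitary

/-! ### The equational criterion for flatness over a noncommutative ring. -/

section Equational

variable {R : Type u} [Ring R]

variable (R) in
/-- The canonical map from the free module on the elements of `M` to `M`. -/
noncomputable abbrev freeEval (M : Type v) [AddCommGroup M] [Module R M] : (M →₀ R) →ₗ[R] M :=
  Finsupp.linearCombination R id

variable (R) in
/-- Every linear relation in `M` is a consequence of relations in `R`. -/
def IsEquational (M : Type v) [AddCommGroup M] [Module R M] : Prop :=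
  ∀ c : M →₀ R, freeEval R M c = 0 →
    ∃ β : (M →₀ R) →ₗ[R] (M →₀ R), freeEval R M ∘ₗ β = freeEval R M ∧ β c = 0

theorem IsEquational.exists_forall {M : Type v} [AddCommGroup M] [Module R M]
    (h : IsEquational R M) (s : Finset (M →₀ R)) (hs : ∀ c ∈ s, freeEval R M c = 0) :
    ∃ β : (M →₀ R) →ₗ[R] (M →₀ R), freeEval R M ∘ₗ β = freeEval R M ∧ ∀ c ∈ s, β c = 0 := by
  classical
  induction s using Finset.induction_on with
  | empty => exact ⟨LinearMap.id, rfl, by simp⟩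
  | insert c s hc ih =>
    obtain ⟨β, hβ, hβs⟩ := ih fun c hc => hs c (Finset.mem_insert_of_mem hc)
    -- Relations are killed one at a time: since `β` respects evaluation, `β c` is again a relation.
    obtain ⟨γ, hγ, hγc⟩ := h (β c) (by
      rw [← LinearMap.comp_apply, hβ]
      exact hs c (Finset.mem_insert_self _ _))
    refine ⟨γ ∘ₗ β, by rw [← LinearMap.comp_assoc, hγ, hβ], fun d hd => ?_⟩
    obtain rfl | hd := Finset.mem_insert.1 hd
    · exact hγc
    · rw [LinearMap.comp_apply, hβs d hd, map_zero]

section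

variable {M N : Type u} [AddCommGroup N] [Module Rᵐᵒᵖ N]

/-- The pairing `N ⊗_R R^(M) → N^(M)`. -/
noncomputable def freePairing (n : N) : (M →₀ R) →+ (M →₀ N) :=
  Finsupp.mapRange.addMonoidHom (AddMonoidHom.mk' (fun r => op r • n) (fun a b => by
    rw [MulOpposite.op_add, add_smul]))

@[simp] theorem freePairing_single (n : N) (m : M) (r : R) :
    freePairing n (Finsupp.single m r) = Finsupp.single m (op r • n) := by
  simp [freePairing]

@[simp] theorem freePairing_apply (n : N) (c : M →₀ R) (m : M) :
    freePairing n c m = op (c m) • n := rfl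

/-- The endomorphism of `N^(M)` induced by an endomorphism of `R^(M)`. -/
noncomputable def freeTensorMap (N : Type u) [AddCommGroup N] [Module Rᵐᵒᵖ N]
    (β : (M →₀ R) →ₗ[R] (M →₀ R)) : (M →₀ N) →+ (M →₀ N) :=
  Finsupp.liftAddHom fun m => AddMonoidHom.mk' (fun n => freePairing n (β (Finsupp.single m 1)))
    (fun a b => by ext x; simp)

@[simp] theorem freeTensorMap_single (β : (M →₀ R) →ₗ[R] (M →₀ R)) (m : M) (n : N) :
    freeTensorMap N β (Finsupp.single m n) = freePairing n (β (Finsupp.single m 1)) := by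
  exact Finsupp.liftAddHom_apply_single _ _ _

theorem freeTensorMap_freePairing (β : (M →₀ R) →ₗ[R] (M →₀ R)) (n : N) (c : M →₀ R) :
    freeTensorMap N β (freePairing n c) = freePairing n (β c) := by
  induction c using Finsupp.induction_linear with
  | zero => simp
  | add a b ha hb => simp [ha, hb]
  | single m r =>
    rw [freePairing_single, freeTensorMap_single, ← Finsupp.smul_single_one m r, map_smul]
    ext x
    simp [mul_smul]

variable [AddCommGroup M] [Module R M]

/-- The relations defining `N ⊗_R M` as a quotient of `N^(M)`. -/
noncomputable def freeRelations (R : Type u) [Ring R] (M N : Type u) [AddCommGroup M] [Module R M]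
    [AddCommGroup N] [Module Rᵐᵒᵖ N] : AddSubgroup (M →₀ N) :=
  AddSubgroup.closure {x | ∃ (n : N) (c : M →₀ R), freeEval R M c = 0 ∧ x = freePairing n c}

/-- The map from `N ⊗_R M` to its presentation by `N^(M)`. -/
noncomputable def toFreeQuotient : BalancedTensor (R := R) N M →+
    (M →₀ N) ⧸ freeRelations R M N :=
  balancedLift (AddMonoidHom.mk' (fun n => AddMonoidHom.mk'
    (fun m => (QuotientAddGroup.mk (Finsupp.single m n) : (M →₀ N) ⧸ freeRelations R M N))
    (fun a b => by
      rw [← QuotientAddGroup.mk_add, QuotientAddGroup.eq_iff_sub_mem]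
      refine AddSubgroup.subset_closure ⟨n, Finsupp.single (a + b) 1 -
        (Finsupp.single a 1 + Finsupp.single b 1), by simp, by simp⟩))
    (fun a b => by ext m; simp [Finsupp.single_add]))
    (fun n r m => by
      change QuotientAddGroup.mk _ = QuotientAddGroup.mk _
      rw [QuotientAddGroup.eq_iff_sub_mem]
      exact AddSubgroup.subset_closure ⟨n, Finsupp.single m r - Finsupp.single (r • m) 1,
        by simp, by simp⟩)

variable (R) in
/-- The quotient map `N^(M) → N ⊗_R M`. -/
noncomputable def ofFree (M N : Type u) [AddCommGroup M] [Module R M] [AddCommGroup N]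
    [Module Rᵐᵒᵖ N] : (M →₀ N) →+ BalancedTensor (R := R) N M :=
  Finsupp.liftAddHom fun m => AddMonoidHom.mk' (fun n => QuotientAddGroup.mk (n ⊗ₜ[ℤ] m))
    (fun a b => by rw [TensorProduct.add_tmul, QuotientAddGroup.mk_add])

@[simp] theorem ofFree_single (m : M) (n : N) :
    ofFree R M N (Finsupp.single m n) = QuotientAddGroup.mk (n ⊗ₜ[ℤ] m) := by
  simp [ofFree]

theorem toFreeQuotient_ofFree (x : M →₀ N) :
    toFreeQuotient (ofFree R M N x) = QuotientAddGroup.mk x := by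
  refine DFunLike.congr_fun (f := (toFreeQuotient (R := R)).comp (ofFree R M N))
    (g := QuotientAddGroup.mk' _) (Finsupp.addHom_ext fun m n => ?_) x
  simp [toFreeQuotient]

theorem ofFree_surjective : Function.Surjective (ofFree R M N) := by
  intro t
  obtain ⟨t, rfl⟩ := QuotientAddGroup.mk_surjective t
  induction t using TensorProduct.induction_on with
  | zero => exact ⟨0, map_zero _⟩
  | tmul n m => exact ⟨Finsupp.single m n, ofFree_single m n⟩
  | add a b ha hb =>
    obtain ⟨x, hx⟩ := ha
    obtain ⟨y, hy⟩ := hb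
    exact ⟨x + y, by rw [map_add, hx, hy, QuotientAddGroup.mk_add]⟩

theorem ofFree_freePairing (n : N) (c : M →₀ R) :
    ofFree R M N (freePairing n c) = QuotientAddGroup.mk (n ⊗ₜ[ℤ] freeEval R M c) := by
  induction c using Finsupp.induction_linear with
  | zero => simp
  | add a b ha hb => rw [map_add, map_add, ha, hb, map_add, TensorProduct.tmul_add,
      QuotientAddGroup.mk_add]
  | single m r => simp [balanced_smul]

theorem ofFree_freeTensorMap (β : (M →₀ R) →ₗ[R] (M →₀ R))
    (hβ : freeEval R M ∘ₗ β = freeEval R M) (x : M →₀ N) :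
    ofFree R M N (freeTensorMap N β x) = ofFree R M N x := by
  refine DFunLike.congr_fun (f := (ofFree R M N).comp (freeTensorMap N β))
    (g := ofFree R M N) (Finsupp.addHom_ext fun m n => ?_) x
  have := LinearMap.congr_fun hβ (Finsupp.single m 1)
  rw [AddMonoidHom.comp_apply, freeTensorMap_single, ofFree_freePairing, ofFree_single]
  rw [LinearMap.comp_apply] at this
  rw [this]
  simp

theorem exists_finset_of_mem_freeRelations {x : M →₀ N} (hx : x ∈ freeRelations R M N) :
    ∃ s : Finset (M →₀ R), (∀ c ∈ s, freeEval R M c = 0) ∧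
      ∀ β : (M →₀ R) →ₗ[R] (M →₀ R), (∀ c ∈ s, β c = 0) → freeTensorMap N β x = 0 := by
  classical
  induction hx using AddSubgroup.closure_induction with
  | mem x hx =>
    obtain ⟨n, c, hc, rfl⟩ := hx
    refine ⟨{c}, by simpa using hc, fun β h => ?_⟩
    rw [freeTensorMap_freePairing, h c (Finset.mem_singleton_self c), map_zero]
  | zero => exact ⟨∅, by simp, by simp⟩
  | add x y _ _ hx hy =>
    obtain ⟨s, hs, h⟩ := hx
    obtain ⟨t, ht, h'⟩ := hy
    refine ⟨s ∪ t, fun c hc => (Finset.mem_union.1 hc).elim (hs c) (ht c), fun β hβ => ?_⟩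
    rw [map_add, h β fun c hc => hβ c (Finset.mem_union_left _ hc),
      h' β fun c hc => hβ c (Finset.mem_union_right _ hc), add_zero]
  | neg x _ hx =>
    obtain ⟨s, hs, h⟩ := hx
    exact ⟨s, hs, fun β hβ => by rw [map_neg, h β hβ, neg_zero]⟩

end

theorem IsEquational.isFlat {M : ModuleCat.{u} R} (h : IsEquational R M) : IsFlat M := by
  intro N N' f hf
  rw [injective_iff_map_eq_zero]
  intro t ht
  obtain ⟨x, rfl⟩ := ofFree_surjective t
  have hmap (x : M →₀ N) : balancedMap (R := R) f (LinearMap.id : M →ₗ[R] M) (ofFree R M N x) =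
      ofFree R M N' (Finsupp.mapRange.addMonoidHom f.toAddMonoidHom x) := by
    refine DFunLike.congr_fun (f := (balancedMap (R := R) f LinearMap.id).comp (ofFree R M N))
      (g := (ofFree R M N').comp (Finsupp.mapRange.addMonoidHom f.toAddMonoidHom))
      (Finsupp.addHom_ext fun m n => ?_) x
    simp only [AddMonoidHom.comp_apply, ofFree_single, Finsupp.mapRange.addMonoidHom_apply,
      Finsupp.mapRange_single]
    rfl
  rw [hmap] at ht
  have h0 := toFreeQuotient_ofFree (R := R)
    (Finsupp.mapRange.addMonoidHom f.toAddMonoidHom x : M →₀ N')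
  rw [ht, map_zero, eq_comm, QuotientAddGroup.eq_zero_iff] at h0
  -- The image of `x` vanishes in `N' ⊗ M` because of finitely many relations in `M`. An
  -- endomorphism `β` killing these kills the image of `x` in `N'^(M)`, hence `β x = 0` already in
  -- `N^(M)` by injectivity of `f`; but `β` does not change the class of `x` in `N ⊗ M`.
  obtain ⟨s, hs, hβ⟩ := exists_finset_of_mem_freeRelations h0
  obtain ⟨β, hβ₁, hβ₂⟩ := h.exists_forall s hs
  have h1 := hβ β hβ₂
  have hcomm : freeTensorMap N' β (Finsupp.mapRange.addMonoidHom f.toAddMonoidHom x) =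
      Finsupp.mapRange.addMonoidHom f.toAddMonoidHom (freeTensorMap N β x) := by
    refine DFunLike.congr_fun
      (f := (freeTensorMap N' β).comp (Finsupp.mapRange.addMonoidHom f.toAddMonoidHom))
      (g := (Finsupp.mapRange.addMonoidHom f.toAddMonoidHom).comp (freeTensorMap N β))
      (Finsupp.addHom_ext fun m n => ?_) x
    ext y
    simp
  rw [hcomm] at h1
  have h2 : freeTensorMap N β x = 0 := by
    refine Finsupp.mapRange_injective f (map_zero f) hf ?_
    exact h1.trans (map_zero (Finsupp.mapRange.addMonoidHom f.toAddMonoidHom)).symm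
  rw [← ofFree_freeTensorMap β hβ₁, h2, map_zero]

theorem IsFlat.isEquational {M : ModuleCat.{u} R} (h : IsFlat M) : IsEquational R M := by
  classical
  intro c hc
  -- The image of `ρ` is the right ideal generated by the coefficients of `c`; `j` is its inclusion
  -- in `R`, to which flatness will be applied.
  let ρ : (M →₀ Rᵐᵒᵖ) →ₗ[Rᵐᵒᵖ] Rᵐᵒᵖ := Finsupp.linearCombination Rᵐᵒᵖ fun m => op (c m)
  let N : ModuleCat.{u} Rᵐᵒᵖ := ModuleCat.of _ ((M →₀ Rᵐᵒᵖ) ⧸ LinearMap.ker ρ)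
  let j : N →ₗ[Rᵐᵒᵖ] ModuleCat.of Rᵐᵒᵖ Rᵐᵒᵖ := (LinearMap.ker ρ).liftQ ρ le_rfl
  have hj : Function.Injective j := LinearMap.ker_eq_bot.1 (Submodule.ker_liftQ_eq_bot _ _ _ le_rfl)
  -- `B` collects the families `(b_m y)_m` with `∑ c_m b_m = 0`. Sending `[b] ⊗ y` to `(b_m y)_m` is
  -- well defined modulo `B`, and detects when an element of `N ⊗ M` comes from such trivial
  -- relations.
  let B : AddSubgroup (M → M) := AddSubgroup.closure
    {v | ∃ b : M →₀ Rᵐᵒᵖ, ρ b = 0 ∧ ∃ y : M, v = fun m => unop (b m) • y}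
  let pair : (M →₀ Rᵐᵒᵖ) →+ M →+ (M → M) ⧸ B :=
    AddMonoidHom.mk' (fun b => AddMonoidHom.mk'
      (fun y => QuotientAddGroup.mk fun m => unop (b m) • y)
      (fun y z => by rw [← QuotientAddGroup.mk_add]; congr 1; funext m; simp))
      (fun b b' => by
        ext y
        simp only [AddMonoidHom.mk'_apply, AddMonoidHom.add_apply, ← QuotientAddGroup.mk_add]
        congr 1; funext m; simp [add_smul])
  let pair' : N →+ M →+ (M → M) ⧸ B := QuotientAddGroup.lift (LinearMap.ker ρ).toAddSubgroup pair
    (fun b hb => by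
      ext y
      exact (QuotientAddGroup.eq_zero_iff _).2 (AddSubgroup.subset_closure ⟨b, hb, y, rfl⟩))
  let Φ : BalancedTensor (R := R) N M →+ (M → M) ⧸ B := balancedLift pair' (fun n r y => by
    obtain ⟨b, rfl⟩ := Submodule.mkQ_surjective _ n
    change QuotientAddGroup.mk _ = QuotientAddGroup.mk _
    congr 1; funext m; simp [mul_smul])
  -- The element `∑ e_m ⊗ m` becomes `1 ⊗ ∑ c_m m = 0` in `R ⊗ M`, so it vanishes by flatness. Hence
  -- the family equal to `m` on the support of `c` and `0` elsewhere lies in `B`.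
  let t : BalancedTensor (R := R) N M := ∑ m ∈ c.support,
    QuotientAddGroup.mk ((Submodule.mkQ (LinearMap.ker ρ) (Finsupp.single m 1) : N) ⊗ₜ[ℤ] m)
  have ht : balancedMap (R := R) j (LinearMap.id : M →ₗ[R] M) t = 0 := by
    have h1 (m : M) : balancedMap (R := R) j (LinearMap.id : M →ₗ[R] M)
        (QuotientAddGroup.mk ((Submodule.mkQ (LinearMap.ker ρ) (Finsupp.single m 1) : N) ⊗ₜ[ℤ] m))
        = QuotientAddGroup.mk ((1 : Rᵐᵒᵖ) ⊗ₜ[ℤ] (c m • m)) := by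
      have h2 : j (Submodule.mkQ (LinearMap.ker ρ) (Finsupp.single m 1)) = op (c m) • 1 := by
        change ρ (Finsupp.single m 1) = _
        simp [ρ]
      rw [← balanced_smul, ← h2]
      rfl
    have h3 : ∑ m ∈ c.support, c m • m = 0 := hc
    rw [map_sum, Finset.sum_congr rfl fun m _ => h1 m]
    refine (map_sum (QuotientAddGroup.mk' _) (fun m => (1 : Rᵐᵒᵖ) ⊗ₜ[ℤ] (c m • m))
      c.support).symm.trans ?_
    rw [← TensorProduct.tmul_sum, h3, TensorProduct.tmul_zero, map_zero]
  have ht0 : t = 0 := h N _ j hj (ht.trans (map_zero _).symm)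
  have hv : (fun m => if m ∈ c.support then m else 0) ∈ B := by
    have h1 : Φ t = 0 := by rw [ht0, map_zero]
    have h2 : Φ t = QuotientAddGroup.mk (∑ m ∈ c.support, fun m' =>
        unop ((Finsupp.single m 1 : M →₀ Rᵐᵒᵖ) m') • m) := by
      rw [map_sum, ← QuotientAddGroup.mk'_apply, map_sum]
      rfl
    rw [h2, QuotientAddGroup.eq_zero_iff] at h1
    convert h1 using 1
    funext m'
    rw [Finset.sum_apply]
    have h3 (m : M) : unop ((Finsupp.single m 1 : M →₀ Rᵐᵒᵖ) m') • m = if m' = m then m else 0 := by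
      rw [Finsupp.single_apply]
      split_ifs with h h' h' <;> simp_all
    simp only [h3, Finset.sum_ite_eq]
  -- Families in `B` lift to families in `R^(M)` that satisfy the relation with coefficients `c`;
  -- such a lift gives the values of `β` on the support of `c`.
  have key : ∀ v ∈ B, ∃ b : M → (M →₀ R), (∀ m, freeEval R M (b m) = v m) ∧
      ∑ m ∈ c.support, c m • b m = 0 := by
    intro v hv
    induction hv using AddSubgroup.closure_induction with
    | mem v hv =>
      obtain ⟨b, hb, y, rfl⟩ := hv
      refine ⟨fun m => Finsupp.single y (unop (b m)), by simp, ?_⟩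
      have h1 : ∑ m ∈ c.support, c m * unop (b m) = 0 := by
        have h2 : ∑ m ∈ b.support, b m * op (c m) = 0 := hb
        have h3 := congrArg unop h2
        rw [Finset.unop_sum, MulOpposite.unop_zero] at h3
        rw [← h3]
        simp only [MulOpposite.unop_mul, MulOpposite.unop_op]
        have e1 : ∑ m ∈ c.support, c m * unop (b m) =
            ∑ m ∈ c.support ∪ b.support, c m * unop (b m) :=
          Finset.sum_subset Finset.subset_union_left fun m _ hm => by
            rw [Finsupp.notMem_support_iff.1 hm, zero_mul]
        have e2 : ∑ m ∈ b.support, c m * unop (b m) =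
            ∑ m ∈ c.support ∪ b.support, c m * unop (b m) :=
          Finset.sum_subset Finset.subset_union_right fun m _ hm => by
            rw [Finsupp.notMem_support_iff.1 hm, MulOpposite.unop_zero, mul_zero]
        rw [e1, e2]
      simp only [Finsupp.smul_single, smul_eq_mul]
      refine (map_sum (Finsupp.singleAddHom y) (fun m => c m * unop (b m)) c.support).symm.trans ?_
      rw [h1, map_zero]
    | zero => exact ⟨0, by simp, by simp⟩
    | add v w _ _ hv hw =>
      obtain ⟨b, hb, hb'⟩ := hv
      obtain ⟨d, hd, hd'⟩ := hw
      exact ⟨b + d, fun m => by simp [hb, hd], by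
        simp only [Pi.add_apply, smul_add, Finset.sum_add_distrib, hb', hd', add_zero]⟩
    | neg v _ hv =>
      obtain ⟨b, hb, hb'⟩ := hv
      exact ⟨-b, fun m => by simp [hb], by
        simp only [Pi.neg_apply, smul_neg, Finset.sum_neg_distrib, hb', neg_zero]⟩
  obtain ⟨b, hb, hb'⟩ := key _ hv
  refine ⟨Finsupp.linearCombination R fun m => if m ∈ c.support then b m else Finsupp.single m 1,
    ?_, ?_⟩
  · refine Finsupp.lhom_ext' fun m => LinearMap.ext_ring ?_
    by_cases hm : m ∈ c.support
    · simp only [LinearMap.comp_apply, Finsupp.lsingle_apply, Finsupp.linearCombination_single,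
        one_smul, if_pos hm, id]
      exact (hb m).trans (if_pos hm)
    · simp only [LinearMap.comp_apply, Finsupp.lsingle_apply, Finsupp.linearCombination_single,
        one_smul, if_neg hm]
  · rw [Finsupp.linearCombination_apply, Finsupp.sum, ← hb']
    exact Finset.sum_congr rfl fun m hm => by rw [if_pos hm]

end Equational

end HUnitary

namespace HUnitary

/-! ### Closure properties of h-unitary and of h-unitary flat modules. -/

section HUnitaryModules

variable {R : Type u} [Ring R] (A : Ideal R)

/-- The submodule `A M` of `M`. -/
def unitalPart (M : Type v) [AddCommGroup M] [Module R M] : Submodule R M :=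
  Submodule.span R {x | ∃ a ∈ A, ∃ y : M, x = a • y}

/-- The modules `M` with `A M = M`. -/
def IsUnital (M : Type v) [AddCommGroup M] [Module R M] : Prop := ∀ m : M, m ∈ unitalPart A M

variable {A}

section

variable {M : Type v} {M' : Type w} [AddCommGroup M] [Module R M] [AddCommGroup M'] [Module R M']

theorem map_mem_unitalPart (f : M →ₗ[R] M') {m : M} (hm : m ∈ unitalPart A M) :
    f m ∈ unitalPart A M' := by
  rw [unitalPart] at hm
  induction hm using Submodule.span_induction with
  | mem x hx =>
    obtain ⟨a, ha, y, rfl⟩ := hx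
    exact Submodule.subset_span ⟨a, ha, f y, map_smul f a y⟩
  | zero => rw [map_zero]; exact Submodule.zero_mem _
  | add x y _ _ hx hy => rw [map_add]; exact Submodule.add_mem _ hx hy
  | smul r x _ hx => rw [map_smul]; exact Submodule.smul_mem _ _ hx

theorem IsUnital.of_surjective (h : IsUnital A M) (f : M →ₗ[R] M') (hf : Function.Surjective f) :
    IsUnital A M' := fun m => by
  obtain ⟨m, rfl⟩ := hf m
  exact map_mem_unitalPart f (h m)

theorem exists_freeEval_of_mem_unitalPart {m : M} (hm : m ∈ unitalPart A M) :
    ∃ c : M →₀ R, (∀ x, c x ∈ A) ∧ freeEval R M c = m := by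
  classical
  rw [unitalPart] at hm
  induction hm using Submodule.span_induction with
  | mem x hx =>
    obtain ⟨a, ha, y, rfl⟩ := hx
    refine ⟨Finsupp.single y a, fun x => ?_, by simp⟩
    rw [Finsupp.single_apply]
    split_ifs
    · exact ha
    · exact A.zero_mem
  | zero => exact ⟨0, fun _ => A.zero_mem, map_zero _⟩
  | add x y _ _ hx hy =>
    obtain ⟨c, hc, rfl⟩ := hx
    obtain ⟨d, hd, rfl⟩ := hy
    exact ⟨c + d, fun x => A.add_mem (hc x) (hd x), map_add _ _ _⟩
  | smul r x _ hx =>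
    obtain ⟨c, hc, rfl⟩ := hx
    exact ⟨r • c, fun x => A.mul_mem_left _ (hc x), map_smul _ _ _⟩

theorem freeEval_mem_unitalPart {X : Type*} (y : X → M) (c : X →₀ R) (hc : ∀ x, c x ∈ A) :
    (c.sum fun x r => r • y x) ∈ unitalPart A M :=
  Submodule.sum_mem _ fun x _ => Submodule.subset_span ⟨c x, hc x, y x, rfl⟩

end

variable [A.IsTwoSided]

/-- `Hom_R(M, (R/A)⁺)` is the character group of `M / AM`, which is zero only if `M = AM`. -/
theorem hom_eq_zero_iff_isUnital {M : Type u} [AddCommGroup M] [Module R M] :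
    (∀ φ : M →ₗ[R] RightDual (quotientRight A), φ = 0) ↔ IsUnital A M := by
  constructor
  · intro h m
    rw [← Submodule.Quotient.mk_eq_zero]
    refine CharacterModule.eq_zero_of_character_apply fun χ => ?_
    let φ : M →ₗ[R] RightDual (quotientRight A) :=
      { toFun := fun m => QuotientAddGroup.lift (Submodule.toAddSubgroup A)
          (AddMonoidHom.mk' (fun r => χ (Submodule.Quotient.mk (r • m)))
            (fun r s => by rw [add_smul, Submodule.Quotient.mk_add, map_add]))
          (fun a ha => by
            have : (Submodule.Quotient.mk (a • m) : M ⧸ unitalPart A M) = 0 :=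
              (Submodule.Quotient.mk_eq_zero _).2 (Submodule.subset_span ⟨a, ha, m, rfl⟩)
            exact (congrArg χ this).trans (map_zero χ))
        map_add' := fun m m' => RightDual.ext fun x => by
          obtain ⟨r, rfl⟩ := QuotientAddGroup.mk_surjective x
          change χ (Submodule.Quotient.mk (r • (m + m'))) = χ _ + χ _
          rw [smul_add, Submodule.Quotient.mk_add, map_add]
        map_smul' := fun s m => RightDual.ext fun x => by
          obtain ⟨r, rfl⟩ := QuotientAddGroup.mk_surjective x
          change χ (Submodule.Quotient.mk (r • s • m)) = χ (Submodule.Quotient.mk ((r * s) • m))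
          rw [mul_smul] }
    have h1 : χ (Submodule.Quotient.mk ((1 : R) • m)) = 0 :=
      DFunLike.congr_fun (LinearMap.congr_fun (h φ) m)
        (QuotientAddGroup.mk (1 : R) : R ⧸ Submodule.toAddSubgroup A)
    rwa [one_smul] at h1
  · intro h φ
    refine LinearMap.ext fun m => ?_
    have hm := h m
    rw [unitalPart] at hm
    induction hm using Submodule.span_induction with
    | mem x hx =>
      obtain ⟨a, ha, y, rfl⟩ := hx
      rw [map_smul]
      refine RightDual.ext fun x => ?_
      obtain ⟨r, rfl⟩ := QuotientAddGroup.mk_surjective (s := Submodule.toAddSubgroup A) x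
      refine (congrArg (φ y) ?_).trans (map_zero (φ y))
      change (Ideal.Quotient.mk A (r * a) : R ⧸ A) = 0
      exact Ideal.Quotient.eq_zero_iff_mem.2 (A.mul_mem_left r ha)
    | zero => rw [map_zero, map_zero]
    | add x y _ _ hx hy => rw [map_add, map_add, hx, hy]
    | smul r x _ hx => rw [map_smul, map_smul, hx]

variable (A) in
/-- The h-unitary modules, as a predicate on unbundled modules. -/
abbrev IsHUnitary (M : Type u) [AddCommGroup M] [Module R M] : Prop :=
  hUnitary A (ModuleCat.of R M)

variable (A) in
/-- The h-unitary flat modules, as a predicate on unbundled modules. -/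
abbrev IsHUnitaryFlat (M : Type u) [AddCommGroup M] [Module R M] : Prop :=
  hUnitaryFlat A (ModuleCat.of R M)

section

variable {M M₁ M₂ M₃ : Type u} [AddCommGroup M] [Module R M] [AddCommGroup M₁] [Module R M₁]
  [AddCommGroup M₂] [Module R M₂]
  [AddCommGroup M₃] [Module R M₃] {f : M₁ →ₗ[R] M₂} {g : M₂ →ₗ[R] M₃}

theorem isHUnitary_iff : IsHUnitary A M ↔
    ∀ n, ExtVanishes R n M (RightDual (quotientRight A)) :=
  forall_congr' fun n => isZero_tor_iff _ n _

theorem IsHUnitary.isUnital (h : IsHUnitary A M) : IsUnital A M :=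
  hom_eq_zero_iff_isUnital.1 (extVanishes_zero_iff.1 (isHUnitary_iff.1 h 0))

theorem IsHUnitary.mid (hf : Function.Injective f) (hfg : Function.Exact f g)
    (hg : Function.Surjective g) (h₁ : IsHUnitary A M₁) (h₃ : IsHUnitary A M₃) :
    IsHUnitary A M₂ :=
  isHUnitary_iff.2 fun n =>
    ExtVanishes.mid hf hfg hg (isHUnitary_iff.1 h₁ n) (isHUnitary_iff.1 h₃ n)

theorem IsHUnitary.left (hf : Function.Injective f) (hfg : Function.Exact f g)
    (hg : Function.Surjective g) (h₂ : IsHUnitary A M₂) (h₃ : IsHUnitary A M₃) :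
    IsHUnitary A M₁ :=
  isHUnitary_iff.2 fun n =>
    ExtVanishes.left hf hfg hg (isHUnitary_iff.1 h₂ n) (isHUnitary_iff.1 h₃ (n + 1))

theorem IsHUnitary.right (hf : Function.Injective f) (hfg : Function.Exact f g)
    (hg : Function.Surjective g) (h₁ : IsHUnitary A M₁) (h₂ : IsHUnitary A M₂) :
    IsHUnitary A M₃ :=
  isHUnitary_iff.2 fun n => by
    obtain _ | n := n
    -- The long exact sequence gives no information in degree zero here; instead `AM = M` passes to
    -- quotients.
    · exact extVanishes_zero_iff.2 (hom_eq_zero_iff_isUnital.2 (h₂.isUnital.of_surjective g hg))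
    · exact ExtVanishes.right_succ hf hfg hg (isHUnitary_iff.1 h₁ n) (isHUnitary_iff.1 h₂ (n + 1))

theorem IsHUnitary.of_retract (h : IsHUnitary A M₁) (i : M₂ →ₗ[R] M₁)
    (r : M₁ →ₗ[R] M₂) (hr : r ∘ₗ i = LinearMap.id) : IsHUnitary A M₂ :=
  isHUnitary_iff.2 fun n => (isHUnitary_iff.1 h n).of_retract i r hr

theorem IsHUnitary.of_linearEquiv (h : IsHUnitary A M₁) (e : M₁ ≃ₗ[R] M₂) : IsHUnitary A M₂ :=
  h.of_retract e.symm.toLinearMap e.toLinearMap (by ext; simp)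

theorem isHUnitary_finsupp {ι : Type u} (h : IsHUnitary A M) : IsHUnitary A (ι →₀ M) :=
  isHUnitary_iff.2 fun n => extVanishes_finsupp (isHUnitary_iff.1 h n)

theorem isHUnitary_prod (h₁ : IsHUnitary A M₁) (h₂ : IsHUnitary A M₂) :
    IsHUnitary A (M₁ × M₂) :=
  IsHUnitary.mid (f := LinearMap.inl R M₁ M₂) (g := LinearMap.snd R M₁ M₂)
    LinearMap.inl_injective Function.Exact.inl_snd LinearMap.snd_surjective h₁ h₂

/-- Flatness makes Tor vanish in positive degrees, so only `R/A ⊗ M = 0` has to be checked. -/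
theorem isHUnitaryFlat_of_isUnital (h : IsFlat (ModuleCat.of R M)) (hM : IsUnital A M) :
    IsHUnitaryFlat A M :=
  ⟨isHUnitary_iff.2 fun n => by
    obtain _ | n := n
    · exact extVanishes_zero_iff.2 (hom_eq_zero_iff_isUnital.2 hM)
    · exact h.extVanishes n _, h⟩

theorem IsHUnitaryFlat.mid (hf : Function.Injective f) (hfg : Function.Exact f g)
    (hg : Function.Surjective g) (h₁ : IsHUnitaryFlat A M₁) (h₃ : IsHUnitaryFlat A M₃) :
    IsHUnitaryFlat A M₂ :=
  ⟨IsHUnitary.mid hf hfg hg h₁.1 h₃.1, (isFlat_iff_extVanishes _).2 fun N =>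
    ExtVanishes.mid hf hfg hg (h₁.2.extVanishes 0 N) (h₃.2.extVanishes 0 N)⟩

theorem IsHUnitaryFlat.left (hf : Function.Injective f) (hfg : Function.Exact f g)
    (hg : Function.Surjective g) (h₂ : IsHUnitaryFlat A M₂) (h₃ : IsHUnitaryFlat A M₃) :
    IsHUnitaryFlat A M₁ :=
  ⟨IsHUnitary.left hf hfg hg h₂.1 h₃.1, (isFlat_iff_extVanishes _).2 fun N =>
    ExtVanishes.left hf hfg hg (h₂.2.extVanishes 0 N) (h₃.2.extVanishes 1 N)⟩

theorem IsHUnitaryFlat.of_retract (h : IsHUnitaryFlat A M₁) (i : M₂ →ₗ[R] M₁)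
    (r : M₁ →ₗ[R] M₂) (hr : r ∘ₗ i = LinearMap.id) : IsHUnitaryFlat A M₂ :=
  ⟨IsHUnitary.of_retract h.1 i r hr, (isFlat_iff_extVanishes _).2 fun N =>
    (h.2.extVanishes 0 N).of_retract i r hr⟩

theorem IsHUnitaryFlat.of_linearEquiv (h : IsHUnitaryFlat A M₁) (e : M₁ ≃ₗ[R] M₂) :
    IsHUnitaryFlat A M₂ :=
  h.of_retract e.symm.toLinearMap e.toLinearMap (by ext; simp)

theorem isHUnitaryFlat_finsupp {ι : Type u} (h : IsHUnitaryFlat A M) :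
    IsHUnitaryFlat A (ι →₀ M) :=
  ⟨isHUnitary_finsupp h.1, (isFlat_iff_extVanishes _).2 fun N =>
    extVanishes_finsupp (h.2.extVanishes 0 N)⟩

end

end HUnitaryModules

/-! ### Telescopes of free modules: flat unital modules that cover unital ones. -/

section Telescope

variable {R : Type u} [Ring R] {V : Type v} [AddCommGroup V] [Module R V] (σ : V →ₗ[R] V)

/-- The transition maps of the sequence `V → V → ⋯` of copies of an endomorphism. -/
def telescopeMap (i j : ℕ) (_ : i ≤ j) : V →ₗ[R] V := σ ^ (j - i)

instance : DirectedSystem (fun _ : ℕ => V) (telescopeMap σ · · ·) where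
  map_self i x := by simp [telescopeMap]
  map_map k j i hij hjk x := by
    change (σ ^ (k - j)) ((σ ^ (j - i)) x) = (σ ^ (k - i)) x
    rw [← Module.End.mul_apply, ← pow_add]
    congr 2
    omega

/-- The direct limit of the sequence `V → V → ⋯` of copies of an endomorphism. -/
def Telescope : Type v := Module.DirectLimit (fun _ : ℕ => V) (telescopeMap σ)

namespace Telescope

noncomputable instance : AddCommGroup (Telescope σ) :=
  inferInstanceAs (AddCommGroup (Module.DirectLimit (fun _ : ℕ => V) (telescopeMap σ)))

noncomputable instance : Module R (Telescope σ) :=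
  inferInstanceAs (Module R (Module.DirectLimit (fun _ : ℕ => V) (telescopeMap σ)))

/-- The `k`-th structure map. -/
noncomputable def of (k : ℕ) : V →ₗ[R] Telescope σ :=
  Module.DirectLimit.of R ℕ (fun _ : ℕ => V) (telescopeMap σ) k

theorem of_pow (k j : ℕ) (v : V) : of σ (k + j) ((σ ^ j) v) = of σ k v := by
  have := Module.DirectLimit.of_f (R := R) (f := telescopeMap σ) (hij := Nat.le_add_right k j)
    (x := v)
  rw [telescopeMap, Nat.add_sub_cancel_left] at this
  exact this

theorem exists_pow_eq_zero {k : ℕ} {v : V} (h : of σ k v = 0) : ∃ j, (σ ^ j) v = 0 := by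
  obtain ⟨j, hj, h⟩ := Module.DirectLimit.of.zero_exact h
  exact ⟨j - k, h⟩

theorem exists_of (w : Telescope σ) : ∃ k v, of σ k v = w := Module.DirectLimit.exists_of w

theorem exists_common (s : Finset (Telescope σ)) :
    ∃ (k : ℕ) (v : Telescope σ → V), ∀ w ∈ s, of σ k (v w) = w := by
  choose k v h using exists_of σ
  refine ⟨s.sup k, fun w => (σ ^ (s.sup k - k w)) (v w), fun w hw => ?_⟩
  obtain ⟨d, hd⟩ := Nat.exists_eq_add_of_le (Finset.le_sup (f := k) hw)
  change of σ (s.sup k) ((σ ^ (s.sup k - k w)) (v w)) = w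
  rw [hd, Nat.add_sub_cancel_left, of_pow, h]

variable {σ} {P : Type w} [AddCommGroup P] [Module R P]

/-- The map from the telescope induced by a map invariant under the endomorphism. -/
noncomputable def desc (ε : V →ₗ[R] P) (h : ε ∘ₗ σ = ε) : Telescope σ →ₗ[R] P :=
  Module.DirectLimit.lift R ℕ (fun _ : ℕ => V) (telescopeMap σ) (fun _ => ε) (fun i j hij x => by
    change ε ((σ ^ (j - i)) x) = ε x
    induction j - i with
    | zero => simp
    | succ n ih => rw [pow_succ', Module.End.mul_apply, ← LinearMap.comp_apply, h, ih])

@[simp] theorem desc_of (ε : V →ₗ[R] P) (h : ε ∘ₗ σ = ε) (k : ℕ) (v : V) :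
    desc ε h (of σ k v) = ε v :=
  Module.DirectLimit.lift_of _ _ _

end Telescope

end Telescope

section FreeTelescope

variable {R : Type u} [Ring R] {X : Type v} (σ : (X →₀ R) →ₗ[R] (X →₀ R))

theorem Telescope.of_eq_sum (k : ℕ) (c : X →₀ R) :
    Telescope.of σ k c = c.sum fun x r => r • Telescope.of σ k (Finsupp.single x 1) := by
  conv_lhs => rw [← Finsupp.sum_single c]
  rw [Finsupp.sum, map_sum]
  refine Finset.sum_congr rfl fun x _ => ?_
  change _ = c x • Telescope.of σ k (Finsupp.single x 1)
  rw [← map_smul, Finsupp.smul_single_one]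

/-- The coefficients of an element of the telescope that eventually divide all others. -/
theorem Telescope.exists_rows (l : Telescope σ) :
    ∃ (ψ : ℕ → (X →₀ R)) (y : ℕ → X → Telescope σ),
      (∀ j, (ψ j).sum (fun x r => r • y j x) = l) ∧
      ∀ c : Telescope σ →₀ R, freeEval R (Telescope σ) c = l →
        ∃ (j : ℕ) (b : Telescope σ → (X →₀ R)), ψ j = c.sum fun w r => r • b w := by
  obtain ⟨k, v, rfl⟩ := Telescope.exists_of σ l
  -- If `l` is represented by `v` at stage `k`, then `σ^j v` represents it at stage `k + j`; the
  -- rows are the coefficient vectors of these representatives.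
  refine ⟨fun j => (σ ^ j) v, fun j x => Telescope.of σ (k + j) (Finsupp.single x 1),
    fun j => by rw [← Telescope.of_eq_sum, Telescope.of_pow], fun c hc => ?_⟩
  obtain ⟨k', b, hb⟩ := Telescope.exists_common σ c.support
  -- The two representatives of `l`, pushed to the common stage `k + k'`, have the same class, hence
  -- agree after finitely many further applications of `σ`.
  have h1 : Telescope.of σ (k + k') ((σ ^ k') v - c.sum fun w r => r • (σ ^ k) (b w)) = 0 := by
    rw [map_sub, Telescope.of_pow, ← hc, Finsupp.linearCombination_apply, Finsupp.sum, Finsupp.sum,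
      map_sum, sub_eq_zero]
    refine Finset.sum_congr rfl fun w hw => ?_
    rw [map_smul, add_comm k k', Telescope.of_pow, hb w hw, id]
  obtain ⟨j, hj⟩ := Telescope.exists_pow_eq_zero σ h1
  refine ⟨j + k', fun w => (σ ^ (j + k)) (b w), ?_⟩
  rw [map_sub, sub_eq_zero, Finsupp.sum, map_sum] at hj
  change (σ ^ (j + k')) v = _
  rw [pow_add, Module.End.mul_apply, hj]
  refine Finset.sum_congr rfl fun w _ => ?_
  change _ = c w • (σ ^ (j + k)) (b w)
  rw [map_smul, pow_add, Module.End.mul_apply]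

/-- A relation in the limit already holds at some finite stage, which is a free module. Rewriting
the elements in its basis, mapped to the telescope, turns the relation into an identity. -/
theorem Telescope.isEquational : IsEquational R (Telescope σ) := by
  classical
  intro c hc
  obtain ⟨k, v, hv⟩ := Telescope.exists_common σ c.support
  have h1 : Telescope.of σ k (c.sum fun w r => r • v w) = 0 := by
    rw [← hc, Finsupp.linearCombination_apply, Finsupp.sum, Finsupp.sum, map_sum]
    exact Finset.sum_congr rfl fun w hw => by rw [map_smul, hv w hw, id]
  obtain ⟨j, hj⟩ := Telescope.exists_pow_eq_zero σ h1
  let τ : (X →₀ R) →ₗ[R] (Telescope σ →₀ R) :=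
    Finsupp.lmapDomain R R fun x => Telescope.of σ (k + j) (Finsupp.single x 1)
  have hτ : freeEval R (Telescope σ) ∘ₗ τ = Telescope.of σ (k + j) :=
    Finsupp.lhom_ext' fun x => LinearMap.ext_ring (by simp [τ])
  refine ⟨Finsupp.linearCombination R fun w => if w ∈ c.support then τ ((σ ^ j) (v w)) else
    Finsupp.single w 1, Finsupp.lhom_ext' fun w => LinearMap.ext_ring ?_, ?_⟩
  · by_cases hw : w ∈ c.support
    · simp only [LinearMap.comp_apply, Finsupp.lsingle_apply, Finsupp.linearCombination_single,
        one_smul, if_pos hw, id]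
      exact (LinearMap.congr_fun hτ _).trans ((Telescope.of_pow σ k j _).trans (hv w hw))
    · simp only [LinearMap.comp_apply, Finsupp.lsingle_apply, Finsupp.linearCombination_single,
        one_smul, if_neg hw]
  · rw [Finsupp.linearCombination_apply, Finsupp.sum]
    have : ∑ w ∈ c.support, c w • τ ((σ ^ j) (v w)) = 0 := by
      rw [← map_zero τ, ← hj, Finsupp.sum, map_sum, map_sum]
      exact Finset.sum_congr rfl fun w _ => by rw [map_smul, map_smul]
    rw [← this]
    exact Finset.sum_congr rfl fun w hw => by rw [if_pos hw]

/-- A basis vector at stage `k` equals its image under `σ` at stage `k + 1`, whose coefficients lie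
in `A`. -/
theorem Telescope.isUnital {A : Ideal R} (hσ : ∀ x y, σ (Finsupp.single x 1) y ∈ A) :
    IsUnital A (Telescope σ) := fun l => by
  obtain ⟨k, v, rfl⟩ := Telescope.exists_of σ l
  rw [Telescope.of_eq_sum]
  refine Submodule.sum_mem _ fun x _ => Submodule.smul_mem _ _ ?_
  rw [← Telescope.of_pow σ k 1, pow_one, Telescope.of_eq_sum]
  exact freeEval_mem_unitalPart _ _ (hσ x)

end FreeTelescope

section UnitalCover

variable {R : Type u} [Ring R] {A : Ideal R} {M : Type u} [AddCommGroup M] [Module R M]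

theorem IsUnital.exists_endomorphism (h : IsUnital A M) :
    ∃ σ : (M →₀ R) →ₗ[R] (M →₀ R), freeEval R M ∘ₗ σ = freeEval R M ∧
      ∀ x y, σ (Finsupp.single x 1) y ∈ A := by
  choose c hc h using fun m : M => exists_freeEval_of_mem_unitalPart (h m)
  exact ⟨Finsupp.linearCombination R c, Finsupp.lhom_ext' fun m => LinearMap.ext_ring (by simp [h]),
    fun x y => by simpa using hc x y⟩

/-- Every unital module is the quotient of a unital telescope of free modules. -/
theorem IsUnital.exists_telescope (h : IsUnital A M) :
    ∃ (σ : (M →₀ R) →ₗ[R] (M →₀ R)) (p : Telescope σ →ₗ[R] M),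
      IsUnital A (Telescope σ) ∧ Function.Surjective p := by
  obtain ⟨σ, hσ, hA⟩ := h.exists_endomorphism
  exact ⟨σ, Telescope.desc _ hσ, Telescope.isUnital σ hA,
    fun m => ⟨Telescope.of σ 0 (Finsupp.single m 1), by simp⟩⟩

variable [A.IsTwoSided]

theorem isHUnitaryFlat_telescope {X : Type u} {σ : (X →₀ R) →ₗ[R] (X →₀ R)}
    (h : IsUnital A (Telescope σ)) : IsHUnitaryFlat A (Telescope σ) :=
  isHUnitaryFlat_of_isUnital (M := Telescope σ)
    (IsEquational.isFlat (M := ModuleCat.of R (Telescope σ)) (Telescope.isEquational σ)) h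

/-- Every unital module is the quotient of an h-unitary flat module. -/
theorem IsUnital.exists_flat_cover (h : IsUnital A M) :
    ∃ (F : ModuleCat.{u} R) (p : F →ₗ[R] M), hUnitaryFlat A F ∧ Function.Surjective p := by
  obtain ⟨σ, p, h, hp⟩ := h.exists_telescope
  exact ⟨ModuleCat.of R (Telescope σ), p, isHUnitaryFlat_telescope h, hp⟩

end UnitalCover

end HUnitary

namespace HUnitary

/-! ### Cardinal arithmetic and closing-off arguments. -/

section Cardinality

variable {κ : Cardinal.{u}}

theorem mk_iUnion_le_of_le (hκ : ℵ₀ ≤ κ) {ι α : Type u} (f : ι → Set α) (hι : #ι ≤ κ)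
    (hf : ∀ i, #(f i) ≤ κ) : #(⋃ i, f i) ≤ κ :=
  (Cardinal.mk_iUnion_le_sum_mk.trans (Cardinal.sum_le_sum _ (fun _ => κ) hf)).trans (by
    rw [Cardinal.sum_const']
    exact Cardinal.mul_le_of_le hκ hι le_rfl)

theorem mk_iUnion_nat_le_of_le (hκ : ℵ₀ ≤ κ) {α : Type u} (f : ℕ → Set α)
    (hf : ∀ i, #(f i) ≤ κ) : #(⋃ i, f i) ≤ κ := by
  rw [← Equiv.ulift.{u}.surjective.iUnion_comp f]
  exact mk_iUnion_le_of_le hκ _ (by simpa using hκ) fun i => hf _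

theorem mk_biUnion_le_of_le (hκ : ℵ₀ ≤ κ) {ι α : Type u} {s : Set ι} (f : ι → Set α) (hs : #s ≤ κ)
    (hf : ∀ i, #(f i) ≤ κ) : #(⋃ i ∈ s, f i) ≤ κ := by
  rw [Set.biUnion_eq_iUnion]
  exact mk_iUnion_le_of_le hκ _ hs fun i => hf i

theorem mk_union_le_of_le (hκ : ℵ₀ ≤ κ) {α : Type u} {s t : Set α} (hs : #s ≤ κ) (ht : #t ≤ κ) :
    #(s ∪ t : Set α) ≤ κ :=
  (Cardinal.mk_union_le s t).trans (Cardinal.add_le_of_le hκ hs ht)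

theorem mk_finset_coe_le (hκ : ℵ₀ ≤ κ) {α : Type u} (s : Finset α) : #(s : Set α) ≤ κ :=
  (Cardinal.finset_card_lt_aleph0 s).le.trans hκ

theorem mk_finset_le_of_le (hκ : ℵ₀ ≤ κ) {α : Type u} (hα : #α ≤ κ) : #(Finset α) ≤ κ := by
  classical
  exact (Cardinal.mk_le_of_surjective List.toFinset_surjective).trans
    ((Cardinal.mk_list_le_max α).trans (max_le hκ hα))

theorem mk_finsupp_le_of_le (hκ : ℵ₀ ≤ κ) {α β : Type u} [Zero β] (hα : #α ≤ κ) (hβ : #β ≤ κ) :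
    #(α →₀ β) ≤ κ :=
  (Cardinal.mk_le_of_injective (Finsupp.graph_injective α β)).trans
    (mk_finset_le_of_le hκ (by
      rw [← Cardinal.mul_def]
      exact Cardinal.mul_le_of_le hκ hα hβ))

/-- A set of at most `κ` elements is contained in such a set closed under an operation that attaches
at most `κ` elements to every finite set. -/
theorem exists_closed_set (hκ : ℵ₀ ≤ κ) {Ω : Type u} (c : Finset Ω → Set Ω)
    (hc : ∀ J, #(c J) ≤ κ) (X₀ : Set Ω) (h₀ : #X₀ ≤ κ) :
    ∃ X : Set Ω, X₀ ⊆ X ∧ #X ≤ κ ∧ ∀ J : Finset Ω, (J : Set Ω) ⊆ X → c J ⊆ X := by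
  classical
  let S (X : Set Ω) : Set Ω := X ∪ ⋃ J : Finset X, c (J.map (Function.Embedding.subtype _))
  let X : ℕ → Set Ω := fun n => S^[n] X₀
  have hX (n : ℕ) : X (n + 1) = S (X n) := Function.iterate_succ_apply' S n X₀
  have hmono : Monotone X := monotone_nat_of_le_succ fun n => by
    rw [hX]
    exact Set.subset_union_left
  refine ⟨⋃ n, X n, Set.subset_iUnion X 0, mk_iUnion_nat_le_of_le hκ _ fun n => ?_, fun J hJ => ?_⟩
  · induction n with
    | zero => exact h₀
    | succ n ih =>
      rw [hX]
      exact mk_union_le_of_le hκ ih (mk_iUnion_le_of_le hκ _ (mk_finset_le_of_le hκ ih)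
        fun J => hc _)
  · obtain ⟨n, hn⟩ : ∃ n, (J : Set Ω) ⊆ X n := by
      choose n hn using fun x : J => Set.mem_iUnion.1 (hJ x.2)
      exact ⟨Finset.univ.sup n, fun x hx => hmono (Finset.le_sup (Finset.mem_univ ⟨x, hx⟩)) (hn ⟨x, hx⟩)⟩
    refine subset_trans ?_ (Set.subset_iUnion X (n + 1))
    rw [hX]
    refine subset_trans ?_ Set.subset_union_right
    refine subset_trans (subset_of_eq ?_) (Set.subset_iUnion _ (J.subtype (· ∈ X n)))
    rw [Finset.subtype_map_of_mem fun x hx => hn hx]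

end Cardinality

section ClosedSubmodules

variable {R : Type u} [Ring R] {κ : Cardinal.{u}}

theorem exists_closed_submodule (hκ : ℵ₀ ≤ κ) {M : Type u} [AddCommGroup M] [Module R M]
    (hspan : ∀ X : Set M, #X ≤ κ → #(Submodule.span R X) ≤ κ) (c : M → Set M)
    (hc : ∀ m, #(c m) ≤ κ) (X₀ : Set M) (h₀ : #X₀ ≤ κ) :
    ∃ S : Submodule R M, X₀ ⊆ S ∧ #S ≤ κ ∧ ∀ m ∈ S, c m ⊆ S := by
  classical
  -- Closing also under spans of finite subsets makes the resulting set a submodule, without adding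
  -- elements afterwards.
  obtain ⟨X, h, hX, hcl⟩ := exists_closed_set hκ
    (fun J : Finset M => (Submodule.span R (J : Set M) : Set M) ∪ ⋃ m ∈ (J : Set M), c m)
    (fun J => mk_union_le_of_le hκ (hspan _ (mk_finset_coe_le hκ J))
      (mk_biUnion_le_of_le hκ c (mk_finset_coe_le hκ J) hc)) X₀ h₀
  have hsp : (Submodule.span R X : Set M) = X := by
    refine Set.Subset.antisymm (fun m hm => ?_) Submodule.subset_span
    obtain ⟨J, hJ, hm⟩ := Submodule.mem_span_finite_of_mem_span hm
    exact hcl J hJ (Or.inl hm)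
  refine ⟨Submodule.span R X, h.trans Submodule.subset_span, ?_, fun m hm => ?_⟩
  · exact (Cardinal.mk_congr (Equiv.setCongr hsp)).trans_le hX
  · rw [hsp]
    have hm' : m ∈ X := by rwa [← SetLike.mem_coe, hsp] at hm
    refine subset_trans ?_ (hcl {m} (by simpa using hm'))
    exact fun y hy => Or.inr (by simpa using hy)

/-- Up to isomorphism there is only a set of modules of bounded cardinality. -/
theorem exists_representatives (R : Type u) [Ring R] (κ : Cardinal.{u}) :
    ∃ (I : Type u) (X : I → ModuleCat.{u} R), ∀ M : ModuleCat.{u} R, #M ≤ κ →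
      ∃ i, Nonempty (M ≅ X i) := by
  refine ⟨Σ (S : Set κ.out) (_ : AddCommGroup S), Module R S,
    fun i => letI := i.2.1; letI := i.2.2; ModuleCat.of R i.1, fun M hM => ?_⟩
  rw [← κ.mk_out] at hM
  obtain ⟨e⟩ := hM
  let e' : Set.range e ≃ M := (Equiv.ofInjective e e.injective).symm
  let := e'.addCommGroup
  let := e'.module R
  exact ⟨⟨Set.range e, inferInstance, inferInstance⟩, ⟨(e'.linearEquiv R).symm.toModuleIso⟩⟩

end ClosedSubmodules

/-! ### Existence of an h-unitary flat generator. -/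

section Generator

variable {R : Type u} [Ring R] (A : Ideal R)

/-- Every element is a combination with coefficients in `A` of finitely many elements; closing `x`
under the choice of such elements yields a small submodule that is again unital. -/
theorem IsUnital.exists_small {M : Type u} [AddCommGroup M] [Module R M] {A : Ideal R}
    (h : IsUnital A M) (x : M) : ∃ S : Submodule R M, x ∈ S ∧ #S ≤ max #R ℵ₀ ∧ IsUnital A S := by
  classical
  choose c hc hcm using fun m : M => exists_freeEval_of_mem_unitalPart (h m)
  have hκ : ℵ₀ ≤ max #R ℵ₀ := le_max_right _ _
  have hspan (X : Set M) (hX : #X ≤ max #R ℵ₀) : #(Submodule.span R X) ≤ max #R ℵ₀ := by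
    have h1 := Cardinal.mk_le_of_surjective (LinearMap.surjective_rangeRestrict
      (Finsupp.linearCombination R (Subtype.val : X → M)))
    rw [Finsupp.range_linearCombination, Subtype.range_coe] at h1
    exact h1.trans (mk_finsupp_le_of_le hκ hX (le_max_left _ _))
  obtain ⟨S, hS, hSκ, hcl⟩ := exists_closed_submodule (R := R) hκ (M := M) hspan
    (fun m => ((c m).support : Set M)) (fun m => mk_finset_coe_le hκ _) {x} (by
      rw [Cardinal.mk_singleton]
      exact Cardinal.one_le_aleph0.trans hκ)
  refine ⟨S, hS rfl, hSκ, fun m => ?_⟩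
  have hm : m = (c m).sum fun y r => r • (if hy : y ∈ S then (⟨y, hy⟩ : S) else 0) := by
    refine Subtype.ext ?_
    conv_lhs => rw [← hcm m]
    rw [Finsupp.sum, AddSubmonoidClass.coe_finsetSum, freeEval, Finsupp.linearCombination_apply]
    refine Finset.sum_congr rfl fun y hy => ?_
    have hy' : y ∈ S := hcl m m.2 hy
    simp [hy']
  rw [hm]
  exact freeEval_mem_unitalPart _ _ (hc m)

theorem isUnital_dfinsupp {I : Type u} (X : I → Type u) [∀ i, AddCommGroup (X i)]
    [∀ i, Module R (X i)] (h : ∀ i, IsUnital A (X i)) : IsUnital A (Π₀ i, X i) := fun m => by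
  classical
  induction m using DFinsupp.induction with
  | h0 => exact Submodule.zero_mem _
  | ha i b f _ _ hf =>
    exact Submodule.add_mem _ (map_mem_unitalPart (DFinsupp.lsingle (R := R) i) (h i b)) hf

theorem exists_unital_generator : ∃ U : ModuleCat.{u} R, IsUnital A U ∧
    ∀ (M : Type u) [AddCommGroup M] [Module R M], IsUnital A M → ∀ x : M,
      ∃ f : U →ₗ[R] M, x ∈ LinearMap.range f := by
  classical
  obtain ⟨I, X, hX⟩ := exists_representatives R (max #R ℵ₀)
  refine ⟨ModuleCat.of R (Π₀ i : {i // IsUnital A (X i)}, X i.1),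
    isUnital_dfinsupp A _ fun i => i.2, fun M _ _ hM x => ?_⟩
  obtain ⟨S, hx, hS, hSA⟩ := hM.exists_small x
  obtain ⟨i, ⟨e⟩⟩ := hX (ModuleCat.of R S) hS
  have hi : IsUnital A (X i) := hSA.of_surjective e.toLinearEquiv.toLinearMap
    e.toLinearEquiv.surjective
  refine ⟨S.subtype ∘ₗ e.toLinearEquiv.symm.toLinearMap ∘ₗ
    DFinsupp.lapply (R := R) (M := fun i : {i // IsUnital A (X i)} => X i.1) ⟨i, hi⟩,
    DFinsupp.single ⟨i, hi⟩ (e.toLinearEquiv ⟨x, hx⟩), ?_⟩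
  simp

/-- The direct sum `U` of representatives of the small unital modules reaches every element of every
unital module, and a flat cover of `U` inherits this. -/
theorem exists_isFlatGenerator [A.IsTwoSided] : ∃ G : ModuleCat.{u} R, IsFlatGenerator A G := by
  obtain ⟨U, hU, h⟩ := exists_unital_generator A
  obtain ⟨G, p, hG, hp⟩ := hU.exists_flat_cover
  refine ⟨G, hG, fun M hM => ?_⟩
  choose f hf using h M (IsHUnitary.isUnital hM)
  refine ⟨M, Finsupp.lsum ℕ fun m => f m ∘ₗ p, fun m => ?_⟩
  obtain ⟨u, hu⟩ := hf m
  obtain ⟨g, rfl⟩ := hp u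
  exact ⟨Finsupp.single m g, by simpa using hu⟩

end Generator

end HUnitary

namespace HUnitary

/-! ### Coefficient rows bounded by the size of the generator rather than of the ring. -/

section Rows

variable {R : Type u} [Ring R] {A : Ideal R} [A.IsTwoSided] {G : ModuleCat.{u} R}
  {κ : Cardinal.{u}}

theorem mk_supported_le (hκ : ℵ₀ ≤ κ) {ι M : Type u} [AddCommGroup M] [Module R M] {s : Set ι}
    (hs : #s ≤ κ) (hM : #M ≤ κ) : #(Finsupp.supported M R s) ≤ κ :=
  (Cardinal.mk_congr (Finsupp.supportedEquivFinsupp (R := R) s).toEquiv).trans_le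
    (mk_finsupp_le_of_le hκ hs hM)

/-- Although `|R|` may exceed `κ`, the span lies in the image of a sum of at most `κ` copies of `G`,
obtained by lifting the given elements. -/
theorem IsFlatGenerator.mk_span_le (hG : IsFlatGenerator A G) (hκ : ℵ₀ ≤ κ) (hGκ : #G ≤ κ)
    {M : Type u} [AddCommGroup M] [Module R M] (hM : IsHUnitary A M) (X : Set M) (hX : #X ≤ κ) :
    #(Submodule.span R X) ≤ κ := by
  obtain ⟨ι, p, hp⟩ := hG.generates _ hM
  choose q hq using hp
  let s : Set ι := ⋃ x ∈ X, ((q x).support : Set ι)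
  have hs : #s ≤ κ := mk_biUnion_le_of_le hκ _ hX fun x => mk_finset_coe_le hκ _
  have hle : Submodule.span R X ≤ (Finsupp.supported G R s).map p :=
    Submodule.span_le.2 fun x hx => ⟨q x, fun i hi => Set.mem_biUnion hx hi, hq x⟩
  refine (Cardinal.mk_le_mk_of_subset (SetLike.coe_subset_coe.2 hle)).trans ?_
  rw [Submodule.map_coe]
  exact Cardinal.mk_image_le.trans (mk_supported_le hκ hs hGκ)

theorem IsFlatGenerator.exists_countable_cover (hG : IsFlatGenerator A G) {H : Type u}
    [AddCommGroup H] [Module R H] (hH : IsHUnitary A H) (s : Finset H) :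
    ∃ q : (ℕ →₀ G) →ₗ[R] H, ∀ x ∈ s, x ∈ LinearMap.range q := by
  classical
  obtain ⟨ι, p, hp⟩ := hG.generates _ hH
  choose y hy using hp
  let T : Finset ι := s.biUnion fun x => (y x).support
  obtain hι | ⟨⟨i₀⟩⟩ := isEmpty_or_nonempty ι
  · exact ⟨0, fun x _ => ⟨0, by
      rw [map_zero]
      exact ((hy x).symm.trans ((congrArg p (Subsingleton.elim _ 0)).trans (map_zero p))).symm⟩⟩
  · obtain ⟨e, he⟩ := (insert i₀ T).countable_toSet.exists_eq_range ⟨i₀, by simp⟩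
    refine ⟨p ∘ₗ Finsupp.lmapDomain G R e, fun x hx => ?_⟩
    have h1 : y x ∈ Finsupp.supported G R (e '' Set.univ) := by
      rw [Finsupp.mem_supported, Set.image_univ, ← he]
      exact fun i hi => Finset.mem_coe.2
        (Finset.mem_insert_of_mem (Finset.mem_biUnion.2 ⟨x, hx, hi⟩))
    rw [← Finsupp.lmapDomain_supported G R e] at h1
    obtain ⟨z, -, hz⟩ := h1
    exact ⟨z, by rw [LinearMap.comp_apply, hz]; exact hy x⟩

/-- There are `κ` many rows through which all linear combinations in h-unitary modules factor. -/
theorem IsFlatGenerator.exists_rows (hG : IsFlatGenerator A G) (hκ : ℵ₀ ≤ κ) (hGκ : #G ≤ κ) :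
    ∃ (X : Type u) (Ψ : Set (X →₀ R)), #Ψ ≤ κ ∧
      ∀ (H : Type u) [AddCommGroup H] [Module R H], IsHUnitary A H → ∀ c : H →₀ R,
        ∃ ψ ∈ Ψ, (∃ y : X → H, (ψ.sum fun x r => r • y x) = freeEval R H c) ∧
          ∃ b : H → (X →₀ R), ψ = c.sum fun w r => r • b w := by
  classical
  -- Countably many copies of `G` suffice, since any finite subset of an h-unitary module lies in
  -- the image of such a sum. A telescope covering this one module provides the rows for all
  -- h-unitary modules.
  let M : Type u := ULift.{u} ℕ →₀ G
  have hM : IsHUnitary A M := isHUnitary_finsupp hG.mem.1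
  have hMκ : #M ≤ κ := mk_finsupp_le_of_le hκ (by simpa using hκ) hGκ
  obtain ⟨σ, p, hσ, hp⟩ := hM.isUnital.exists_telescope
  have hW := isHUnitaryFlat_telescope hσ
  -- The telescope is itself h-unitary and is generated by `ℵ₀ · |M|` elements, so the bound on
  -- spans applies to it.
  have hWκ : #(Telescope σ) ≤ κ := by
    have h1 := hG.mk_span_le hκ hGκ hW.1 (⋃ k : ℕ, Set.range fun m : M =>
      Telescope.of σ k (Finsupp.single m 1))
      (mk_iUnion_nat_le_of_le hκ _ fun k => Cardinal.mk_range_le.trans hMκ)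
    have hmem (w : Telescope σ) : w ∈ Submodule.span R (⋃ k : ℕ, Set.range fun m : M =>
        Telescope.of σ k (Finsupp.single m 1)) := by
      obtain ⟨k, v, rfl⟩ := Telescope.exists_of σ w
      rw [Telescope.of_eq_sum]
      exact Submodule.sum_mem _ fun m _ => Submodule.smul_mem _ _
        (Submodule.subset_span (Set.mem_iUnion.2 ⟨k, m, rfl⟩))
    exact (Cardinal.mk_le_of_injective (f := fun w => Subtype.mk w (hmem w))
      fun a b h => congrArg Subtype.val h).trans h1
  choose ψ y hy hψ using Telescope.exists_rows σ
  refine ⟨M, ⋃ l, Set.range (ψ l), mk_iUnion_le_of_le hκ _ hWκ fun l => ?_, ?_⟩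
  · exact (Cardinal.mk_le_aleph0_iff.2 (Set.countable_range _).to_subtype).trans hκ
  · intro H _ _ hH c
    obtain ⟨q, hq⟩ := hG.exists_countable_cover hH c.support
    let e : M ≃ₗ[R] (ℕ →₀ G) := Finsupp.domLCongr Equiv.ulift
    let q' : Telescope σ →ₗ[R] H := q ∘ₗ e.toLinearMap ∘ₗ p
    have hq' (w : H) (hw : w ∈ c.support) : ∃ t, q' t = w := by
      obtain ⟨g, rfl⟩ := hq w hw
      obtain ⟨t, ht⟩ := hp (e.symm g)
      exact ⟨t, congrArg q ((congrArg e ht).trans (e.apply_symm_apply g))⟩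
    choose! s hs using hq'
    -- The combination `c` is lifted to the telescope. The rows of its value there divide all
    -- combinations with that value, and their solutions are pushed forward to `H`.
    let l := freeEval R (Telescope σ) (c.mapDomain s)
    obtain ⟨j, b, hb⟩ := hψ l (c.mapDomain s) rfl
    refine ⟨ψ l j, Set.mem_iUnion.2 ⟨l, j, rfl⟩, ⟨fun x => q' (y l j x), ?_⟩,
      fun w => b (s w), ?_⟩
    · have h1 := congrArg q' (hy l j)
      rw [Finsupp.sum, map_sum] at h1
      simp only [map_smul] at h1
      refine h1.trans ?_
      simp only [l]
      rw [freeEval, Finsupp.linearCombination_mapDomain, Finsupp.linearCombination_apply,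
        Finsupp.sum, map_sum, Finsupp.linearCombination_apply]
      refine Finset.sum_congr rfl fun w hw => ?_
      rw [map_smul]
      exact congrArg (c w • ·) (hs w hw)
    · exact hb.trans (Finsupp.sum_mapDomain_index (h := fun w r => r • b w)
        (fun _ => zero_smul _ _) fun _ _ _ => add_smul _ _ _)

end Rows

/-! ### Row-pure submodules and flat quotients. -/

section Pure

variable {R : Type u} [Ring R] {F : Type u} [AddCommGroup F] [Module R F]

/-- The submodules `S` such that a linear combination that lies in `S` is one of elements of `S`
with the same coefficients. -/
def IsRowPure (S : Submodule R F) : Prop :=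
  ∀ c : F →₀ R, freeEval R F c ∈ S →
    ∃ s : F → F, (∀ m, s m ∈ S) ∧ (c.sum fun m r => r • s m) = freeEval R F c

theorem IsRowPure.exists_sum {S : Submodule R F} (hS : IsRowPure S) {X : Type*} (c : X →₀ R)
    (y : X → F) (h : (c.sum fun x r => r • y x) ∈ S) :
    ∃ s : F → F, (∀ m, s m ∈ S) ∧
      (c.sum fun x r => r • s (y x)) = c.sum fun x r => r • y x := by
  have h1 (f : F → F) : ((c.mapDomain y).sum fun m r => r • f m) = c.sum fun x r => r • f (y x) :=
    Finsupp.sum_mapDomain_index (fun _ => zero_smul _ _) fun _ _ _ => add_smul _ _ _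
  obtain ⟨s, hs, hsum⟩ := hS (c.mapDomain y) (by
    rw [freeEval, Finsupp.linearCombination_apply, h1]
    exact h)
  refine ⟨s, hs, ?_⟩
  rw [← h1, hsum, freeEval, Finsupp.linearCombination_apply, h1]
  rfl

theorem isRowPure_bot : IsRowPure (⊥ : Submodule R F) := fun c hc =>
  ⟨0, fun _ => Submodule.zero_mem _, by
    rw [(Submodule.mem_bot R).1 hc]
    exact Finset.sum_eq_zero fun _ _ => smul_zero _⟩

/-- A solution in `T` is lifted to the preimage of `T`; its error lies in `S` and is a combination
with the same coefficients, so purity of `S` allows it to be corrected. -/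
theorem IsRowPure.comap_mkQ {S : Submodule R F} (hS : IsRowPure S) {T : Submodule R (F ⧸ S)}
    (hT : IsRowPure T) : IsRowPure (T.comap S.mkQ) := fun c hc => by
  obtain ⟨s, hs, hsum⟩ := hT.exists_sum c S.mkQ (by
    simpa [freeEval, Finsupp.linearCombination_apply, Finsupp.sum] using hc)
  choose τ hτ using S.mkQ_surjective
  obtain ⟨t, ht, htsum⟩ := hS.exists_sum c (fun m => τ (s (S.mkQ m)) - m) (by
    refine (Submodule.Quotient.mk_eq_zero S).1 ?_
    rw [← Submodule.mkQ_apply, Finsupp.sum, map_sum]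
    simp only [map_smul, map_sub, hτ, smul_sub, Finset.sum_sub_distrib]
    exact sub_eq_zero.2 hsum)
  refine ⟨fun m => τ (s (S.mkQ m)) - t (τ (s (S.mkQ m)) - m), fun m => ?_, ?_⟩
  · rw [Submodule.mem_comap, map_sub, hτ]
    refine T.sub_mem (hs _) ?_
    have : S.mkQ (t (τ (s (S.mkQ m)) - m)) = 0 := (Submodule.Quotient.mk_eq_zero S).2 (ht _)
    rw [this]
    exact T.zero_mem
  · simp only [smul_sub, Finsupp.sum, Finset.sum_sub_distrib] at htsum ⊢
    rw [htsum, sub_sub_cancel, freeEval, Finsupp.linearCombination_apply]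
    rfl

/-- A relation in `F ⧸ S` lifts to a combination lying in `S`, which purity rewrites with elements
of `S`. The difference is a genuine relation in `F`; the endomorphism killing it there is projected
to the quotient. -/
theorem IsRowPure.isEquational_quotient (hF : IsEquational R F) {S : Submodule R F}
    (hS : IsRowPure S) : IsEquational R (F ⧸ S) := fun c hc => by
  choose τ hτ using S.mkQ_surjective
  obtain ⟨s, hs, hsum⟩ := hS.exists_sum c τ (by
    refine (Submodule.Quotient.mk_eq_zero S).1 ?_
    rw [← Submodule.mkQ_apply, Finsupp.sum, map_sum]
    simp only [map_smul, hτ]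
    exact hc)
  obtain ⟨β, hβ, h0⟩ := hF
    (c.sum fun q r => r • (Finsupp.single (τ q) 1 - Finsupp.single (s (τ q)) 1)) (by
      rw [Finsupp.sum, map_sum]
      simp only [map_smul, map_sub, freeEval, Finsupp.linearCombination_single, one_smul, smul_sub,
        Finset.sum_sub_distrib, id]
      exact sub_eq_zero.2 hsum.symm)
  let π : (F →₀ R) →ₗ[R] (F ⧸ S →₀ R) := Finsupp.lmapDomain R R S.mkQ
  have hπ (x : F →₀ R) : freeEval R (F ⧸ S) (π x) = S.mkQ (freeEval R F x) := by
    have : freeEval R (F ⧸ S) ∘ₗ π = S.mkQ ∘ₗ freeEval R F :=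
      Finsupp.lhom_ext' fun m => LinearMap.ext_ring (by simp [π])
    exact LinearMap.congr_fun this x
  refine ⟨Finsupp.linearCombination R fun q =>
    π (β (Finsupp.single (τ q) 1 - Finsupp.single (s (τ q)) 1)),
    Finsupp.lhom_ext' fun q => LinearMap.ext_ring ?_, ?_⟩
  · have h1 : freeEval R F (β (Finsupp.single (τ q) 1 - Finsupp.single (s (τ q)) 1)) =
        τ q - s (τ q) := by
      rw [← LinearMap.comp_apply, hβ]
      simp
    have h2 : S.mkQ (s (τ q)) = 0 := (Submodule.Quotient.mk_eq_zero S).2 (hs _)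
    rw [LinearMap.comp_apply, LinearMap.comp_apply, Finsupp.lsingle_apply,
      Finsupp.linearCombination_single, one_smul, hπ, h1, map_sub, hτ, h2, sub_zero]
    simp
  · rw [Finsupp.linearCombination_apply]
    simp only [← map_smul]
    rw [Finsupp.sum, ← map_sum, ← map_sum]
    exact (congrArg π h0).trans (map_zero π)

variable {A : Ideal R} [A.IsTwoSided]

theorem IsRowPure.isHUnitaryFlat_quotient (hF : IsHUnitaryFlat A F) {S : Submodule R F}
    (hS : IsRowPure S) : IsHUnitaryFlat A (F ⧸ S) :=
  isHUnitaryFlat_of_isUnital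
    (IsEquational.isFlat (M := ModuleCat.of R (F ⧸ S)) (hS.isEquational_quotient hF.2.isEquational))
    ((IsHUnitary.isUnital hF.1).of_surjective S.mkQ S.mkQ_surjective)

theorem IsRowPure.isHUnitaryFlat (hF : IsHUnitaryFlat A F) {S : Submodule R F}
    (hS : IsRowPure S) : IsHUnitaryFlat A S :=
  IsHUnitaryFlat.left S.subtype_injective (LinearMap.exact_subtype_mkQ S) S.mkQ_surjective hF
    (hS.isHUnitaryFlat_quotient hF)

theorem IsFlatGenerator.exists_isRowPure {G : ModuleCat.{u} R} (hG : IsFlatGenerator A G)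
    {κ : Cardinal.{u}} (hκ : ℵ₀ ≤ κ) (hGκ : #G ≤ κ) (hF : IsHUnitary A F) (x : F) :
    ∃ S : Submodule R F, x ∈ S ∧ #S ≤ κ ∧ IsRowPure S := by
  classical
  obtain ⟨X, Ψ, hΨ, h⟩ := hG.exists_rows hκ hGκ
  have hy (m : F) (ψ : X →₀ R) : ∃ y : X → F, (∃ y' : X → F, (ψ.sum fun x r => r • y' x) = m) →
      (ψ.sum fun x r => r • y x) = m := by
    by_cases h : ∃ y' : X → F, (ψ.sum fun x r => r • y' x) = m
    · exact ⟨h.choose, fun _ => h.choose_spec⟩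
    · exact ⟨0, fun h' => (h h').elim⟩
  choose y hy using hy
  -- For each element and each of the `κ` rows a chosen solution is added, if there is one. Spans of
  -- at most `κ` elements stay within `κ`.
  obtain ⟨S, hxS, hSκ, hS⟩ := exists_closed_submodule (R := R) hκ (hG.mk_span_le hκ hGκ hF)
    (fun m => ⋃ ψ ∈ Ψ, ((ψ.support.image (y m ψ) : Finset F) : Set F))
    (fun m => mk_biUnion_le_of_le hκ _ hΨ fun ψ => mk_finset_coe_le hκ _) {x} (by
      rw [Cardinal.mk_singleton]
      exact Cardinal.one_le_aleph0.trans hκ)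
  refine ⟨S, hxS rfl, hSκ, fun c hc => ?_⟩
  obtain ⟨ψ, hψ, hψy, b, hb⟩ := h F hF c
  have hyS (i : X) (hi : i ∈ ψ.support) : y (freeEval R F c) ψ i ∈ S :=
    hS _ hc (Set.mem_biUnion hψ (Finset.mem_coe.2 (Finset.mem_image_of_mem _ hi)))
  -- As `ψ = ∑ c_w b_w`, a solution of the row `ψ` in `S` turns into the solution `s_w = ∑ b_{w,i}
  -- y_i` for the coefficients `c`.
  refine ⟨fun w => ∑ i ∈ ψ.support, b w i • y (freeEval R F c) ψ i,
    fun w => S.sum_mem fun i hi => S.smul_mem _ (hyS i hi), ?_⟩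
  refine Eq.trans ?_ (hy (freeEval R F c) ψ hψy)
  rw [Finsupp.sum, Finsupp.sum]
  simp only [Finset.smul_sum]
  rw [Finset.sum_comm]
  refine Finset.sum_congr rfl fun i _ => ?_
  have h1 : ψ i = ∑ w ∈ c.support, c w * b w i := by
    conv_lhs => rw [hb]
    rw [Finsupp.sum, Finsupp.finsetSum_apply]
    rfl
  rw [h1, Finset.sum_smul]
  exact Finset.sum_congr rfl fun w _ => smul_smul _ _ _

end Pure

/-! ### Small h-unitary flat modules detect cotorsion. -/

section Deconstruction

variable {R : Type u} [Ring R] {A : Ideal R} [A.IsTwoSided] {G : ModuleCat.{u} R}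
  {κ : Cardinal.{u}}

/-- The h-unitary flat modules of cardinality at most `κ` detect cotorsion. -/
theorem IsFlatGenerator.extVanishes_one (hG : IsFlatGenerator A G) (hκ : ℵ₀ ≤ κ) (hGκ : #G ≤ κ)
    {Y : Type u} [AddCommGroup Y] [Module R Y]
    (hY : ∀ S : ModuleCat.{u} R, hUnitaryFlat A S → #S ≤ κ → ExtVanishes R 1 S Y)
    {F : Type u} [AddCommGroup F] [Module R F] (hF : IsHUnitaryFlat A F) : ExtVanishes R 1 F Y := by
  obtain ⟨I, D, i, p, hI, hi, hip, hp⟩ := exists_injective_embedding R Y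
  refine extVanishes_one_of_lifts hi hip hp (extVanishes_of_injective hI 0) fun v => ?_
  -- Zorn's lemma is applied to partial lifts of `v` with row-pure domain. Purity keeps the quotient
  -- by the domain h-unitary flat, so that a small pure piece of it can be adjoined.
  let P : Set (F →ₗ.[R] I) := {f | IsRowPure f.domain ∧ ∀ x : f.domain, p (f x) = v x}
  obtain ⟨f, -, hf⟩ := zorn_le_nonempty₀ P (fun c hc hchain g hg => by
    have hdir : DirectedOn (· ≤ ·) c := hchain.directedOn
    refine ⟨LinearPMap.sSup c hdir, ⟨fun d hd => ?_, fun x => ?_⟩, fun z hz =>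
      LinearPMap.le_sSup hdir hz⟩
    · obtain ⟨f, hfc, hd⟩ := (LinearPMap.mem_domain_sSup_iff ⟨g, hg⟩ hdir).1 hd
      obtain ⟨s, hs, hsum⟩ := (hc hfc).1 d hd
      exact ⟨s, fun m => (LinearPMap.le_sSup hdir hfc).1 (hs m), hsum⟩
    · obtain ⟨f, hfc, hx⟩ := (LinearPMap.mem_domain_sSup_iff ⟨g, hg⟩ hdir).1 x.2
      rw [← (LinearPMap.le_sSup hdir hfc).2 (x := ⟨x, hx⟩) rfl]
      exact (hc hfc).2 _) ⊥ ⟨isRowPure_bot, fun x => by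
        obtain ⟨x, hx⟩ := x
        obtain rfl : x = 0 := (Submodule.mem_bot R).1 hx
        exact ((congrArg p (map_zero (⊥ : F →ₗ.[R] I).toFun)).trans (map_zero p)).trans
          (map_zero v).symm⟩
  have htop : f.domain = ⊤ := by
    by_contra hne
    obtain ⟨x, hx⟩ : ∃ x, x ∉ f.domain := by
      by_contra! h
      exact hne (Submodule.eq_top_iff'.2 h)
    have hq := hf.prop.1.isHUnitaryFlat_quotient hF
    obtain ⟨T, hxT, hTκ, hT⟩ := hG.exists_isRowPure hκ hGκ hq.1 (f.domain.mkQ x)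
    let T' : Submodule R F := T.comap f.domain.mkQ
    have hle : f.domain ≤ T' := fun y hy => by
      rw [Submodule.mem_comap, Submodule.mkQ_apply, (Submodule.Quotient.mk_eq_zero _).2 hy]
      exact T.zero_mem
    let π : T' →ₗ[R] T := f.domain.mkQ.restrict fun y hy => hy
    have hπ : Function.Surjective π := fun t => by
      obtain ⟨y, hy⟩ := f.domain.mkQ_surjective t
      exact ⟨⟨y, by rw [Submodule.mem_comap, hy]; exact t.2⟩, Subtype.ext hy⟩
    have hπ0 : Function.Exact (Submodule.inclusion hle) π := fun y => by
      constructor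
      · intro h
        exact ⟨⟨y, (Submodule.Quotient.mk_eq_zero _).1 (congrArg Subtype.val h)⟩, rfl⟩
      · rintro ⟨z, rfl⟩
        exact Subtype.ext ((Submodule.Quotient.mk_eq_zero _).2 z.2)
    -- Injectivity of `I` extends the partial lift to `T'`. The error `p l - v` vanishes on the old
    -- domain, so it factors through the small module `T`; `Ext¹(T, Y) = 0` lifts it to `I`, and the
    -- lift is subtracted.
    obtain ⟨l, hl⟩ := hI.out (Submodule.inclusion hle) (Submodule.inclusion_injective hle) f.toFun
    have hker (y : T') (hy : π y = 0) : (p ∘ₗ l - v ∘ₗ T'.subtype) y = 0 := by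
      obtain ⟨z, rfl⟩ := (hπ0 y).1 hy
      rw [LinearMap.sub_apply, LinearMap.comp_apply, hl, sub_eq_zero]
      exact hf.prop.2 z
    let d : T →ₗ[R] D := (LinearMap.ker π).liftQ (p ∘ₗ l - v ∘ₗ T'.subtype) hker ∘ₗ
      (π.quotKerEquivOfSurjective hπ).symm.toLinearMap
    have hd (y : T') : d (π y) = (p ∘ₗ l - v ∘ₗ T'.subtype) y := by
      have : (π.quotKerEquivOfSurjective hπ).symm (π y) = (LinearMap.ker π).mkQ y := by
        rw [LinearEquiv.symm_apply_eq]
        rfl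
      simp only [d, LinearMap.comp_apply, LinearEquiv.coe_coe, this]
      rfl
    obtain ⟨w, hw⟩ := (hY (ModuleCat.of R T) (hT.isHUnitaryFlat hq) hTκ).exists_lift hi hip hp d
    let f' : F →ₗ.[R] I := ⟨T', l - w ∘ₗ π⟩
    have hff' : f ≤ f' := ⟨hle, fun a b hab => by
      obtain rfl : b = Submodule.inclusion hle a := Subtype.ext hab.symm
      have : π (Submodule.inclusion hle a) = 0 := (hπ0 _).2 ⟨a, rfl⟩
      change f.toFun a = l _ - w (π _)
      rw [this, map_zero, sub_zero, hl]⟩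
    have hf' : f' ∈ P := ⟨hf.prop.1.comap_mkQ hT, fun y => by
      change p (l y - w (π y)) = v y
      rw [map_sub, ← LinearMap.comp_apply p w, hw, hd]
      simp⟩
    exact hx ((hf.le_of_ge hf' hff').1 hxT)
  refine ⟨f.toFun ∘ₗ (LinearEquiv.ofTop f.domain htop).symm.toLinearMap, LinearMap.ext fun x => ?_⟩
  exact hf.prop.2 _

end Deconstruction

end HUnitary

namespace HUnitary

/-! ### The small object argument for a set of monomorphisms. -/

section SmallObject

open MorphismProperty

/-- The stages of a relative cell complex are linked by monomorphisms. In a Grothendieck abelian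
category, mapping out of an object commutes with such colimits of length a regular cardinal
exceeding its number of subobjects. -/
theorem hasSmallObjectArgument_ofHoms {C : Type*} [Category.{w} C] [Abelian C]
    [IsGrothendieckAbelian.{w} C] {ι : Type w} {X Y : ι → C} (f : ∀ i, X i ⟶ Y i)
    [∀ i, Mono (f i)] : HasSmallObjectArgument.{w} (ofHoms f) := by
  obtain ⟨κ, hκ', hκ⟩ := HasCardinalLT.exists_regular_cardinal_forall.{w}
    fun i => Subobject (X i)
  have : Fact κ.IsRegular := ⟨hκ'⟩
  have : Nonempty κ.ord.ToType := by simpa using hκ'.ne_zero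
  have := WellFoundedLT.toOrderBot κ.ord.ToType
  have hle : ofHoms f ≤ monomorphisms C := by
    rintro _ _ _ ⟨i⟩
    exact inferInstanceAs (Mono (f i))
  exact ⟨κ, inferInstance, inferInstance,
    { preservesColimit {A B X Y} i hi g hg := by
        let hg' : (monomorphisms C).TransfiniteCompositionOfShape κ.ord.ToType g :=
          { toTransfiniteCompositionOfShape := hg.toTransfiniteCompositionOfShape
            map_mem j hj := by
              have := (hg.attachCells j hj).pushouts_coproducts
              simp only [ofHoms_homFamily] at this
              refine (?_ : _ ≤ monomorphisms C) _ this
              simp only [pushouts_le_iff, coproducts_le_iff]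
              exact hle }
        have (j j' : κ.ord.ToType) (φ : j ⟶ j') : Mono (hg'.F.map φ) := hg'.mem_map φ
        apply IsGrothendieckAbelian.preservesColimit_coyoneda_obj_of_mono (Y := hg'.F) (κ := κ)
        obtain ⟨i⟩ := hi
        exact hκ i }⟩

end SmallObject

/-! ### Extension and lifting along projective presentations. -/

section ModuleLemmas

variable {R : Type u} [Ring R]

/-- Extensions of modules along surjections onto a free module. -/
theorem exists_free_presentation (S : ModuleCat.{u} R) :
    ∃ (K P : ModuleCat.{u} R) (k : K →ₗ[R] P) (q : P →ₗ[R] S), Module.Projective R P ∧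
      Function.Injective k ∧ Function.Exact k q ∧ Function.Surjective q :=
  ⟨ModuleCat.of R (LinearMap.ker (freeEval R S)), ModuleCat.of R (S →₀ R),
    (LinearMap.ker (freeEval R S)).subtype, freeEval R S,
    inferInstanceAs (Module.Projective R (S →₀ R)), Submodule.subtype_injective _,
    LinearMap.exact_subtype_ker_map _,
    fun s => ⟨Finsupp.single s 1, by simp⟩⟩

section

variable {K P S Y : Type u} [AddCommGroup K] [Module R K] [AddCommGroup P] [Module R P]
  [AddCommGroup S] [Module R S] [AddCommGroup Y] [Module R Y] {k : K →ₗ[R] P} {q : P →ₗ[R] S}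

/-- A map that vanishes on the kernel of a surjection factors through it. -/
theorem exists_factor (hkq : Function.Exact k q) (hq : Function.Surjective q) (φ : P →ₗ[R] Y)
    (h : φ ∘ₗ k = 0) : ∃ ψ : S →ₗ[R] Y, ψ ∘ₗ q = φ := by
  have hker : LinearMap.ker q ≤ LinearMap.ker φ := fun x hx => by
    obtain ⟨y, rfl⟩ := (hkq x).1 hx
    exact LinearMap.congr_fun h y
  refine ⟨(LinearMap.ker q).liftQ φ hker ∘ₗ (q.quotKerEquivOfSurjective hq).symm.toLinearMap,
    LinearMap.ext fun x => ?_⟩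
  have : (q.quotKerEquivOfSurjective hq).symm (q x) = (LinearMap.ker q).mkQ x := by
    rw [LinearEquiv.symm_apply_eq]
    rfl
  simp only [LinearMap.comp_apply, LinearEquiv.coe_coe, this]
  rfl

/-- For an extension `E` of `S`, the map `q` lifts to `P → E`. On `K` the lift takes values in `Y`;
subtracting an extension of it to `P` makes the lift descend to a section. -/
theorem extVanishes_one_of_extends [Module.Projective R P]
    (hkq : Function.Exact k q) (hq : Function.Surjective q)
    (h : ∀ φ : K →ₗ[R] Y, ∃ ψ : P →ₗ[R] Y, ψ ∘ₗ k = φ) : ExtVanishes R 1 S Y := by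
  refine extVanishes_one_of_splits _ fun E _ _ f g hf hfg hg => ?_
  obtain ⟨l, hl⟩ := Module.projective_lifting_property g q hg
  have hfl (x : K) : ∃ y, f y = l (k x) := (hfg _).1 (by
    rw [← LinearMap.comp_apply, hl, hkq.apply_apply_eq_zero])
  choose φ hφ using hfl
  obtain ⟨ψ, hψ⟩ := h
    { toFun := φ
      map_add' := fun x y => hf (by simp only [map_add, hφ])
      map_smul' := fun r x => hf (by simp only [map_smul, hφ, RingHom.id_apply]) }
  obtain ⟨s, hs⟩ := exists_factor hkq hq (l - f ∘ₗ ψ) (LinearMap.ext fun x => by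
    have := LinearMap.congr_fun hψ x
    rw [LinearMap.comp_apply] at this
    simp only [LinearMap.comp_apply, LinearMap.sub_apply, this]
    exact sub_eq_zero.2 (hφ x).symm)
  refine ⟨s, LinearMap.ext fun x => ?_⟩
  obtain ⟨x, rfl⟩ := hq x
  rw [LinearMap.comp_apply, ← LinearMap.comp_apply s, hs, LinearMap.sub_apply, map_sub,
    ← LinearMap.comp_apply, hl, LinearMap.comp_apply, hfg.apply_apply_eq_zero, sub_zero]
  rfl

/-- The lifting property of a map with projective target against surjections. -/
theorem exists_square_lift [Module.Projective R P] (hk : Function.Injective k)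
    (hkq : Function.Exact k q) (hq : Function.Surjective q) {Y I D : Type u} [AddCommGroup Y]
    [Module R Y] [AddCommGroup I] [Module R I] [AddCommGroup D] [Module R D] {i : Y →ₗ[R] I}
    {p : I →ₗ[R] D} (hi : Function.Injective i) (hip : Function.Exact i p)
    (hp : Function.Surjective p) (hY : ExtVanishes R 1 S Y) (a : K →ₗ[R] I) (b : P →ₗ[R] D)
    (hab : p ∘ₗ a = b ∘ₗ k) : ∃ l : P →ₗ[R] I, l ∘ₗ k = a ∧ p ∘ₗ l = b := by
  obtain ⟨l, hl⟩ := Module.projective_lifting_property p b hp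
  have hfl (x : K) : ∃ y, i y = a x - l (k x) := (hip _).1 (by
    rw [map_sub, ← LinearMap.comp_apply, hab, ← LinearMap.comp_apply p l, hl]
    exact sub_self _)
  choose φ hφ using hfl
  obtain ⟨ψ, hψ⟩ := hY.exists_extension hk hkq hq
    { toFun := φ
      map_add' := fun x y => hi (by simp only [map_add, hφ]; abel)
      map_smul' := fun r x => hi (by simp only [map_smul, hφ, RingHom.id_apply, smul_sub]) }
  refine ⟨l + i ∘ₗ ψ, LinearMap.ext fun x => ?_, LinearMap.ext fun x => ?_⟩
  · have := LinearMap.congr_fun hψ x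
    rw [LinearMap.comp_apply] at this
    rw [LinearMap.comp_apply, LinearMap.add_apply, LinearMap.comp_apply, this]
    exact (congrArg _ (hφ x)).trans (add_sub_cancel _ _)
  · rw [LinearMap.comp_apply, LinearMap.add_apply, map_add, LinearMap.comp_apply,
      hip.apply_apply_eq_zero, add_zero, ← LinearMap.comp_apply, hl]

end

end ModuleLemmas

/-! ### Special cotorsion preenvelopes of modules. -/

section Complete

variable {R : Type u} [Ring R] {A : Ideal R} [A.IsTwoSided]

variable (A) in
/-- The h-unitary modules `Y` with `Ext¹(F, Y) = 0` for all h-unitary flat modules `F`. -/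
def IsHUnitaryCotorsion (Y : Type u) [AddCommGroup Y] [Module R Y] : Prop :=
  IsHUnitary A Y ∧ ∀ F : ModuleCat.{u} R, hUnitaryFlat A F → ExtVanishes R 1 F Y

open MorphismProperty ZeroObject in
/-- Every h-unitary module has a special cotorsion preenvelope. -/
theorem exists_cotorsion_embedding (M : Type u) [AddCommGroup M] [Module R M]
    (hM : IsHUnitary A M) :
    ∃ (C F : ModuleCat.{u} R) (i : M →ₗ[R] C) (p : C →ₗ[R] F), IsHUnitaryCotorsion A C ∧
      hUnitaryFlat A F ∧ Function.Injective i ∧ Function.Exact i p ∧ Function.Surjective p := by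
  obtain ⟨G, hG⟩ := exists_isFlatGenerator A
  let κ := max #G ℵ₀
  have hκ : ℵ₀ ≤ κ := le_max_right _ _
  obtain ⟨J, X, hX⟩ := exists_representatives R κ
  choose K P k q hP hk hkq hq using
    fun j : {j // hUnitaryFlat A (X j)} => exists_free_presentation (X j)
  let k' (j : {j // hUnitaryFlat A (X j)}) : K j ⟶ P j := ModuleCat.ofHom (k j)
  have (j : {j // hUnitaryFlat A (X j)}) : Mono (k' j) := (ModuleCat.mono_iff_injective _).2 (hk j)
  have := hasSmallObjectArgument_ofHoms k'
  let I := ofHoms k'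
  -- `M → 0` is factored. The right lifting property of `C → 0` says that maps `K_j → C` extend to
  -- `P_j`, that is, `Ext¹(X_j, C) = 0`.
  let fac := factorizationData I.rlp.llp I.rlp (0 : ModuleCat.of R M ⟶ 0)
  let C := fac.Z
  let i : ModuleCat.of R M ⟶ C := fac.i
  have hi : I.rlp.llp i := fac.hi
  have hrlp {D D' : ModuleCat.{u} R} (p : D ⟶ D') (h : ∀ j (a : K j ⟶ D) (b : P j ⟶ D'),
      a ≫ p = k' j ≫ b → ∃ l : P j ⟶ D, k' j ≫ l = a ∧ l ≫ p = b) : I.rlp p := by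
    rintro _ _ _ ⟨j⟩
    exact ⟨fun {a b} sq => ⟨(h j a b sq.w).elim fun l hl => ⟨⟨l, hl.1, hl.2⟩⟩⟩⟩
  have hllp {D D' : ModuleCat.{u} R} (p : D ⟶ D') (hp : I.rlp p) (a : ModuleCat.of R M ⟶ D)
      (b : C ⟶ D') (w : a ≫ p = i ≫ b) : ∃ l : C ⟶ D, i ≫ l = a ∧ l ≫ p = b := by
    have := hi p hp
    have sq : CommSq a i p b := ⟨w⟩
    exact ⟨sq.lift, sq.fac_left, sq.fac_right⟩
  -- An embedding of `M` in an injective module `D` extends along `i`, because `D → 0` has the right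
  -- lifting property against the injections `K_j → P_j`.
  have hinj : Function.Injective i := by
    obtain ⟨D, -, d, -, hD, hd, -, -⟩ := exists_injective_embedding R M
    obtain ⟨l, hl, -⟩ := hllp (0 : D ⟶ 0) (hrlp _ fun j a b _ => by
      obtain ⟨l, hl⟩ := hD.out (k j) (hk j) a.hom
      exact ⟨ModuleCat.ofHom l, ModuleCat.hom_ext (LinearMap.ext hl),
        (isZero_zero _).eq_of_tgt _ _⟩) (ModuleCat.ofHom d) 0 (by simp)
    exact Function.Injective.of_comp (f := l) (by
      have : l.hom ∘ₗ i.hom = d := congrArg ModuleCat.Hom.hom hl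
      rw [← this] at hd
      exact hd)
  let F := ModuleCat.of R (C ⧸ LinearMap.range i.hom)
  let π : C →ₗ[R] F := (LinearMap.range i.hom).mkQ
  have hiπ : Function.Exact i.hom π := LinearMap.exact_map_mkQ_range _
  have hπ : Function.Surjective π := Submodule.mkQ_surjective _
  have hF1 (Y : ModuleCat.{u} R) (hY : ∀ S : ModuleCat.{u} R, hUnitaryFlat A S →
      ExtVanishes R 1 S Y) : ExtVanishes R 1 F Y := by
    obtain ⟨D, D', d, p, hD, hd, hdp, hp⟩ := exists_injective_embedding R Y
    refine extVanishes_one_of_lifts hd hdp hp (extVanishes_of_injective hD 0) fun v => ?_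
    obtain ⟨l, hl, hlp⟩ := hllp (ModuleCat.ofHom p) (hrlp _ fun j a b w => by
      obtain ⟨l, h1, h2⟩ := exists_square_lift (hk j) (hkq j) (hq j) hd hdp hp (hY _ j.2)
        a.hom b.hom (congrArg ModuleCat.Hom.hom w)
      exact ⟨ModuleCat.ofHom l, ModuleCat.hom_ext h1, ModuleCat.hom_ext h2⟩)
      0 (ModuleCat.ofHom (v ∘ₗ π)) (by
        refine ModuleCat.hom_ext (LinearMap.ext fun m => ?_)
        change p 0 = v (π (i m))
        rw [hiπ.apply_apply_eq_zero, map_zero, map_zero])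
    obtain ⟨ψ, hψ⟩ := exists_factor hiπ hπ l.hom (congrArg ModuleCat.Hom.hom hl)
    refine ⟨ψ, LinearMap.ext fun x => ?_⟩
    obtain ⟨x, rfl⟩ := hπ x
    rw [LinearMap.comp_apply, ← LinearMap.comp_apply ψ, hψ]
    exact LinearMap.congr_fun (congrArg ModuleCat.Hom.hom hlp) x
  -- Orthogonality to all character modules gives flatness. Lifting against `0 → (R/A)⁺`, which is
  -- possible since `Hom(S, (R/A)⁺) = 0` for h-unitary `S`, gives `AF = F`.
  have hF : hUnitaryFlat A F := by
    refine isHUnitaryFlat_of_isUnital ((isFlat_iff_extVanishes _).2 fun N =>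
      hF1 (ModuleCat.of R (RightDual N)) fun S hS =>
      hS.2.extVanishes 0 N) (hom_eq_zero_iff_isUnital.1 fun φ => ?_)
    obtain ⟨l, hl, hlp⟩ := hllp (0 : 0 ⟶ ModuleCat.of R (RightDual (quotientRight A)))
      (hrlp _ fun j a b w => by
        obtain ⟨ψ, hψ⟩ := exists_factor (hkq j) (hq j) b.hom (by
          refine (congrArg ModuleCat.Hom.hom w).symm.trans ?_
          rw [comp_zero]
          rfl)
        have h0 : ψ = 0 := hom_eq_zero_iff_isUnital.2 (IsHUnitary.isUnital j.2.1) ψ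
        exact ⟨0, (isZero_zero _).eq_of_tgt _ _, ModuleCat.hom_ext (by
          rw [zero_comp, ← hψ, h0]
          rfl)⟩) 0 (ModuleCat.ofHom (φ ∘ₗ π)) (by
        refine ModuleCat.hom_ext (LinearMap.ext fun m => ?_)
        change 0 = φ (π (i m))
        rw [hiπ.apply_apply_eq_zero, map_zero])
    refine LinearMap.ext fun x => ?_
    obtain ⟨x, rfl⟩ := hπ x
    have := LinearMap.congr_fun (congrArg ModuleCat.Hom.hom hlp) x
    rw [comp_zero] at this
    exact this.symm
  refine ⟨C, F, i.hom, π, ⟨IsHUnitary.mid hinj hiπ hπ hM hF.1, fun S hS => ?_⟩, hF, hinj, hiπ, hπ⟩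
  refine hG.extVanishes_one hκ (le_max_left _ _) (fun S hS hSκ => ?_) hS
  obtain ⟨j, ⟨e⟩⟩ := hX S hSκ
  have hj : hUnitaryFlat A (X j) := IsHUnitaryFlat.of_linearEquiv hS e.toLinearEquiv
  have h1 : ExtVanishes R 1 (X j) C := by
    have := hP ⟨j, hj⟩
    refine extVanishes_one_of_extends (hkq ⟨j, hj⟩) (hq ⟨j, hj⟩) fun φ => ?_
    have := fac.hp (k' ⟨j, hj⟩) ⟨_⟩
    have sq : CommSq (ModuleCat.ofHom φ) (k' ⟨j, hj⟩) fac.p 0 :=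
      ⟨(isZero_zero _).eq_of_tgt _ _⟩
    exact ⟨sq.lift.hom, congrArg ModuleCat.Hom.hom sq.fac_left⟩
  exact h1.of_linearEquiv_left e.toLinearEquiv.symm

end Complete

end HUnitary

namespace HUnitary

/-! ### A horseshoe lemma for cotorsion preenvelopes. -/

section Pushouts

variable {R : Type u} [Ring R] {A : Ideal R} [A.IsTwoSided]

/-- The pushout of an injection along a homomorphism. -/
theorem exists_pushout {Z Y X : Type u} [AddCommGroup Z] [Module R Z] [AddCommGroup Y] [Module R Y]
    [AddCommGroup X] [Module R X] (f : Z →ₗ[R] Y) (hf : Function.Injective f) (g : Z →ₗ[R] X) :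
    ∃ (W : ModuleCat.{u} R) (i : X →ₗ[R] W) (j : Y →ₗ[R] W), Function.Injective i ∧
      j ∘ₗ f = i ∘ₗ g ∧ (∀ w, ∃ x y, i x + j y = w) ∧
      ∀ (T : Type u) [AddCommGroup T] [Module R T] (s : X →ₗ[R] T) (t : Y →ₗ[R] T),
        s ∘ₗ g = t ∘ₗ f → ∃ h : W →ₗ[R] T, h ∘ₗ i = s ∧ h ∘ₗ j = t := by
  let r : Z →ₗ[R] X × Y := LinearMap.prod (-g) f
  let π := (LinearMap.range r).mkQ
  have hπ (z : Z) : π (-g z, f z) = 0 := (Submodule.Quotient.mk_eq_zero _).2 ⟨z, rfl⟩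
  refine ⟨ModuleCat.of R ((X × Y) ⧸ LinearMap.range r), π ∘ₗ LinearMap.inl R X Y,
    π ∘ₗ LinearMap.inr R X Y, ?_, ?_, ?_, ?_⟩
  · rw [injective_iff_map_eq_zero]
    intro x hx
    obtain ⟨z, hz⟩ := (Submodule.Quotient.mk_eq_zero _).1 hx
    have h2 : f z = 0 := congrArg Prod.snd hz
    have h1 : -g z = x := congrArg Prod.fst hz
    rw [← h1, (injective_iff_map_eq_zero f).1 hf z h2, map_zero, neg_zero]
  · refine LinearMap.ext fun z => ?_
    have h := hπ z
    rw [show ((-g z, f z) : X × Y) = (0, f z) - (g z, 0) by simp, map_sub, sub_eq_zero] at h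
    exact h
  · intro w
    obtain ⟨⟨x, y⟩, rfl⟩ := Submodule.mkQ_surjective _ w
    exact ⟨x, y, (map_add π _ _).symm.trans (congrArg π (by simp))⟩
  · intro T _ _ s t hst
    refine ⟨(LinearMap.range r).liftQ (s.coprod t) ?_, LinearMap.ext fun x => ?_,
      LinearMap.ext fun y => ?_⟩
    · rintro _ ⟨z, rfl⟩
      have := LinearMap.congr_fun hst z
      rw [LinearMap.comp_apply, LinearMap.comp_apply] at this
      simp [r, this]
    · exact (s.coprod_apply t (x, 0)).trans (by simp)
    · exact (s.coprod_apply t (0, y)).trans (by simp)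

/-- Special cotorsion preenvelopes of the outer terms of a short exact sequence extend to a
morphism of short exact sequences. -/
theorem IsHUnitaryCotorsion.exists_horseshoe
    {Z Y Z' C C' F' : Type u} [AddCommGroup Z] [Module R Z] [AddCommGroup Y] [Module R Y]
    [AddCommGroup Z'] [Module R Z'] [AddCommGroup C] [Module R C]
    [AddCommGroup C'] [Module R C'] [AddCommGroup F'] [Module R F']
    {a : Z →ₗ[R] Y} {b : Y →ₗ[R] Z'} {c : Z →ₗ[R] C} {c' : Z' →ₗ[R] C'} {p' : C' →ₗ[R] F'}
    (hC : IsHUnitaryCotorsion A C) (hC' : IsHUnitary A C') (hF' : IsHUnitaryFlat A F')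
    (ha : Function.Injective a) (hab : Function.Exact a b) (hb : Function.Surjective b)
    (hc' : Function.Injective c') (hcp' : Function.Exact c' p') (hp' : Function.Surjective p') :
    ∃ (D : ModuleCat.{u} R) (α : C →ₗ[R] D) (β : D →ₗ[R] C') (d : Y →ₗ[R] D),
      Function.Injective α ∧ Function.Exact α β ∧ Function.Surjective β ∧ d ∘ₗ a = α ∘ₗ c ∧
        β ∘ₗ d = c' ∘ₗ b := by
  -- The pushout `U` is an extension of `Z'` by `C`. It must be prolonged to an extension of `C'` by
  -- `C`; the obstruction would lie in `Ext²(F', C)`.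
  obtain ⟨U, i, j, hi, hij, hU, hdesc⟩ := exists_pushout a ha c
  obtain ⟨v, hvi, hvj⟩ := hdesc Z' 0 b (LinearMap.ext fun z => (hab.apply_apply_eq_zero z).symm)
  have hv : Function.Surjective v := fun z => by
    obtain ⟨y, rfl⟩ := hb z
    exact ⟨j y, LinearMap.congr_fun hvj y⟩
  have hiv : Function.Exact i v := fun w => by
    constructor
    · intro hw
      obtain ⟨x, y, rfl⟩ := hU w
      rw [map_add, ← LinearMap.comp_apply, ← LinearMap.comp_apply, hvi, hvj, LinearMap.zero_apply,
        zero_add] at hw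
      obtain ⟨z, rfl⟩ := (hab y).1 hw
      exact ⟨x + c z, by rw [map_add, ← LinearMap.comp_apply i c, ← hij]; rfl⟩
    · rintro ⟨x, rfl⟩
      exact LinearMap.congr_fun hvi x
  -- A flat cover `P` of `C'` shifts this obstruction to `Ext¹(K, C)`, where `K = ker (P → F')` is
  -- h-unitary flat. So `K → Z'` lifts to `U`, and the pushout of `P` along this lift is the
  -- required extension.
  obtain ⟨P, q, hP, hq⟩ := (IsHUnitary.isUnital hC').exists_flat_cover
  let K := LinearMap.ker (p' ∘ₗ q)
  have hK : IsHUnitaryFlat A K := IsHUnitaryFlat.left K.subtype_injective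
    (LinearMap.exact_subtype_ker_map _) (hp'.comp hq) hP hF'
  have hr (k : K) : ∃ z, c' z = q k := (hcp' _).1 k.2
  choose r hr using hr
  obtain ⟨ψ, hψ⟩ := (hC.2 _ hK).exists_lift hi hiv hv
    { toFun := r
      map_add' := fun x y => hc' (by simp [hr])
      map_smul' := fun t x => hc' (by simp [hr]) }
  have hψ' (k : K) : c' (v (ψ k)) = q k := (congrArg c' (LinearMap.congr_fun hψ k)).trans (hr k)
  obtain ⟨D, i', j', hi', hij', hD, hdesc'⟩ := exists_pushout K.subtype K.subtype_injective ψ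
  obtain ⟨β, hβi, hβj⟩ := hdesc' C' (c' ∘ₗ v) q (LinearMap.ext hψ')
  refine ⟨D, i' ∘ₗ i, β, i' ∘ₗ j, hi'.comp hi, fun w => ⟨fun hw => ?_, ?_⟩, fun x => ?_, ?_, ?_⟩
  · obtain ⟨x, y, rfl⟩ := hD w
    rw [map_add, ← LinearMap.comp_apply, ← LinearMap.comp_apply, hβi, hβj,
      LinearMap.comp_apply] at hw
    have hy : y ∈ K := by
      have := congrArg p' hw
      rw [map_add, hcp'.apply_apply_eq_zero, zero_add, map_zero] at this
      exact this
    have h1 : v (x + ψ ⟨y, hy⟩) = 0 := hc' (by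
      rw [map_add, map_add, hψ', map_zero]
      exact hw)
    obtain ⟨z, hz⟩ := (hiv _).1 h1
    refine ⟨z, ?_⟩
    rw [LinearMap.comp_apply, hz, map_add, ← LinearMap.comp_apply i' ψ, ← hij']
    rfl
  · rintro ⟨x, rfl⟩
    rw [LinearMap.comp_apply, ← LinearMap.comp_apply β, hβi, LinearMap.comp_apply,
      hiv.apply_apply_eq_zero, map_zero]
  · obtain ⟨y, rfl⟩ := hq x
    exact ⟨j' y, LinearMap.congr_fun hβj y⟩
  · rw [LinearMap.comp_assoc, hij, LinearMap.comp_assoc]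
  · rw [← LinearMap.comp_assoc, hβi, LinearMap.comp_assoc, hvj]

/-- The extensions of h-unitary modules are h-unitary, hence the relative `Ext¹` between h-unitary
modules agrees with the absolute one. -/
theorem hUnitaryCotorsion_iff (Y : ModuleCat.{u} R) :
    hUnitaryCotorsion A Y ↔ IsHUnitaryCotorsion A Y := by
  refine and_congr_right fun hY => forall₂_congr fun F hF => ⟨fun h => ?_, fun h => ?_⟩
  · refine extVanishes_one_of_splits _ fun E _ _ f g hf hfg hg => ?_
    obtain ⟨s⟩ := h (ModuleCat.of R E) (ModuleCat.ofHom f) (ModuleCat.ofHom g) _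
      (IsHUnitary.mid hf hfg hg hY hF.1) (moduleCat_shortExact hf hfg hg)
    exact ⟨s.s.hom, congrArg ModuleCat.Hom.hom s.s_g⟩
  · intro E f g w hE hS
    obtain ⟨l, hl⟩ := h.exists_lift (f := f.hom) (g := g.hom)
      ((ModuleCat.mono_iff_injective _).1 hS.mono_f)
      ((ShortComplex.ShortExact.moduleCat_exact_iff_function_exact _).1 hS.exact)
      ((ModuleCat.epi_iff_surjective _).1 hS.epi_g) LinearMap.id
    have := hS.mono_f
    exact ⟨ShortComplex.Splitting.ofExactOfSection _ hS.exact (ModuleCat.ofHom l)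
      (ModuleCat.hom_ext hl) this⟩

end Pushouts

/-! ### Small h-unitary submodules cut out of a resolution by the generator. -/

section SmallSubmodules

variable {R : Type u} [Ring R] {A : Ideal R} [A.IsTwoSided] {G : ModuleCat.{u} R}
  {κ : Cardinal.{u}}

/-- Every presentation of an h-unitary module by a direct sum of copies of a flat generator
extends to a resolution. -/
theorem IsFlatGenerator.exists_resolution (hG : IsFlatGenerator A G) (M : ModuleCat.{u} R)
    (hM : hUnitary A M) (ι₀ : Type u) (p₀ : (ι₀ →₀ G) →ₗ[R] M) (hp₀ : Function.Surjective p₀) :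
    ∃ (ι : ℕ → Type u) (H : ℕ → ModuleCat.{u} R) (p : ∀ k, (ι k →₀ G) →ₗ[R] H k)
      (e : ∀ k, H (k + 1) →ₗ[R] (ι k →₀ G)) (i : ι 0 ≃ ι₀) (q : H 0 ≃ₗ[R] M),
      (∀ k, Function.Surjective (p k)) ∧ (∀ k, Function.Injective (e k)) ∧
        (∀ k, Function.Exact (e k) (p k)) ∧ ∀ x, q (p 0 x) = p₀ (Finsupp.lmapDomain G R i x) := by
  choose ι p hp using hG.generates
  let σ := {X : Σ (H : ModuleCat.{u} R) (ι : Type u), (ι →₀ G) →ₗ[R] H //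
    hUnitary A X.1 ∧ Function.Surjective X.2.2}
  have hK (X : σ) : hUnitary A (ModuleCat.of R (LinearMap.ker X.1.2.2)) :=
    IsHUnitary.left (Submodule.subtype_injective _) (LinearMap.exact_subtype_ker_map _)
      X.2.2 (isHUnitary_finsupp hG.mem.1) X.2.1
  let H : ℕ → σ := fun k => Nat.rec ⟨⟨M, ι₀, p₀⟩, hM, hp₀⟩ (fun _ X =>
    ⟨⟨ModuleCat.of R (LinearMap.ker X.1.2.2), ι _ (hK X), p _ (hK X)⟩, hK X, hp _ (hK X)⟩) k
  refine ⟨fun k => (H k).1.2.1, fun k => (H k).1.1, fun k => (H k).1.2.2,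
    fun k => (LinearMap.ker (H k).1.2.2).subtype, Equiv.refl ι₀, LinearEquiv.refl R M,
    fun k => (H k).2.2, fun k => Submodule.subtype_injective _,
    fun k => LinearMap.exact_subtype_ker_map _, fun x => congrArg p₀ ?_⟩
  exact Finsupp.mapDomain_id.symm

/-- For every presentation of an h-unitary module by a direct sum of copies of `G`, the images of
small partial sums that are h-unitary cover the module. -/
theorem IsFlatGenerator.exists_small_submodule (hG : IsFlatGenerator A G) (hκ : ℵ₀ ≤ κ)
    (hGκ : #G ≤ κ) (M : ModuleCat.{u} R) (hM : hUnitary A M) (ι₀ : Type u)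
    (p₀ : (ι₀ →₀ G) →ₗ[R] M) (hp₀ : Function.Surjective p₀) (x : M) :
    ∃ s : Set ι₀, #s ≤ κ ∧ x ∈ (Finsupp.supported G R s).map p₀ ∧
      IsHUnitary A ((Finsupp.supported G R s).map p₀) := by
  classical
  obtain ⟨ι, H, p, e, i₀, q, hp, he, hep, hq⟩ := hG.exists_resolution M hM ι₀ p₀ hp₀
  choose y hy using hp
  -- All levels of the resolution are closed off simultaneously, inside the disjoint union of their
  -- index sets.
  let Ω := Σ k, ι (ULift.down.{u} k)
  let inj (k : ℕ) : Set (ι k) → Set Ω := fun s => (fun i => (⟨⟨k⟩, i⟩ : Ω)) '' s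
  let lev (X : Set Ω) (k : ℕ) : Set (ι k) := {i | (⟨⟨k⟩, i⟩ : Ω) ∈ X}
  have hinj (k : ℕ) : Function.Injective fun i : ι k => (⟨⟨k⟩, i⟩ : Ω) :=
    fun a b h => eq_of_heq (Sigma.mk.inj_iff.1 h).2
  have hlev (J : Finset Ω) (k : ℕ) : #(lev J k) ≤ κ :=
    (Cardinal.mk_le_of_injective (f := fun i : lev J k => (⟨⟨⟨k⟩, i.1⟩, i.2⟩ : (J : Set Ω)))
      fun a b h => Subtype.ext (hinj _ (congrArg Subtype.val h))).trans (mk_finset_coe_le hκ J)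
  -- Two closure operations: `c₁` adds what is needed to cover the syzygies already supported at
  -- level `k`, giving exactness; `c₂` adds the supports of the images of generators from level `k +
  -- 1`, giving a subcomplex. For `c₁` each `z` has at most one preimage `w`, as `e k` is injective.
  let c₁ (J : Finset Ω) (k : ℕ) : Set (ι (k + 1)) :=
    ⋃ z ∈ {z : ι k →₀ G | z ∈ Finsupp.supported G R (lev J k)},
      ⋃ w ∈ {w : H (k + 1) | e k w = z}, ((y (k + 1) w).support : Set (ι (k + 1)))
  let c₂ (J : Finset Ω) (k : ℕ) : Set (ι k) :=
    ⋃ i ∈ lev J (k + 1), ⋃ g : G,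
      ((e k (p (k + 1) (Finsupp.single i g))).support : Set (ι k))
  have hc₁ (J : Finset Ω) (k : ℕ) : #(c₁ J k) ≤ κ :=
    mk_biUnion_le_of_le hκ _ (mk_supported_le (R := R) hκ (hlev J k) hGκ) fun z =>
      mk_biUnion_le_of_le hκ _ ((Cardinal.mk_le_one_iff_set_subsingleton.2
        fun a ha b hb => he k (ha.trans hb.symm)).trans (Cardinal.one_le_aleph0.trans hκ))
        fun w => mk_finset_coe_le hκ _
  have hc₂ (J : Finset Ω) (k : ℕ) : #(c₂ J k) ≤ κ :=
    mk_biUnion_le_of_le hκ _ (hlev J (k + 1)) fun i =>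
      mk_iUnion_le_of_le hκ _ hGκ fun g => mk_finset_coe_le hκ _
  obtain ⟨X, hX₀, hXκ, hX⟩ := exists_closed_set hκ
    (fun J : Finset Ω => (⋃ k, inj (k + 1) (c₁ J k)) ∪ ⋃ k, inj k (c₂ J k))
    (fun J => mk_union_le_of_le hκ
      (mk_iUnion_nat_le_of_le hκ _ fun k => Cardinal.mk_image_le.trans (hc₁ J k))
      (mk_iUnion_nat_le_of_le hκ _ fun k => Cardinal.mk_image_le.trans (hc₂ J k)))
    (inj 0 (y 0 (q.symm x)).support) (Cardinal.mk_image_le.trans (mk_finset_coe_le hκ _))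
  let B (k : ℕ) := Finsupp.supported G R (lev X k)
  let T (k : ℕ) : Submodule R (H k) := (B k).map (p k)
  have hB (k : ℕ) : IsHUnitary A (B k) :=
    (isHUnitary_finsupp hG.mem.1).of_linearEquiv (Finsupp.supportedEquivFinsupp (lev X k)).symm
  have he₁ (k : ℕ) (w : H (k + 1)) (hw : e k w ∈ B k) : w ∈ T (k + 1) := by
    refine ⟨y (k + 1) w, fun i hi => ?_, hy _ _⟩
    let J : Finset Ω := (e k w).support.map ⟨fun i => ⟨⟨k⟩, i⟩, hinj k⟩
    have hJ : (J : Set Ω) ⊆ X := by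
      intro j hj
      obtain ⟨i, hi, rfl⟩ := Finset.mem_map.1 hj
      exact hw hi
    refine hX J hJ (Or.inl (Set.mem_iUnion.2 ⟨k, i, ?_, rfl⟩))
    refine Set.mem_biUnion (x := e k w) ?_ (Set.mem_biUnion (x := w) rfl hi)
    exact fun i hi => Finset.mem_map.2 ⟨i, hi, rfl⟩
  have he₂ (k : ℕ) : T (k + 1) ≤ (B k).comap (e k) := by
    rw [Submodule.map_le_iff_le_comap, ← Submodule.comap_comp]
    intro z hz
    rw [Submodule.mem_comap, ← Finsupp.sum_single z, Finsupp.sum, map_sum]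
    refine Submodule.sum_mem _ fun i hi j hj => ?_
    have hJ : (({⟨⟨k + 1⟩, i⟩} : Finset Ω) : Set Ω) ⊆ X := by
      rw [Finset.coe_singleton, Set.singleton_subset_iff]
      exact hz hi
    refine hX _ hJ (Or.inr (Set.mem_iUnion.2 ⟨k, j, ?_, rfl⟩))
    refine Set.mem_biUnion (x := i) ?_ (Set.mem_iUnion.2 ⟨z i, hj⟩)
    exact Finset.mem_coe.2 (Finset.mem_singleton_self _)
  -- The closed set restricts the resolution to exact sequences `0 → T (k+1) → B k → T k → 0`. In
  -- degree zero `T k` is unital as an image of `B k`; higher degrees follow by dimension shifting,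
  -- for all `k` at once.
  have hT (n : ℕ) : ∀ k, ExtVanishes R n (T k) (RightDual (quotientRight A)) := by
    induction n with
    | zero =>
      intro k
      exact extVanishes_zero_iff.2 (hom_eq_zero_iff_isUnital.2 ((IsHUnitary.isUnital
        (hB k)).of_surjective ((p k).submoduleMap (B k)) ((p k).submoduleMap_surjective _)))
    | succ n ih =>
      intro k
      refine ExtVanishes.right_succ (f := (e k).restrict (p := T (k + 1)) (q := B k) (he₂ k))
        (g := (p k).submoduleMap (B k)) (fun a b h => ?_) (fun z => ⟨fun hz => ?_, ?_⟩)
        ((p k).submoduleMap_surjective _) (ih (k + 1)) (isHUnitary_iff.1 (hB k) (n + 1))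
      · exact Subtype.ext (he k (congrArg Subtype.val h))
      · obtain ⟨w, hw⟩ := (hep k z.1).1 (congrArg Subtype.val hz)
        exact ⟨⟨w, he₁ k w (by rw [hw]; exact z.2)⟩, Subtype.ext hw⟩
      · rintro ⟨w, rfl⟩
        exact Subtype.ext ((hep k).apply_apply_eq_zero w.1)
  have hT₀ : (Finsupp.supported G R (i₀ '' lev X 0)).map p₀ = (T 0).map q.toLinearMap := by
    have : Finsupp.supported G R (i₀ '' lev X 0) =
        (B 0).map (Finsupp.lmapDomain G R i₀) := (Finsupp.lmapDomain_supported _ _ _ _).symm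
    rw [this, ← Submodule.map_comp, ← Submodule.map_comp]
    exact congrArg (fun f => (B 0).map f) (LinearMap.ext fun x => (hq x).symm)
  refine ⟨i₀ '' lev X 0, ?_, ?_, ?_⟩
  · refine Cardinal.mk_image_le.trans ?_
    exact (Cardinal.mk_le_of_injective (f := fun i : lev X 0 => (⟨⟨⟨0⟩, i.1⟩, i.2⟩ : X))
      fun a b h => Subtype.ext (hinj _ (congrArg Subtype.val h))).trans hXκ
  · rw [hT₀]
    exact ⟨q.symm x, ⟨y 0 (q.symm x), fun i hi => hX₀ ⟨i, hi, rfl⟩, hy _ _⟩, q.apply_symm_apply x⟩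
  · rw [hT₀]
    exact IsHUnitary.of_linearEquiv (M₁ := T 0) (isHUnitary_iff.2 fun n => hT n 0)
      (q.submoduleMap (T 0))

end SmallSubmodules

end HUnitary

namespace HUnitary

/-! ### Lifting properties and Ext in an abelian category. -/

section AbelianExt

open Abelian

variable {𝓐 : Type*} [Category.{w} 𝓐] [Abelian 𝓐]

/-- The pullback of a short exact sequence. -/
theorem shortExact_pullback {S : ShortComplex 𝓐} (hS : S.ShortExact) {X : 𝓐} (v : X ⟶ S.X₃) :
    ∃ (f : S.X₁ ⟶ pullback S.g v) (w : f ≫ pullback.snd S.g v = 0),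
      (ShortComplex.mk f (pullback.snd S.g v) w).ShortExact := by
  have := hS.mono_f
  have := hS.epi_g
  have hw : S.f ≫ S.g = (0 : S.X₁ ⟶ X) ≫ v := by rw [S.zero, zero_comp]
  have hf : pullback.lift S.f 0 hw ≫ pullback.fst S.g v = S.f := pullback.lift_fst _ _ _
  have hs : pullback.lift S.f 0 hw ≫ pullback.snd S.g v = 0 := pullback.lift_snd _ _ _
  have : Mono (pullback.lift S.f 0 hw) := mono_of_mono_fac hf
  refine ⟨pullback.lift S.f 0 hw, hs, ShortComplex.ShortExact.mk' ?_ this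
    (inferInstanceAs (Epi (pullback.snd S.g v)))⟩
  refine ShortComplex.exact_of_f_is_kernel _ (KernelFork.IsLimit.ofι' _ _ fun {A} k hk => ?_)
  have hk' : k ≫ pullback.snd S.g v = 0 := hk
  have hl : (k ≫ pullback.fst S.g v) ≫ S.g = 0 := by
    rw [Category.assoc, pullback.condition, reassoc_of% hk', zero_comp]
  refine ⟨hS.exact.lift _ hl, pullback.hom_ext ?_ ?_⟩
  · rw [Category.assoc]
    exact (congrArg _ hf).trans (hS.exact.lift_f _ _)
  · rw [Category.assoc]
    exact ((congrArg _ hs).trans comp_zero).trans hk'.symm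

variable [HasExt.{w} 𝓐]

theorem subsingleton_ext_iff_zero {X Y : 𝓐} {n : ℕ} :
    Subsingleton (Ext.{w} X Y n) ↔ ∀ x : Ext.{w} X Y n, x = 0 :=
  ⟨fun _ _ => Subsingleton.elim _ _, fun h => ⟨fun x y => (h x).trans (h y).symm⟩⟩

theorem exists_lift_of_subsingleton_ext {S : ShortComplex 𝓐} (hS : S.ShortExact) {X : 𝓐}
    (h : Subsingleton (Ext.{w} X S.X₁ 1)) (v : X ⟶ S.X₃) : ∃ l : X ⟶ S.X₂, l ≫ S.g = v := by
  obtain ⟨y, hy⟩ := Ext.covariant_sequence_exact₃ _ hS (Ext.mk₀ v) rfl (Subsingleton.elim _ _)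
  obtain ⟨l, rfl⟩ := (Ext.mk₀_bijective _ _).2 y
  rw [Ext.mk₀_comp_mk₀] at hy
  exact ⟨l, (Ext.mk₀_bijective _ _).1 hy⟩

theorem exists_extension_of_subsingleton_ext {S : ShortComplex 𝓐} (hS : S.ShortExact) {Y : 𝓐}
    (h : Subsingleton (Ext.{w} S.X₃ Y 1)) (v : S.X₁ ⟶ Y) : ∃ l : S.X₂ ⟶ Y, S.f ≫ l = v := by
  obtain ⟨y, hy⟩ := Ext.contravariant_sequence_exact₁ hS _ (Ext.mk₀ v) rfl (Subsingleton.elim _ _)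
  obtain ⟨l, rfl⟩ := (Ext.mk₀_bijective _ _).2 y
  rw [Ext.mk₀_comp_mk₀] at hy
  exact ⟨l, (Ext.mk₀_bijective _ _).1 hy⟩

theorem subsingleton_ext_mid {S : ShortComplex 𝓐} (hS : S.ShortExact) {Y : 𝓐} {n : ℕ}
    (h₁ : Subsingleton (Ext.{w} S.X₁ Y n)) (h₃ : Subsingleton (Ext.{w} S.X₃ Y n)) :
    Subsingleton (Ext.{w} S.X₂ Y n) :=
  subsingleton_ext_iff_zero.2 fun x => by
    obtain ⟨y, rfl⟩ := Ext.contravariant_sequence_exact₂ hS _ x (Subsingleton.elim _ _)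
    rw [subsingleton_ext_iff_zero.1 h₃ y, Ext.comp_zero]

theorem subsingleton_ext_one_of_splits [EnoughInjectives 𝓐] {X Y : 𝓐}
    (h : ∀ (E : 𝓐) (f : Y ⟶ E) (g : E ⟶ X) (w : f ≫ g = 0),
      (ShortComplex.mk f g w).ShortExact → ∃ s : X ⟶ E, s ≫ g = 𝟙 X) :
    Subsingleton (Ext.{w} X Y 1) := by
  let S := ShortComplex.mk (Injective.ι Y) (cokernel.π _) (cokernel.condition _)
  have hS : S.ShortExact :=
    { exact := ShortComplex.exact_of_g_is_cokernel _ (cokernelIsCokernel _) }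
  refine subsingleton_ext_iff_zero.2 fun x => ?_
  obtain ⟨y, rfl⟩ := Ext.covariant_sequence_exact₁ _ hS x (Ext.eq_zero_of_injective _) rfl
  obtain ⟨v, rfl⟩ := (Ext.mk₀_bijective _ _).2 y
  obtain ⟨f, w, hf⟩ := shortExact_pullback hS v
  obtain ⟨s, hs⟩ := h _ _ _ _ hf
  have : v = (s ≫ pullback.fst S.g v) ≫ S.g := by
    rw [Category.assoc, pullback.condition, reassoc_of% hs]
  rw [this, ← Ext.mk₀_comp_mk₀, Ext.comp_assoc (h₁₂ := zero_add 0) (h₂₃ := zero_add 1) (h := rfl),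
    hS.comp_extClass, Ext.comp_zero]

/-- A monomorphism with cokernel `X` has the left lifting property with respect to every
epimorphism with kernel `K` such that `Ext¹(X, K) = 0`. -/
theorem hasLiftingProperty_of_subsingleton_ext {S T : ShortComplex 𝓐} (hS : S.ShortExact)
    (hT : T.ShortExact) (h : Subsingleton (Ext.{w} S.X₃ T.X₁ 1)) :
    HasLiftingProperty S.f T.g where
  sq_hasLift {a b} sq := by
    have := hT.mono_f
    -- The obstruction to lifting `b` dies on `S.X₁`, where `a` is a lift, so it comes from
    -- `Ext¹(S.X₃, T.X₁) = 0`. The difference between `a` and the restricted lift has values in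
    -- `T.X₁` and is extended to `S.X₂`.
    have h0 : (Ext.mk₀ S.f).comp ((Ext.mk₀ b).comp hT.extClass (zero_add 1)) (zero_add 1) = 0 := by
      rw [Ext.mk₀_comp_mk₀_assoc, ← sq.w, ← Ext.mk₀_comp_mk₀,
        Ext.comp_assoc (h₁₂ := zero_add 0) (h₂₃ := zero_add 1) (h := rfl), hT.comp_extClass,
        Ext.comp_zero]
    obtain ⟨e, he⟩ := Ext.contravariant_sequence_exact₂ hS _ _ h0
    rw [subsingleton_ext_iff_zero.1 h e, Ext.comp_zero] at he
    obtain ⟨y, hy⟩ := Ext.covariant_sequence_exact₃ _ hT (Ext.mk₀ b) rfl he.symm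
    obtain ⟨l, rfl⟩ := (Ext.mk₀_bijective _ _).2 y
    rw [Ext.mk₀_comp_mk₀] at hy
    have hl : l ≫ T.g = b := (Ext.mk₀_bijective _ _).1 hy
    have hd : (a - S.f ≫ l) ≫ T.g = 0 := by
      rw [Preadditive.sub_comp, Category.assoc, hl, sq.w, sub_self]
    obtain ⟨m, hm⟩ := exists_extension_of_subsingleton_ext hS h (hT.exact.lift _ hd)
    refine ⟨⟨⟨l + m ≫ T.f, ?_, ?_⟩⟩⟩
    · rw [Preadditive.comp_add, reassoc_of% hm, ShortComplex.Exact.lift_f]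
      abel
    · rw [Preadditive.add_comp, hl, Category.assoc, T.zero, comp_zero, add_zero]

/-- The monomorphisms whose cokernel has the property `P`. -/
def monosWithCokernel (P : ObjectProperty 𝓐) : MorphismProperty 𝓐 :=
  fun _ B f => ∃ (X : 𝓐) (g : B ⟶ X) (w : f ≫ g = 0), (ShortComplex.mk f g w).ShortExact ∧ P X

theorem rlp_monosWithCokernel {P : ObjectProperty 𝓐} {T : ShortComplex 𝓐} (hT : T.ShortExact)
    (h : ∀ X, P X → Subsingleton (Ext.{w} X T.X₁ 1)) : (monosWithCokernel P).rlp T.g := by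
  rintro _ _ f ⟨X, g, w, hS, hX⟩
  exact hasLiftingProperty_of_subsingleton_ext hS hT (h X hX)

/-- Transfers orthogonality from `P` to the cokernels of all maps in `llp (rlp ...)`: the lift of
the square starting with the zero map descends to the cokernel. -/
theorem exists_section_of_llp_rlp {P : ObjectProperty 𝓐} {S T : ShortComplex 𝓐}
    (hS : S.ShortExact) (hP : (monosWithCokernel P).rlp.llp S.f) (hT : T.ShortExact)
    (h : ∀ X, P X → Subsingleton (Ext.{w} X T.X₁ 1)) (v : S.X₃ ⟶ T.X₃) :
    ∃ s : S.X₃ ⟶ T.X₂, s ≫ T.g = v := by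
  have := hP _ (rlp_monosWithCokernel hT h)
  have := hS.epi_g
  have sq : CommSq 0 S.f T.g (S.g ≫ v) := ⟨by simp⟩
  refine ⟨hS.exact.desc sq.lift sq.fac_left, ?_⟩
  rw [← cancel_epi S.g, hS.exact.g_desc_assoc, sq.fac_right]

end AbelianExt

section FlatCokernels

variable {R : Type u} [Ring R] {A : Ideal R} [A.IsTwoSided]

/-- Testing against extensions by character modules gives flatness; testing against `0 → (R/A)⁺`
gives unitality. -/
theorem hUnitaryFlat_of_llp_rlp {S : ShortComplex (ModuleCat.{u} R)} (hS : S.ShortExact)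
    (h : (monosWithCokernel (hUnitaryFlat A)).rlp.llp S.f) : hUnitaryFlat A S.X₃ := by
  refine isHUnitaryFlat_of_isUnital ((isFlat_iff_extVanishes _).2 fun N => ?_)
    (hom_eq_zero_iff_isUnital.1 fun φ => ?_)
  · refine extVanishes_one_of_splits _ fun E _ _ f g hf hfg hg => ?_
    obtain ⟨s, hs⟩ := exists_section_of_llp_rlp hS h (moduleCat_shortExact hf hfg hg)
      (fun X hX => hX.2.extVanishes 0 N) (𝟙 _)
    exact ⟨s.hom, congrArg ModuleCat.Hom.hom hs⟩
  · have hp : (monosWithCokernel (hUnitaryFlat A)).rlp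
        (0 : ModuleCat.of R PUnit.{u + 1} ⟶ ModuleCat.of R (RightDual (quotientRight A))) := by
      rintro _ _ f ⟨X, g, w, hX, hXF⟩
      have := hX.epi_g
      refine ⟨fun {a b} sq => ⟨⟨⟨0, ?_, ?_⟩⟩⟩⟩
      · exact (ModuleCat.isZero_of_subsingleton _).eq_of_tgt _ _
      · have : hX.exact.desc b (by rw [← sq.w, comp_zero]) = 0 := ModuleCat.hom_ext
          (hom_eq_zero_iff_isUnital.2 (IsHUnitary.isUnital hXF.1) _)
        rw [← hX.exact.g_desc b (by rw [← sq.w, comp_zero]), this, comp_zero, comp_zero]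
    have := h _ hp
    have sq : CommSq 0 S.f (0 : ModuleCat.of R PUnit.{u + 1} ⟶ _)
      (S.g ≫ ModuleCat.ofHom φ) := ⟨by simp⟩
    have := hS.epi_g
    have h0 : ModuleCat.ofHom φ = 0 := by
      rw [← cancel_epi S.g, ← sq.fac_right, comp_zero, comp_zero]
    exact congrArg ModuleCat.Hom.hom h0

end FlatCokernels

end HUnitary

namespace HUnitary

/-! ### Cycles and h-unitarity in short exact sequences of complexes. -/

section Complexes

variable {R : Type u} [Ring R]

/-- A linear map whose values lie in the range of an injective map factors through it. -/
theorem exists_factor_of_injective {X Y Z : Type u} [AddCommGroup X] [Module R X] [AddCommGroup Y]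
    [Module R Y] [AddCommGroup Z] [Module R Z] {f : X →ₗ[R] Y} (hf : Function.Injective f)
    (φ : Z →ₗ[R] Y) (h : ∀ z, ∃ x, f x = φ z) : ∃ ψ : Z →ₗ[R] X, ∀ z, f (ψ z) = φ z := by
  choose ψ hψ using h
  exact ⟨{ toFun := ψ
           map_add' := fun x y => hf (by simp only [map_add, hψ])
           map_smul' := fun r x => hf (by simp only [map_smul, hψ, RingHom.id_apply]) }, hψ⟩

variable {K L : CochainComplex (ModuleCat.{u} R) ℤ}

theorem hom_d_apply (f : K ⟶ L) (i j : ℤ) (x : K.X i) :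
    (L.d i j).hom ((f.f i).hom x) = (f.f j).hom ((K.d i j).hom x) :=
  LinearMap.congr_fun (congrArg ModuleCat.Hom.hom (f.comm i j)) x

theorem d_d_apply (K : CochainComplex (ModuleCat.{u} R) ℤ) (i j k : ℤ) (x : K.X i) :
    (K.d j k).hom ((K.d i j).hom x) = 0 :=
  LinearMap.congr_fun (congrArg ModuleCat.Hom.hom (K.d_comp_d i j k)) x

theorem hom_f_zero_apply {M : CochainComplex (ModuleCat.{u} R) ℤ} {f : K ⟶ L} {g : L ⟶ M}
    (w : f ≫ g = 0) (i : ℤ) (x : K.X i) : (g.f i).hom ((f.f i).hom x) = 0 := by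
  have := HomologicalComplex.congr_hom w i
  exact LinearMap.congr_fun (congrArg ModuleCat.Hom.hom this) x

theorem acyclic_iff : K.Acyclic ↔ ∀ i j k : ℤ, i + 1 = j → j + 1 = k →
    Function.Exact (K.d i j).hom (K.d j k).hom := by
  have (i j k : ℤ) (hij : i + 1 = j) (hjk : j + 1 = k) :
      K.ExactAt j ↔ Function.Exact (K.d i j).hom (K.d j k).hom := by
    rw [K.exactAt_iff' i j k (by simp [← hij]) (by simp [← hjk])]
    exact ShortComplex.ShortExact.moduleCat_exact_iff_function_exact _
  exact ⟨fun h i j k hij hjk => (this i j k hij hjk).1 (h j), fun h j =>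
    (this (j - 1) j (j + 1) (by simp) rfl).2 (h _ _ _ (by simp) rfl)⟩

theorem shortExact_complex_iff {Y E X : CochainComplex (ModuleCat.{u} R) ℤ} {f : Y ⟶ E}
    {g : E ⟶ X} {w : f ≫ g = 0} : (ShortComplex.mk f g w).ShortExact ↔
      ∀ i, Function.Injective (f.f i).hom ∧ Function.Exact (f.f i).hom (g.f i).hom ∧
        Function.Surjective (g.f i).hom := by
  rw [HomologicalComplex.shortExact_iff_degreewise_shortExact]
  refine forall_congr' fun i => ⟨fun h => ?_, fun h => ?_⟩
  · exact ⟨(ModuleCat.mono_iff_injective _).1 h.mono_f,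
      (ShortComplex.ShortExact.moduleCat_exact_iff_function_exact _).1 h.exact,
      (ModuleCat.epi_iff_surjective _).1 h.epi_g⟩
  · exact moduleCat_shortExact h.1 h.2.1 h.2.2

variable {A : Ideal R} [A.IsTwoSided]

theorem exact_ker_range (i j : ℤ) : Function.Exact
    (LinearMap.ker (K.d i j).hom).subtype (K.d i j).hom.rangeRestrict := by
  rw [LinearMap.exact_iff, LinearMap.ker_rangeRestrict, Submodule.range_subtype]

theorem hUnitaryComplex_iff : hUnitaryComplex A K ↔ ∀ i j : ℤ, i + 1 = j →
    IsHUnitary A (LinearMap.ker (K.d i j).hom) ∧ IsHUnitary A (K.X i) := by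
  refine ⟨?_, fun h i => ?_⟩
  · rintro h i _ rfl
    exact ⟨(h i).1, (h i).2.1⟩
  · obtain ⟨h₁, h₂⟩ := h i _ rfl
    exact ⟨h₁, h₂, IsHUnitary.right (Submodule.subtype_injective _) (exact_ker_range i (i + 1))
      (LinearMap.surjective_rangeRestrict _) h₁ h₂⟩

theorem hUnitaryComplex.isHUnitary_ker (h : hUnitaryComplex A K) {i j : ℤ} (hij : i + 1 = j) :
    IsHUnitary A (LinearMap.ker (K.d i j).hom) :=
  (hUnitaryComplex_iff.1 h i j hij).1

theorem hUnitaryComplex.isHUnitary_X (h : hUnitaryComplex A K) (i : ℤ) : IsHUnitary A (K.X i) :=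
  (hUnitaryComplex_iff.1 h i _ rfl).2

theorem hUnitaryComplex.isHUnitary_range (h : hUnitaryComplex A K) {i j : ℤ} (hij : i + 1 = j) :
    IsHUnitary A (LinearMap.range (K.d i j).hom) := by
  subst hij
  exact (h i).2.2

/-- The map induced on cycles. -/
def cyclesHom (f : K ⟶ L) (i j : ℤ) :
    LinearMap.ker (K.d i j).hom →ₗ[R] LinearMap.ker (L.d i j).hom :=
  (f.f i).hom.restrict fun x hx => by
    rw [LinearMap.mem_ker, hom_d_apply, LinearMap.mem_ker.1 hx, map_zero]

theorem cyclesHom_coe (f : K ⟶ L) (i j : ℤ) (x : LinearMap.ker (K.d i j).hom) :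
    (cyclesHom f i j x : L.X i) = (f.f i).hom x := rfl

section ShortExact

variable {Y E X : CochainComplex (ModuleCat.{u} R) ℤ} {f : Y ⟶ E} {g : E ⟶ X} {w : f ≫ g = 0}

theorem cyclesHom_shortExact (hS : (ShortComplex.mk f g w).ShortExact) (hY : Y.Acyclic) {i j : ℤ}
    (hij : i + 1 = j) : Function.Injective (cyclesHom f i j) ∧
      Function.Exact (cyclesHom f i j) (cyclesHom g i j) ∧
      Function.Surjective (cyclesHom g i j) := by
  have h := shortExact_complex_iff.1 hS
  refine ⟨fun x y hxy => Subtype.ext ((h i).1 (congrArg Subtype.val hxy)), fun e => ⟨fun he => ?_, ?_⟩,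
    fun x => ?_⟩
  · obtain ⟨y, hy⟩ := ((h i).2.1 e.1).1 (congrArg Subtype.val he)
    refine ⟨⟨y, (h j).1 ?_⟩, Subtype.ext hy⟩
    rw [← hom_d_apply, hy, map_zero]
    exact e.2
  · rintro ⟨y, rfl⟩
    exact Subtype.ext (hom_f_zero_apply w i y.1)
  · obtain ⟨e, he⟩ := (h i).2.2 x.1
    have h0 : (g.f j).hom ((E.d i j).hom e) = 0 := by
      rw [← hom_d_apply, he]
      exact x.2
    -- The boundary of a lift of a cycle is a cycle of `Y`; it is a boundary by acyclicity, and
    -- correcting by it makes the lift a cycle.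
    obtain ⟨y, hy⟩ := ((h j).2.1 _).1 h0
    have hy0 : (Y.d j (j + 1)).hom y = 0 := (h (j + 1)).1 (by
      rw [← hom_d_apply, hy, d_d_apply, map_zero])
    obtain ⟨y', rfl⟩ := (acyclic_iff.1 hY i j _ hij rfl y).1 hy0
    refine ⟨⟨e - (f.f i).hom y', ?_⟩, Subtype.ext ?_⟩
    · rw [LinearMap.mem_ker, map_sub, hom_d_apply, hy, sub_self]
    · rw [cyclesHom_coe, map_sub, hom_f_zero_apply w, sub_zero, he]

/-- Makes the relative `Ext¹` into an acyclic complex agree with the absolute one. Without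
acyclicity of `Y` the cycles need not form a short exact sequence. -/
theorem hUnitaryComplex_mid (hS : (ShortComplex.mk f g w).ShortExact) (hY : Y.Acyclic)
    (hYQ : hUnitaryComplex A Y) (hX : hUnitaryComplex A X) : hUnitaryComplex A E :=
  hUnitaryComplex_iff.2 fun i j hij => by
    obtain ⟨h₁, h₂, h₃⟩ := cyclesHom_shortExact hS hY hij
    obtain ⟨k₁, k₂, k₃⟩ := shortExact_complex_iff.1 hS i
    exact ⟨IsHUnitary.mid h₁ h₂ h₃ (hYQ.isHUnitary_ker hij) (hX.isHUnitary_ker hij),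
      IsHUnitary.mid k₁ k₂ k₃ (hYQ.isHUnitary_X i) (hX.isHUnitary_X i)⟩

/-- If the middle term of a short exact sequence `0 → Y → E → X → 0` of complexes is acyclic, then
some module is an extension both of `Z_j Y` by `Z_i E` and of `Z_i X` by `Y_i`, where
`j = i + 1`. -/
theorem exists_connecting_module (hS : (ShortComplex.mk f g w).ShortExact) (hE : E.Acyclic)
    {i j k : ℤ} (hij : i + 1 = j) (hjk : j + 1 = k) :
    ∃ (V : ModuleCat.{u} R) (a : LinearMap.ker (E.d i j).hom →ₗ[R] V)
      (b : V →ₗ[R] LinearMap.ker (Y.d j k).hom) (a' : Y.X i →ₗ[R] V)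
      (b' : V →ₗ[R] LinearMap.ker (X.d i j).hom), Function.Injective a ∧ Function.Exact a b ∧
        Function.Surjective b ∧ Function.Injective a' ∧ Function.Exact a' b' ∧
          Function.Surjective b' := by
  have h := shortExact_complex_iff.1 hS
  -- `V` is the preimage in `E_i` of the cycles of `X`. It projects onto `Z_i X` with kernel `Y_i`,
  -- and the differential of `E` maps it onto `Z_j Y` with kernel `Z_i E`.
  let V : Submodule R (E.X i) := LinearMap.ker ((X.d i j).hom ∘ₗ (g.f i).hom)
  have hd (v : V) : (g.f j).hom ((E.d i j).hom v) = 0 := by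
    rw [← hom_d_apply]
    exact v.2
  obtain ⟨b, hb⟩ := exists_factor_of_injective (h j).1 ((E.d i j).hom ∘ₗ V.subtype)
    fun v => ((h j).2.1 _).1 (hd v)
  have hbd (v : V) : (Y.d j k).hom (b v) = 0 := (h k).1 (by
    rw [← hom_d_apply, hb, LinearMap.comp_apply, d_d_apply, map_zero])
  have hZ (x : E.X i) (hx : (E.d i j).hom x = 0) : x ∈ V := by
    rw [LinearMap.mem_ker, LinearMap.comp_apply, hom_d_apply, hx, map_zero]
  refine ⟨ModuleCat.of R V, Submodule.inclusion hZ, b.codRestrict _ hbd,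
    (f.f i).hom.codRestrict V fun y => ?_, ((g.f i).hom ∘ₗ V.subtype).codRestrict _ fun v => v.2,
    Submodule.inclusion_injective hZ, fun v => ⟨fun hv => ?_, ?_⟩, fun y => ?_,
    fun x y hxy => (h i).1 (congrArg Subtype.val hxy), fun v => ⟨fun hv => ?_, ?_⟩, fun x => ?_⟩
  · rw [LinearMap.mem_ker, LinearMap.comp_apply, hom_f_zero_apply w, map_zero]
  · refine ⟨⟨v.1, ?_⟩, rfl⟩
    have hv0 : b v = 0 := congrArg Subtype.val hv
    have := hb v
    rw [hv0, map_zero] at this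
    exact this.symm
  · rintro ⟨x, rfl⟩
    refine Subtype.ext ((h j).1 ((hb _).trans ?_))
    exact (LinearMap.mem_ker.1 x.2).trans (map_zero _).symm
  · have hy : (E.d j k).hom ((f.f j).hom y.1) = 0 := by
      rw [hom_d_apply, LinearMap.mem_ker.1 y.2, map_zero]
    obtain ⟨e, he⟩ := (acyclic_iff.1 hE i j k hij hjk _).1 hy
    refine ⟨⟨e, ?_⟩, Subtype.ext ((h j).1 ((hb _).trans he))⟩
    rw [LinearMap.mem_ker, LinearMap.comp_apply, hom_d_apply, he, hom_f_zero_apply w]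
  · obtain ⟨y, hy⟩ := ((h i).2.1 v.1).1 (congrArg Subtype.val hv)
    exact ⟨y, Subtype.ext hy⟩
  · rintro ⟨y, rfl⟩
    exact Subtype.ext (hom_f_zero_apply w i y)
  · obtain ⟨e, he⟩ := (h i).2.2 x.1
    refine ⟨⟨e, ?_⟩, Subtype.ext he⟩
    rw [LinearMap.mem_ker, LinearMap.comp_apply, he]
    exact x.2

theorem hUnitaryComplex_right (hS : (ShortComplex.mk f g w).ShortExact) (hE : E.Acyclic)
    (hY : hUnitaryComplex A Y) (hEQ : hUnitaryComplex A E) : hUnitaryComplex A X :=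
  hUnitaryComplex_iff.2 fun i j hij => by
    obtain ⟨V, a, b, a', b', h₁, h₂, h₃, h₁', h₂', h₃'⟩ := exists_connecting_module hS hE hij rfl
    obtain ⟨k₁, k₂, k₃⟩ := shortExact_complex_iff.1 hS i
    exact ⟨IsHUnitary.right h₁' h₂' h₃' (hY.isHUnitary_X i)
      (IsHUnitary.mid h₁ h₂ h₃ (hEQ.isHUnitary_ker hij) (hY.isHUnitary_ker rfl)),
      IsHUnitary.right k₁ k₂ k₃ (hY.isHUnitary_X i) (hEQ.isHUnitary_X i)⟩

theorem hUnitaryComplex_left (hS : (ShortComplex.mk f g w).ShortExact) (hE : E.Acyclic)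
    (hEQ : hUnitaryComplex A E) (hX : hUnitaryComplex A X) : hUnitaryComplex A Y := by
  have hY (i : ℤ) : IsHUnitary A (Y.X i) := by
    obtain ⟨k₁, k₂, k₃⟩ := shortExact_complex_iff.1 hS i
    exact IsHUnitary.left k₁ k₂ k₃ (hEQ.isHUnitary_X i) (hX.isHUnitary_X i)
  refine hUnitaryComplex_iff.2 fun j k hjk => ⟨?_, hY j⟩
  have hij : j - 1 + 1 = j := by simp
  obtain ⟨V, a, b, a', b', h₁, h₂, h₃, h₁', h₂', h₃'⟩ := exists_connecting_module hS hE hij hjk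
  exact IsHUnitary.right h₁ h₂ h₃ (hEQ.isHUnitary_ker hij)
    (IsHUnitary.mid h₁' h₂' h₃' (hY (j - 1)) (hX.isHUnitary_ker hij))

end ShortExact

/-- The short exact sequences `0 → Z_i → K_i → Z_j → 0` of an acyclic complex, where
`j = i + 1`. -/
theorem exists_cycles_shortExact (hK : K.Acyclic) {i j k : ℤ} (hij : i + 1 = j)
    (hjk : j + 1 = k) : ∃ g : K.X i →ₗ[R] LinearMap.ker (K.d j k).hom,
      (∀ x, (g x : K.X j) = (K.d i j).hom x) ∧
      Function.Exact (LinearMap.ker (K.d i j).hom).subtype g ∧ Function.Surjective g := by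
  refine ⟨(K.d i j).hom.codRestrict _ fun x => LinearMap.mem_ker.2 (d_d_apply K i j k x), fun x => rfl, ?_, fun x => ?_⟩
  · rw [LinearMap.exact_iff, LinearMap.ker_codRestrict, Submodule.range_subtype]
  · obtain ⟨y, hy⟩ := (acyclic_iff.1 hK i j k hij hjk x.1).1 x.2
    exact ⟨y, Subtype.ext hy⟩

/-- Each cycle module is a quotient of a term, hence unital, with the previous cycle module as
kernel; dimension shifting to the left along the complex gives all degrees. -/
theorem hUnitaryComplex_of_acyclic (hK : K.Acyclic) (h : ∀ i, IsHUnitary A (K.X i)) :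
    hUnitaryComplex A K := by
  have hZ (n : ℕ) : ∀ j k : ℤ, j + 1 = k →
      ExtVanishes R n (LinearMap.ker (K.d j k).hom) (RightDual (quotientRight A)) := by
    induction n with
    | zero =>
      intro j k hjk
      obtain ⟨g, -, -, hg⟩ := exists_cycles_shortExact hK (sub_add_cancel j 1) hjk
      exact extVanishes_zero_iff.2 (hom_eq_zero_iff_isUnital.2
        ((IsHUnitary.isUnital (h (j - 1))).of_surjective g hg))
    | succ n ih =>
      intro j k hjk
      obtain ⟨g, -, hgx, hg⟩ := exists_cycles_shortExact hK (sub_add_cancel j 1) hjk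
      exact ExtVanishes.right_succ (Submodule.subtype_injective _) hgx hg
        (ih _ _ (sub_add_cancel j 1)) (isHUnitary_iff.1 (h (j - 1)) (n + 1))
  exact hUnitaryComplex_iff.2 fun i j hij => ⟨isHUnitary_iff.2 fun n => hZ n i j hij, h i⟩

end Complexes

/-! ### Degreewise split extensions of complexes. -/

section Extend

variable {R : Type u} [Ring R] (T Y : CochainComplex (ModuleCat.{u} R) ℤ)

/-- The extension of the complex `T` by the complex `Y` with underlying graded module `Y × T`
that is given by maps `π i j : T_i → Y_j` anticommuting with the differentials. -/
def extend (π : ∀ i j : ℤ, T.X i →ₗ[R] Y.X j) (hπ : ∀ i j k : ℤ, i + 1 = j → j + 1 = k →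
    ∀ t, (Y.d j k).hom (π i j t) + π j k ((T.d i j).hom t) = 0) :
    CochainComplex (ModuleCat.{u} R) ℤ where
  X i := ModuleCat.of R (Y.X i × T.X i)
  d i j := if i + 1 = j then ModuleCat.ofHom
    (((Y.d i j).hom.coprod (π i j)).prod ((T.d i j).hom ∘ₗ LinearMap.snd R _ _)) else 0
  shape i j h := if_neg h
  d_comp_d' i j k hij hjk := by
    rw [if_pos (show i + 1 = j from hij), if_pos (show j + 1 = k from hjk)]
    refine ModuleCat.hom_ext (LinearMap.ext fun x => Prod.ext ?_ (d_d_apply T i j k x.2))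
    change (Y.d j k).hom ((Y.d i j).hom x.1 + π i j x.2) + π j k ((T.d i j).hom x.2) = 0
    rw [map_add, d_d_apply, zero_add]
    exact hπ i j k hij hjk x.2

variable {T Y} {π : ∀ i j : ℤ, T.X i →ₗ[R] Y.X j} (hπ : ∀ i j k : ℤ, i + 1 = j → j + 1 = k →
    ∀ t, (Y.d j k).hom (π i j t) + π j k ((T.d i j).hom t) = 0)

theorem extend_d {i j : ℤ} (hij : i + 1 = j) (y : Y.X i) (t : T.X i) :
    ((extend T Y π hπ).d i j).hom (y, t) = ((Y.d i j).hom y + π i j t, (T.d i j).hom t) := by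
  simp only [extend, if_pos hij]
  rfl

/-- The inclusion of `Y`. -/
def extendInl : Y ⟶ extend T Y π hπ where
  f i := ModuleCat.ofHom (LinearMap.inl R (Y.X i) (T.X i))
  comm' i j hij := ModuleCat.hom_ext (LinearMap.ext fun y => by
    refine (extend_d hπ hij y 0).trans ?_
    rw [map_zero, map_zero, add_zero]
    rfl)

/-- The projection to `T`. -/
def extendSnd : extend T Y π hπ ⟶ T where
  f i := ModuleCat.ofHom (LinearMap.snd R (Y.X i) (T.X i))
  comm' _ _ hij := ModuleCat.hom_ext (LinearMap.ext fun y =>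
    (congrArg Prod.snd (extend_d hπ hij y.1 y.2)).symm)

theorem extendInl_snd : extendInl hπ ≫ extendSnd hπ = 0 := rfl

theorem extend_shortExact :
    (ShortComplex.mk (extendInl hπ) (extendSnd hπ) (extendInl_snd hπ)).ShortExact :=
  shortExact_complex_iff.2 fun _ =>
    ⟨LinearMap.inl_injective, Function.Exact.inl_snd, LinearMap.snd_surjective⟩

end Extend

end HUnitary

namespace HUnitary

/-! ### Orthogonality to complexes with cotorsion cycles, and acyclicity of Hom complexes. -/

section CotorsionComplexes

open Abelian

variable {R : Type u} [Ring R] {A : Ideal R} [A.IsTwoSided]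

theorem IsHUnitaryCotorsion.mid {M₁ M₂ M₃ : Type u} [AddCommGroup M₁] [Module R M₁]
    [AddCommGroup M₂] [Module R M₂] [AddCommGroup M₃] [Module R M₃] {f : M₁ →ₗ[R] M₂}
    {g : M₂ →ₗ[R] M₃} (hf : Function.Injective f) (hfg : Function.Exact f g)
    (hg : Function.Surjective g) (h₁ : IsHUnitaryCotorsion A M₁)
    (h₃ : IsHUnitaryCotorsion A M₃) : IsHUnitaryCotorsion A M₂ :=
  ⟨IsHUnitary.mid hf hfg hg h₁.1 h₃.1, fun F hF =>
    ExtVanishes.cov_mid hf hfg hg (h₁.2 F hF) (h₃.2 F hF)⟩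

theorem cotorsionComplex_iff {C : CochainComplex (ModuleCat.{u} R) ℤ} :
    cotorsionComplex A C ↔ C.Acyclic ∧
      ∀ i j : ℤ, i + 1 = j → IsHUnitaryCotorsion A (LinearMap.ker (C.d i j).hom) := by
  constructor
  · intro h
    refine ⟨h.2.1, fun i j hij => ?_⟩
    subst hij
    have := (hUnitaryCotorsion_iff (cyclesModule C i)).1 (h.2.2 i)
    exact this
  · intro h
    have hX (i : ℤ) : IsHUnitary A (C.X i) := by
      obtain ⟨g, -, hg, hg'⟩ := exists_cycles_shortExact h.1 (rfl : i + 1 = _) rfl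
      exact IsHUnitary.mid (Submodule.subtype_injective _) hg hg' (h.2 i _ rfl).1 (h.2 _ _ rfl).1
    exact ⟨hUnitaryComplex_of_acyclic h.1 hX, h.1,
      fun i => (hUnitaryCotorsion_iff (cyclesModule C i)).2 (h.2 i _ rfl)⟩

theorem cotorsionComplex.isHUnitaryCotorsion_X {C : CochainComplex (ModuleCat.{u} R) ℤ}
    (hC : cotorsionComplex A C) (i : ℤ) : IsHUnitaryCotorsion A (C.X i) := by
  obtain ⟨hC, h⟩ := cotorsionComplex_iff.1 hC
  obtain ⟨g, -, hg, hg'⟩ := exists_cycles_shortExact hC (rfl : i + 1 = _) rfl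
  exact IsHUnitaryCotorsion.mid (Submodule.subtype_injective _) hg hg' (h i _ rfl) (h _ _ rfl)

theorem shift_d_apply (K : CochainComplex (ModuleCat.{u} R) ℤ) (a : ℤ) :
    (∀ (i j : ℤ) (x : K.X (i + a)), ((K⟦a⟧).d i j).hom x = (K.d (i + a) (j + a)).hom x) ∨
      ∀ (i j : ℤ) (x : K.X (i + a)), ((K⟦a⟧).d i j).hom x = -(K.d (i + a) (j + a)).hom x := by
  rcases Int.units_eq_one_or a.negOnePow with h | h
  · refine Or.inl fun i j x => ?_
    rw [CochainComplex.shiftFunctor_obj_d', h, one_smul]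
    rfl
  · refine Or.inr fun i j x => ?_
    rw [CochainComplex.shiftFunctor_obj_d', h, Units.neg_smul, one_smul]
    rfl

theorem cotorsionComplex_shift {C : CochainComplex (ModuleCat.{u} R) ℤ}
    (hC : cotorsionComplex A C) (a : ℤ) : cotorsionComplex A (C⟦a⟧) := by
  obtain ⟨hC, h⟩ := cotorsionComplex_iff.1 hC
  have hker (i j : ℤ) (x : C.X (i + a)) :
      ((C⟦a⟧).d i j).hom x = 0 ↔ (C.d (i + a) (j + a)).hom x = 0 := by
    rcases shift_d_apply C a with ha | ha
    · exact ⟨fun h => (ha i j x).symm.trans h, fun h => (ha i j x).trans h⟩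
    · exact ⟨fun h => neg_eq_zero.1 ((ha i j x).symm.trans h),
        fun h => (ha i j x).trans (neg_eq_zero.2 h)⟩
  refine cotorsionComplex_iff.2 ⟨acyclic_iff.2 fun i j k hij hjk x => ⟨fun hx => ?_, ?_⟩,
    fun i j hij => ?_⟩
  · obtain ⟨y, hy⟩ := (acyclic_iff.1 hC (i + a) (j + a) (k + a) (by lia) (by lia) x).1
      ((hker j k x).1 hx)
    rcases shift_d_apply C a with ha | ha
    · exact ⟨y, (ha i j y).trans hy⟩
    · exact ⟨-y, (ha i j (-y)).trans (by rw [map_neg, neg_neg]; exact hy)⟩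
  · rintro ⟨y, rfl⟩
    exact d_d_apply _ _ _ _ y
  · have : LinearMap.ker ((C⟦a⟧).d i j).hom = LinearMap.ker (C.d (i + a) (j + a)).hom :=
      Submodule.ext fun x => hker i j x
    rw [this]
    exact h _ _ (by lia)

/-- Complexes of h-unitary flat modules with zero differential are orthogonal to the
complexes in `cotorsionComplex A`. -/
theorem subsingleton_ext_of_d_eq_zero {X C : CochainComplex (ModuleCat.{u} R) ℤ}
    (hd : ∀ i j, X.d i j = 0) (hX : ∀ i, hUnitaryFlat A (X.X i)) (hC : cotorsionComplex A C) :
    Subsingleton (Ext.{u} X C 1) := by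
  obtain ⟨hC, h⟩ := cotorsionComplex_iff.1 hC
  refine subsingleton_ext_one_of_splits fun E f g w hS => ?_
  -- As every element of `X` is a cycle, a section is the same as a lift to the cycles of `E`, and
  -- these are extensions by the cotorsion cycles of `C`.
  have (i : ℤ) : ∃ l : X.X i →ₗ[R] LinearMap.ker (E.d i (i + 1)).hom,
      ∀ x, (g.f i).hom (l x) = x := by
    obtain ⟨h₁, h₂, h₃⟩ := cyclesHom_shortExact hS hC (rfl : i + 1 = _)
    obtain ⟨l, hl⟩ := ((h i _ rfl).2 _ (hX i)).exists_lift h₁ h₂ h₃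
      (LinearMap.id.codRestrict _ fun x => LinearMap.mem_ker.2 (by rw [hd]; rfl))
    exact ⟨l, fun x => congrArg Subtype.val (LinearMap.congr_fun hl x)⟩
  choose l hl using this
  refine ⟨{ f := fun i => ModuleCat.ofHom ((LinearMap.ker (E.d i (i + 1)).hom).subtype ∘ₗ l i)
            comm' := ?_ }, ?_⟩
  · rintro i _ rfl
    rw [hd, zero_comp]
    exact ModuleCat.hom_ext (LinearMap.ext fun x => (l i x).2)
  · ext i x
    exact hl i x

/-- `X` is an extension of the complex of its shifted cycles by that of its cycles, both with zero
differential. -/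
theorem subsingleton_ext_of_acyclic {X C : CochainComplex (ModuleCat.{u} R) ℤ} (hX : X.Acyclic)
    (h : ∀ i j : ℤ, i + 1 = j → IsHUnitaryFlat A (LinearMap.ker (X.d i j).hom))
    (hC : cotorsionComplex A C) : Subsingleton (Ext.{u} X C 1) := by
  let Z : CochainComplex (ModuleCat.{u} R) ℤ :=
    { X := fun i => ModuleCat.of R (LinearMap.ker (X.d i (i + 1)).hom)
      d := fun _ _ => 0 }
  let Z' : CochainComplex (ModuleCat.{u} R) ℤ :=
    { X := fun i => ModuleCat.of R (LinearMap.ker (X.d (i + 1) (i + 1 + 1)).hom)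
      d := fun _ _ => 0 }
  choose b hb hab hb' using fun i : ℤ => exists_cycles_shortExact hX (rfl : i + 1 = _) rfl
  let f : Z ⟶ X :=
    { f := fun i => ModuleCat.ofHom (LinearMap.ker (X.d i (i + 1)).hom).subtype
      comm' := by
        rintro i _ rfl
        exact ModuleCat.hom_ext (LinearMap.ext fun x => x.2) }
  let g : X ⟶ Z' :=
    { f := fun i => ModuleCat.ofHom (b i)
      comm' := by
        rintro i _ rfl
        refine ModuleCat.hom_ext (LinearMap.ext fun x => Subtype.ext ?_)
        exact ((hb _ _).trans (d_d_apply X _ _ _ x)).symm }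
  have w : f ≫ g = 0 := by
    ext i x
    exact congrArg Subtype.val ((hab i).apply_apply_eq_zero x)
  have hS : (ShortComplex.mk f g w).ShortExact := shortExact_complex_iff.2 fun i =>
    ⟨Submodule.subtype_injective _, hab i, hb' i⟩
  exact subsingleton_ext_mid hS
    (subsingleton_ext_of_d_eq_zero (fun _ _ => rfl) (fun i => h i _ rfl) hC)
    (subsingleton_ext_of_d_eq_zero (fun _ _ => rfl) (fun i => h (i + 1) _ rfl) hC)

open CochainComplex.HomComplex in
theorem homComplex_acyclic_iff {F C : CochainComplex (ModuleCat.{u} R) ℤ} :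
    (CochainComplex.HomComplex F C).Acyclic ↔ ∀ (m n k : ℤ), m + 1 = n → n + 1 = k →
      ∀ z : Cochain F C n, δ n k z = 0 → ∃ b : Cochain F C m, δ m n b = z := by
  have (m n k : ℤ) (hmn : m + 1 = n) (hnk : n + 1 = k) :
      (CochainComplex.HomComplex F C).ExactAt n ↔
        ∀ z : Cochain F C n, δ n k z = 0 → ∃ b : Cochain F C m, δ m n b = z := by
    rw [HomologicalComplex.exactAt_iff' _ m n k (by simp [← hmn]) (by simp [← hnk])]
    exact ShortComplex.ab_exact_iff _
  exact ⟨fun h m n k hmn hnk => (this m n k hmn hnk).1 (h n), fun h n =>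
    (this (n - 1) n (n + 1) (by simp) rfl).2 (h _ _ _ (by simp) rfl)⟩

open CochainComplex.HomComplex in
-- A degreewise split extension is classified by the degree-one cocycle of its splitting; a cochain
-- bounding this cocycle corrects the degreewise sections to a chain map.
theorem exists_section_of_homComplex_acyclic {F C E : CochainComplex (ModuleCat.{u} R) ℤ}
    (h : (CochainComplex.HomComplex F C).Acyclic) {f : C ⟶ E} {g : E ⟶ F} {w : f ≫ g = 0}
    (σ : ∀ n, ((ShortComplex.mk f g w).map (HomologicalComplex.eval _ _ n)).Splitting) :
    ∃ s : F ⟶ E, s ≫ g = 𝟙 F := by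
  let z := CochainComplex.cocycleOfDegreewiseSplit _ σ
  obtain ⟨b, hb⟩ := homComplex_acyclic_iff.1 h 0 1 2 rfl rfl z.1 (z.δ_eq_zero 2)
  obtain ⟨s, hs⟩ : ∃ s : ∀ i, F.X i ⟶ E.X i, ∀ i, s i = (σ i).s := ⟨_, fun _ => rfl⟩
  obtain ⟨r, hr⟩ : ∃ r : ∀ i, E.X i ⟶ C.X i, ∀ i, r i = (σ i).r := ⟨_, fun _ => rfl⟩
  have hg (i : ℤ) : s i ≫ g.f i = 𝟙 _ := by
    rw [hs]
    exact (σ i).s_g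
  have hfg (i : ℤ) : f.f i ≫ g.f i = 0 := by
    rw [← HomologicalComplex.comp_f, w, HomologicalComplex.zero_f]
  have hid (i : ℤ) : r i ≫ f.f i + g.f i ≫ s i = 𝟙 (E.X i) := by
    rw [hs, hr]
    exact (σ i).id
  refine ⟨{ f := fun i => s i - b.v i i (add_zero i) ≫ f.f i
            comm' := ?_ }, ?_⟩
  · intro i j hij
    have hz : s i ≫ E.d i j ≫ r j =
        b.v i i (add_zero i) ≫ C.d i j - F.d i j ≫ b.v j j (add_zero j) := by
      rw [hs, hr]
      exact (Cochain.congr_v hb i j hij).symm.trans (δ_zero_cochain_v b i j hij)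
    have h1 : s i ≫ E.d i j = (s i ≫ E.d i j ≫ r j) ≫ f.f j + F.d i j ≫ s j := by
      refine (Category.comp_id (s i ≫ E.d i j)).symm.trans ?_
      rw [← hid j, Preadditive.comp_add, Category.assoc, Category.assoc, ← g.comm_assoc,
        reassoc_of% hg i, Category.assoc, Category.assoc]
    rw [Preadditive.sub_comp, Preadditive.comp_sub, h1, hz, Preadditive.sub_comp, Category.assoc,
      Category.assoc, Category.assoc, f.comm]
    abel
  · ext1 i
    change (s i - b.v i i (add_zero i) ≫ f.f i) ≫ g.f i = 𝟙 _
    rw [Preadditive.sub_comp, Category.assoc, hfg, comp_zero, sub_zero]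
    exact hg i

theorem subsingleton_ext_of_homComplex_acyclic {F C : CochainComplex (ModuleCat.{u} R) ℤ}
    (hF : ∀ i, hUnitaryFlat A (F.X i)) (hC : cotorsionComplex A C)
    (h : (CochainComplex.HomComplex F C).Acyclic) : Subsingleton (Ext.{u} F C 1) := by
  refine subsingleton_ext_one_of_splits fun E f g w hS => ?_
  have (i : ℤ) : Nonempty
      ((ShortComplex.mk f g w).map (HomologicalComplex.eval _ _ i)).Splitting := by
    obtain ⟨h₁, h₂, h₃⟩ := shortExact_complex_iff.1 hS i
    obtain ⟨l, hl⟩ := ((hC.isHUnitaryCotorsion_X i).2 _ (hF i)).exists_lift h₁ h₂ h₃ LinearMap.id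
    have hi := (HomologicalComplex.shortExact_iff_degreewise_shortExact _).1 hS i
    have := hi.mono_f
    exact ⟨ShortComplex.Splitting.ofExactOfSection _ hi.exact (ModuleCat.ofHom l)
      (ModuleCat.hom_ext hl) this⟩
  exact exists_section_of_homComplex_acyclic h fun i => (this i).some

open CochainComplex.HomComplex in
theorem homComplex_acyclic_of_subsingleton_ext {F C : CochainComplex (ModuleCat.{u} R) ℤ}
    (h : ∀ a : ℤ, Subsingleton (Ext.{u} F (C⟦a⟧) 1)) :
    (CochainComplex.HomComplex F C).Acyclic := by
  have key (D : CochainComplex (ModuleCat.{u} R) ℤ) (hD : Subsingleton (Ext.{u} F D 1))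
      (z : Cochain F D 1) (hz : δ 1 2 z = 0) : ∃ b : Cochain F D 0, δ 0 1 b = z := by
    -- A cocycle of degree one twists the differential on `D ⊕ F`; a section of this extension
    -- exhibits the cocycle as a coboundary. Cocycles of other degrees are reduced to this case by
    -- shifting `C`.
    let π (i j : ℤ) : F.X i →ₗ[R] D.X j := if h : i + 1 = j then (z.v i j h).hom else 0
    have hπ' {i j : ℤ} (hij : i + 1 = j) : π i j = (z.v i j hij).hom := dif_pos hij
    have hπ (i j k : ℤ) (hij : i + 1 = j) (hjk : j + 1 = k) (t : F.X i) :
        (D.d j k).hom (π i j t) + π j k ((F.d i j).hom t) = 0 := by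
      rw [hπ' hij, hπ' hjk]
      have := (δ_v 1 2 rfl z i k (by lia) j j (by lia) hij).symm.trans
        (Cochain.congr_v hz i k (by lia))
      rw [show Int.negOnePow 2 = 1 from rfl, one_smul] at this
      exact LinearMap.congr_fun (congrArg ModuleCat.Hom.hom this) t
    obtain ⟨s, hs⟩ := exists_lift_of_subsingleton_ext (extend_shortExact hπ) hD (𝟙 F)
    let b (i : ℤ) : F.X i ⟶ D.X i :=
      ModuleCat.ofHom (LinearMap.fst R (D.X i) (F.X i) ∘ₗ (s.f i).hom)
    have hsb (i : ℤ) (t : F.X i) : (s.f i).hom t = (b i t, t) := Prod.ext rfl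
      (LinearMap.congr_fun (congrArg ModuleCat.Hom.hom (HomologicalComplex.congr_hom hs i)) t)
    refine ⟨-Cochain.ofHoms b, ?_⟩
    ext i j hij t
    have h1 : (D.d i j).hom (b i t) + π i j t = b j ((F.d i j).hom t) := by
      have := hom_d_apply s i j t
      rw [hsb, hsb] at this
      exact congrArg Prod.fst ((extend_d hπ hij _ _).symm.trans this)
    rw [hπ' hij] at h1
    rw [δ_zero_cochain_v, Cochain.neg_v, Cochain.neg_v, Cochain.ofHoms_v, Cochain.ofHoms_v]
    change (D.d i j).hom (-b i t) - -b j ((F.d i j).hom t) = (z.v i j hij).hom t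
    rw [← h1, map_neg]
    abel
  refine homComplex_acyclic_iff.2 fun m n k hmn hnk z hz => ?_
  obtain ⟨b, hb⟩ := key _ (h m) (z.rightShift m 1 (by lia)) (by
    rw [z.δ_rightShift m 1 2 _ k (by lia), hz, Cochain.rightShift_zero, smul_zero])
  refine ⟨m.negOnePow • b.rightUnshift m (zero_add m), ?_⟩
  rw [δ_units_smul, b.δ_rightUnshift m (zero_add m) n 1 (by lia), hb, smul_smul,
    Int.units_mul_self, one_smul, Cochain.rightUnshift_rightShift]

/-- The terms of `C` are cotorsion, so extensions of `F` by `C` are degreewise split. Acyclicity of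
the Hom complex is then vanishing of `Ext¹` into all shifts of `C`, which are again in the class. -/
theorem dgFlatComplex_iff {F : CochainComplex (ModuleCat.{u} R) ℤ} :
    dgFlatComplex A F ↔ hUnitaryComplex A F ∧ (∀ i, hUnitaryFlat A (F.X i)) ∧
      ∀ C, cotorsionComplex A C → Subsingleton (Ext.{u} F C 1) :=
  ⟨fun h => ⟨h.1, h.2.1, fun C hC =>
    subsingleton_ext_of_homComplex_acyclic h.2.1 hC (h.2.2 C hC)⟩,
  fun h => ⟨h.1, h.2.1, fun _ hC => homComplex_acyclic_of_subsingleton_ext fun a =>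
    h.2.2 _ (cotorsionComplex_shift hC a)⟩⟩

end CotorsionComplexes

end HUnitary

namespace HUnitary

/-! ### Extensions by orthogonal flat complexes and their sequential colimits. -/

section FlatMonos

open Abelian ZeroObject

variable {R : Type u} [Ring R] (A : Ideal R) [A.IsTwoSided]

/-- The complexes of h-unitary flat modules that are orthogonal to `cotorsionComplex A`. -/
def orthogonalFlatComplex : ObjectProperty (CochainComplex (ModuleCat.{u} R) ℤ) :=
  fun X => (∀ i, hUnitaryFlat A (X.X i)) ∧
    ∀ C, cotorsionComplex A C → Subsingleton (Ext.{u} X C 1)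

/-- The morphisms of complexes with the left lifting properties of the monomorphisms that have
their cokernel in `orthogonalFlatComplex A`, also degreewise. -/
def flatExtension : MorphismProperty (CochainComplex (ModuleCat.{u} R) ℤ) :=
  fun _ _ f => (monosWithCokernel (orthogonalFlatComplex A)).rlp.llp f ∧
    ∀ n, (monosWithCokernel (hUnitaryFlat A)).rlp.llp (f.f n)

variable {A}

/-- An injective object mapping to zero has the right lifting property against every monomorphism,
so an injective embedding of `X` factors through `f`. -/
theorem mono_of_llp_rlp {𝓐 : Type*} [Category.{w} 𝓐] [Abelian 𝓐] [EnoughInjectives 𝓐]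
    {P : ObjectProperty 𝓐} {X Y : 𝓐} {f : X ⟶ Y} (hf : (monosWithCokernel P).rlp.llp f) :
    Mono f := by
  have hp : (monosWithCokernel P).rlp (0 : Injective.under X ⟶ 0) := by
    rintro _ _ f ⟨Z, g, w, hS, -⟩
    have : Mono f := hS.mono_f
    exact ⟨fun {a b} sq => ⟨⟨⟨Injective.factorThru a f, Injective.comp_factorThru a f,
      (isZero_zero _).eq_of_tgt _ _⟩⟩⟩⟩
  have := hf _ hp
  have sq : CommSq (Injective.ι X) f (0 : Injective.under X ⟶ 0) 0 := ⟨by simp⟩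
  exact mono_of_mono_fac sq.fac_left

theorem flatExtension_of_shortExact {Y E X : CochainComplex (ModuleCat.{u} R) ℤ} {f : Y ⟶ E}
    {g : E ⟶ X} {w : f ≫ g = 0} (hS : (ShortComplex.mk f g w).ShortExact)
    (hX : orthogonalFlatComplex A X) : flatExtension A f :=
  ⟨MorphismProperty.le_llp_rlp _ _ ⟨X, g, w, hS, hX⟩, fun n => MorphismProperty.le_llp_rlp _ _
    ⟨_, _, _, (HomologicalComplex.shortExact_iff_degreewise_shortExact _).1 hS n, hX.1 n⟩⟩

theorem flatExtension.comp {X Y Z : CochainComplex (ModuleCat.{u} R) ℤ} {f : X ⟶ Y} {g : Y ⟶ Z}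
    (hf : flatExtension A f) (hg : flatExtension A g) : flatExtension A (f ≫ g) :=
  ⟨MorphismProperty.comp_mem _ _ _ hf.1 hg.1, fun n =>
    MorphismProperty.comp_mem _ _ _ (hf.2 n) (hg.2 n)⟩

theorem flatExtension.exists_shortExact {X Y : CochainComplex (ModuleCat.{u} R) ℤ} {f : X ⟶ Y}
    (hf : flatExtension A f) :
    ∃ (Z : CochainComplex (ModuleCat.{u} R) ℤ) (g : Y ⟶ Z) (w : f ≫ g = 0),
      (ShortComplex.mk f g w).ShortExact ∧ orthogonalFlatComplex A Z := by
  have := mono_of_llp_rlp hf.1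
  obtain ⟨Z, g, w, hS⟩ : ∃ (Z : CochainComplex (ModuleCat.{u} R) ℤ) (g : Y ⟶ Z) (w : f ≫ g = 0),
      (ShortComplex.mk f g w).ShortExact :=
    ⟨_, cokernel.π f, cokernel.condition f,
      { exact := ShortComplex.exact_of_g_is_cokernel _ (cokernelIsCokernel f) }⟩
  refine ⟨Z, g, w, hS, fun n => ?_, fun C hC => ?_⟩
  · have hn := (HomologicalComplex.shortExact_iff_degreewise_shortExact _).1 hS n
    have := hUnitaryFlat_of_llp_rlp hn (hf.2 n)
    exact this
  · refine subsingleton_ext_one_of_splits fun E f' g' w' hT => ?_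
    exact exists_section_of_llp_rlp hS hf.1 hT (fun X hX => hX.2 C hC) (𝟙 _)

/-- A class defined by a left lifting property is closed under transfinite composition; evaluation
in each degree commutes with the colimit. -/
theorem flatExtension_colimit (F : ℕ ⥤ CochainComplex (ModuleCat.{u} R) ℤ)
    (h : ∀ k, flatExtension A (F.map (homOfLE (Nat.le_add_right k 1)))) :
    flatExtension A (colimit.ι F 0) := by
  let c (W : MorphismProperty (CochainComplex (ModuleCat.{u} R) ℤ))
      (hW : ∀ k, W (F.map (homOfLE (Nat.le_add_right k 1)))) :
      W.TransfiniteCompositionOfShape ℕ (colimit.ι F 0) :=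
    { F := F
      isoBot := Iso.refl _
      incl := (colimit.cocone F).ι
      isColimit := colimit.isColimit F
      fac := Category.id_comp _
      map_mem := fun k _ => hW k }
  refine ⟨MorphismProperty.transfiniteCompositionsOfShape_le _ _ _
    ⟨c _ fun k => (h k).1⟩, fun n => ?_⟩
  have : PreservesWellOrderContinuousOfShape ℕ
      (HomologicalComplex.eval (ModuleCat.{u} R) (ComplexShape.up ℤ) n) := {}
  exact MorphismProperty.transfiniteCompositionsOfShape_le _ ℕ _
    ⟨(c (((monosWithCokernel (hUnitaryFlat A)).rlp.llp).inverseImage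
      (HomologicalComplex.eval (ModuleCat.{u} R) (ComplexShape.up ℤ) n)) fun k => (h k).2 n).map⟩

/-- A cycle of the colimit is represented by a cycle at some finite stage, and becomes a boundary at
the next one. -/
theorem acyclic_colimit (F : ℕ ⥤ CochainComplex (ModuleCat.{u} R) ℤ)
    (h : ∀ (k : ℕ) (i j l : ℤ), i + 1 = j → j + 1 = l → ∀ z : (F.obj k).X j,
      ((F.obj k).d j l).hom z = 0 → ∃ w : (F.obj (k + 1)).X i,
        ((F.obj (k + 1)).d i j).hom w = ((F.map (homOfLE (Nat.le_add_right k 1))).f j).hom z) :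
    (colimit F).Acyclic := by
  have hι (k m : ℕ) (hkm : k ⟶ m) (n : ℤ) (x : (F.obj k).X n) :
      ((colimit.ι F m).f n).hom (((F.map hkm).f n).hom x) = ((colimit.ι F k).f n).hom x := by
    rw [← colimit.w F hkm]
    rfl
  have := preservesFilteredColimitsOfSize_shrink.{0, u, 0, u} (forget (ModuleCat.{u} R))
  have hc (n : ℤ) := isColimitOfPreserves
    (HomologicalComplex.eval (ModuleCat.{u} R) (ComplexShape.up ℤ) n) (colimit.isColimit F)
  have hrep (n : ℤ) (x : (colimit F).X n) :
      ∃ (k : ℕ) (y : (F.obj k).X n), ((colimit.ι F k).f n).hom y = x :=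
    Concrete.isColimit_exists_rep _ (hc n) x
  have hzero (n : ℤ) (k : ℕ) (y : (F.obj k).X n) (hy : ((colimit.ι F k).f n).hom y = 0) :
      ∃ (m : ℕ) (a : k ⟶ m), ((F.map a).f n).hom y = 0 := by
    obtain ⟨m, a, b, hab⟩ := Concrete.isColimit_exists_of_rep_eq _ (hc n) (i := k) (j := k) y 0
      (hy.trans (map_zero ((colimit.ι F k).f n).hom).symm)
    exact ⟨m, a, hab.trans (map_zero ((F.map b).f n).hom)⟩
  refine acyclic_iff.2 fun i j l hij hjl x => ⟨fun hx => ?_, ?_⟩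
  · obtain ⟨k, y, hy⟩ := hrep j x
    obtain ⟨m, a, ha⟩ := hzero l k (((F.obj k).d j l).hom y) (by rw [← hom_d_apply, hy, hx])
    obtain ⟨w, hw⟩ := h m i j l hij hjl (((F.map a).f j).hom y) (by rw [hom_d_apply, ha])
    exact ⟨((colimit.ι F (m + 1)).f i).hom w, by rw [hom_d_apply, hw, hι, hι, hy]⟩
  · rintro ⟨y, rfl⟩
    exact d_d_apply _ _ _ _ y

end FlatMonos

end HUnitary

namespace HUnitary

/-! ### Embedding a complex into an acyclic one. -/

section AcyclicExtensions

variable {R : Type u} [Ring R] {A : Ideal R} [A.IsTwoSided]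

/-- A sequence of h-unitary modules is covered by one h-unitary flat module. -/
theorem exists_uniform_cover (Y : ℤ → ModuleCat.{u} R) (hY : ∀ n, hUnitary A (Y n)) :
    ∃ V : ModuleCat.{u} R, hUnitaryFlat A V ∧
      ∃ p : ∀ n, V →ₗ[R] Y n, ∀ n, Function.Surjective (p n) := by
  obtain ⟨G, hG⟩ := exists_isFlatGenerator A
  choose ι p hp using fun n => hG.generates (Y n) (hY n)
  let Ω := Σ n : ULift.{u} ℤ, ι n.down
  have hinj (n : ℤ) : Function.Injective fun i : ι n => (⟨⟨n⟩, i⟩ : Ω) :=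
    fun a b h => eq_of_heq (Sigma.mk.inj_iff.1 h).2
  refine ⟨ModuleCat.of R (Ω →₀ G), isHUnitaryFlat_finsupp hG.mem,
    fun n => p n ∘ₗ Finsupp.lcomapDomain _ (hinj n), fun n y => ?_⟩
  obtain ⟨x, rfl⟩ := hp n y
  refine ⟨Finsupp.mapDomain (fun i : ι n => (⟨⟨n⟩, i⟩ : Ω)) x, congrArg (p n) ?_⟩
  exact Finsupp.comapDomain_mapDomain _ (hinj n) x

/-- The complex with zero differential and constant value `V`. -/
def constComplex (V : ModuleCat.{u} R) : CochainComplex (ModuleCat.{u} R) ℤ where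
  X _ := V
  d _ _ := 0

/-- Killing all the cohomology classes of a complex of h-unitary modules. -/
theorem exists_extension_killing_cohomology {E : CochainComplex (ModuleCat.{u} R) ℤ}
    (hE : hUnitaryComplex A E) :
    ∃ (E' : CochainComplex (ModuleCat.{u} R) ℤ) (f : E ⟶ E'), hUnitaryComplex A E' ∧
      flatExtension A f ∧ ∀ i j k : ℤ, i + 1 = j → j + 1 = k → ∀ z : E.X j,
        (E.d j k).hom z = 0 → ∃ w : E'.X i, (E'.d i j).hom w = (f.f j).hom z := by
  obtain ⟨V, hV, p, hp⟩ := exists_uniform_cover (fun n => cyclesModule E n) fun n => (hE n).1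
  -- Copies of `V` in all degrees map onto the cycles one degree higher. One module for all degrees
  -- allows a single extension with constant quotient and zero differential.
  let π (i j : ℤ) : V →ₗ[R] E.X j := (LinearMap.ker (E.d j (j + 1)).hom).subtype ∘ₗ p j
  have hπ (i j k : ℤ) (hij : i + 1 = j) (hjk : j + 1 = k) (t : V) :
      (E.d j k).hom (π i j t) + π j k (((constComplex V).d i j).hom t) = 0 := by
    subst hjk
    have h1 : (E.d j (j + 1)).hom (π i j t) = 0 := (p j t).2
    rw [h1, zero_add]
    exact map_zero (π j _)
  let E' := extend (constComplex V) E π hπ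
  have hd {i j : ℤ} (hij : i + 1 = j) (y : E.X i) (t : V) :
      (E'.d i j).hom (y, t) = ((E.d i j).hom y + π i j t, 0) :=
    extend_d (T := constComplex V) hπ hij y t
  refine ⟨E', extendInl hπ, hUnitaryComplex_iff.2 fun i j hij => ?_,
    flatExtension_of_shortExact (extend_shortExact hπ) ⟨fun _ => hV, fun C hC =>
      subsingleton_ext_of_d_eq_zero (fun _ _ => rfl) (fun _ => hV) hC⟩, ?_⟩
  · have hX : IsHUnitary A (E'.X i) := isHUnitary_prod (hE.isHUnitary_X i) hV.1
    refine ⟨?_, hX⟩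
    -- The new cycles are the kernel of a surjection from `E'_i` onto the old cycles in degree `j`,
    -- hence h-unitary.
    let g : E'.X i →ₗ[R] LinearMap.ker (E.d j (j + 1)).hom :=
      ((E.d i j).hom.codRestrict _ fun x => LinearMap.mem_ker.2 (d_d_apply E i j _ x)).coprod (p j)
    have hg (x : E'.X i) : (E'.d i j).hom x = ((g x : E.X j), 0) := hd hij x.1 x.2
    refine IsHUnitary.left (Submodule.subtype_injective _) (g := g) (fun x => ⟨fun hx => ?_, ?_⟩)
      (fun z => ?_) hX (hE.isHUnitary_ker rfl)
    · exact ⟨⟨x, LinearMap.mem_ker.2 (by rw [hg, hx]; rfl)⟩, rfl⟩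
    · rintro ⟨x, rfl⟩
      exact Subtype.ext (congrArg Prod.fst ((hg _).symm.trans x.2))
    · obtain ⟨t, rfl⟩ := hp j z
      refine ⟨(0, t), ?_⟩
      refine (LinearMap.coprod_apply _ _ _).trans ?_
      rw [map_zero, zero_add]
      rfl
  · intro i j k hij hjk z hz
    subst hjk
    obtain ⟨t, ht⟩ := hp j ⟨z, hz⟩
    refine ⟨(0, t), (hd hij 0 t).trans ?_⟩
    rw [map_zero, zero_add]
    exact Prod.ext (congrArg Subtype.val ht) rfl

/-- Every complex of h-unitary modules embeds into an acyclic one. -/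
theorem exists_acyclic_extension {Y : CochainComplex (ModuleCat.{u} R) ℤ}
    (hY : hUnitaryComplex A Y) :
    ∃ (Y' : CochainComplex (ModuleCat.{u} R) ℤ) (f : Y ⟶ Y'), hUnitaryComplex A Y' ∧ Y'.Acyclic ∧
      flatExtension A f := by
  choose E f hE hf hk using
    fun X : {X // hUnitaryComplex A X} => exists_extension_killing_cohomology X.2
  let X : ℕ → {X // hUnitaryComplex A X} := fun k =>
    Nat.rec ⟨Y, hY⟩ (fun _ X => ⟨E X, hE X⟩) k
  let F := Functor.ofSequence (X := fun k => (X k).1) fun k => f (X k)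
  have hF (k : ℕ) : F.map (homOfLE (Nat.le_add_right k 1)) = f (X k) :=
    Functor.ofSequence_map_homOfLE_succ _ k
  have hac : (colimit F).Acyclic := acyclic_colimit F fun k i j l hij hjl z hz => by
    rw [hF]
    exact hk (X k) i j l hij hjl z hz
  have hfe : flatExtension A (colimit.ι F 0) := flatExtension_colimit F fun k => by
    rw [hF]
    exact hf (X k)
  obtain ⟨Z, g, w, hS, hZ⟩ := hfe.exists_shortExact
  refine ⟨colimit F, colimit.ι F 0, hUnitaryComplex_of_acyclic hac fun i => ?_, hac, hfe⟩
  obtain ⟨h₁, h₂, h₃⟩ := shortExact_complex_iff.1 hS i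
  exact IsHUnitary.mid h₁ h₂ h₃ (hY.isHUnitary_X i) (hZ.1 i).1

end AcyclicExtensions

end HUnitary

namespace HUnitary

/-! ### From acyclic complexes to complexes with cotorsion cycles. -/

section CotorsionExtensions

variable {R : Type u} [Ring R] {A : Ideal R} [A.IsTwoSided]

theorem IsHUnitaryCotorsion.of_linearEquiv {M₁ M₂ : Type u} [AddCommGroup M₁] [Module R M₁]
    [AddCommGroup M₂] [Module R M₂] (h : IsHUnitaryCotorsion A M₁) (e : M₁ ≃ₗ[R] M₂) :
    IsHUnitaryCotorsion A M₂ :=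
  ⟨h.1.of_linearEquiv e, fun F hF => extVanishes_one_of_splits _ fun E _ _ f g hf hfg hg => by
    obtain ⟨l, hl⟩ := (h.2 F hF).exists_lift (f := f ∘ₗ e.toLinearMap) (g := g)
      (hf.comp e.injective) (fun x => (hfg x).trans ⟨fun ⟨y, hy⟩ => ⟨e.symm y, by simpa using hy⟩,
        fun ⟨y, hy⟩ => ⟨e y, hy⟩⟩) hg LinearMap.id
    exact ⟨l, hl⟩⟩

theorem acyclic_of_shortExact {Y E X : CochainComplex (ModuleCat.{u} R) ℤ} {f : Y ⟶ E}
    {g : E ⟶ X} {w : f ≫ g = 0} (hS : (ShortComplex.mk f g w).ShortExact) (hY : Y.Acyclic)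
    (hE : E.Acyclic) : X.Acyclic :=
  acyclic_iff.2 fun i j k hij hjk x => ⟨fun hx => by
    obtain ⟨e, he⟩ := (cyclesHom_shortExact hS hY hjk).2.2 ⟨x, hx⟩
    obtain ⟨e', he'⟩ := (acyclic_iff.1 hE i j k hij hjk e.1).1 e.2
    exact ⟨(g.f i).hom e', by rw [hom_d_apply, he']; exact congrArg Subtype.val he⟩, by
    rintro ⟨y, rfl⟩
    exact d_d_apply _ _ _ _ y⟩

/-- Every acyclic complex of h-unitary modules embeds into an acyclic complex with cotorsion
cycles. -/
theorem exists_cotorsionComplex_extension {Y : CochainComplex (ModuleCat.{u} R) ℤ}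
    (hY : hUnitaryComplex A Y) (hYa : Y.Acyclic) :
    ∃ (D : CochainComplex (ModuleCat.{u} R) ℤ) (f : Y ⟶ D), cotorsionComplex A D ∧
      flatExtension A f := by
  choose C F c p hC hF hc hcp hp using fun i =>
    exists_cotorsion_embedding (LinearMap.ker (Y.d i (i + 1)).hom) (hY.isHUnitary_ker rfl)
  choose b hb hab hb' using fun i : ℤ => exists_cycles_shortExact hYa (rfl : i + 1 = _) rfl
  choose D α β d hα hαβ hβ hdα hβd using fun i : ℤ => (hC i).exists_horseshoe (c := c i)
    (hC (i + 1)).1 (hF (i + 1)) (Submodule.subtype_injective _) (hab i) (hb' i)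
    (hc (i + 1)) (hcp (i + 1)) (hp (i + 1))
  have hdα' (i : ℤ) (z : LinearMap.ker (Y.d i (i + 1)).hom) : d i z.1 = α i (c i z) :=
    LinearMap.congr_fun (hdα i) z
  have hβd' (i : ℤ) (y) : β i (d i y) = c (i + 1) (b i y) := LinearMap.congr_fun (hβd i) y
  -- The sequences `0 → C i → D i → C (i+1) → 0` are spliced into an acyclic complex whose cycles
  -- are the modules `C i`.
  let K : CochainComplex (ModuleCat.{u} R) ℤ :=
    CochainComplex.of D (fun i => ModuleCat.ofHom (α (i + 1) ∘ₗ β i)) fun i =>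
      ModuleCat.hom_ext (LinearMap.ext fun x => by
        change α _ (β _ (α _ (β i x))) = 0
        rw [(hαβ (i + 1)).apply_apply_eq_zero, map_zero])
  have hK (i : ℤ) : K.d i (i + 1) = ModuleCat.ofHom (α (i + 1) ∘ₗ β i) :=
    CochainComplex.of_d (fun i => D i) (fun i => ModuleCat.ofHom (α (i + 1) ∘ₗ β i)) i
  have hker (i : ℤ) (x : D i) : (K.d i (i + 1)).hom x = 0 ↔ ∃ y, α i y = x := by
    rw [hK]
    exact ((map_eq_zero_iff _ (hα (i + 1))).trans (hαβ i x))
  let f : Y ⟶ K :=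
    { f := fun i => ModuleCat.ofHom (d i)
      comm' := by
        rintro i _ rfl
        rw [hK]
        refine ModuleCat.hom_ext (LinearMap.ext fun x => ?_)
        change α (i + 1) (β i (d i x)) = d (i + 1) ((Y.d i (i + 1)).hom x)
        rw [hβd', ← hdα', hb] }
  have hKa : K.Acyclic := acyclic_iff.2 (by
    rintro i _ _ rfl rfl x
    constructor
    · intro hx
      obtain ⟨y, rfl⟩ := (hker (i + 1) x).1 hx
      obtain ⟨x, rfl⟩ := hβ i y
      exact ⟨x, by rw [hK]; rfl⟩
    · rintro ⟨y, rfl⟩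
      exact d_d_apply _ _ _ _ y)
  let γ (i : ℤ) : C i →ₗ[R] LinearMap.ker (K.d i (i + 1)).hom :=
    (α i).codRestrict _ fun y => LinearMap.mem_ker.2 ((hker i _).2 ⟨y, rfl⟩)
  have hγ (i : ℤ) : Function.Bijective (γ i) :=
    ⟨fun x y h => hα i (congrArg Subtype.val h), fun x => by
      obtain ⟨y, hy⟩ := (hker i x.1).1 x.2
      exact ⟨y, Subtype.ext hy⟩⟩
  have hKC : cotorsionComplex A K := cotorsionComplex_iff.2 ⟨hKa, by
    rintro i _ rfl
    exact (hC i).of_linearEquiv (LinearEquiv.ofBijective (γ i) (hγ i))⟩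
  have hf : Mono f := by
    have (i : ℤ) : Mono (f.f i) := by
      refine (ModuleCat.mono_iff_injective _).2 ((injective_iff_map_eq_zero (d i)).2 fun y hy => ?_)
      have h1 : b i y = 0 := hc (i + 1) (by rw [← hβd', hy, map_zero, map_zero])
      obtain ⟨z, rfl⟩ := (hab i y).1 h1
      have h2 : z = 0 := hc i (hα i ((hdα' i z).symm.trans (hy.trans (by simp))))
      rw [h2, map_zero]
    exact HomologicalComplex.mono_of_mono_f f this
  obtain ⟨X, g, w, hS⟩ : ∃ (X : CochainComplex (ModuleCat.{u} R) ℤ) (g : K ⟶ X) (w : f ≫ g = 0),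
      (ShortComplex.mk f g w).ShortExact :=
    ⟨_, cokernel.π f, cokernel.condition f,
      { exact := ShortComplex.exact_of_g_is_cokernel _ (cokernelIsCokernel f) }⟩
  have hXa := acyclic_of_shortExact hS hYa hKa
  -- Since `Y` is acyclic, taking cycles is exact here, so the cycles of the quotient are the
  -- cokernels `F i` of the preenvelopes.
  have hZ (i : ℤ) : IsHUnitaryFlat A (LinearMap.ker (X.d i (i + 1)).hom) := by
    obtain ⟨h₁, h₂, h₃⟩ := cyclesHom_shortExact hS hYa (rfl : i + 1 = _)
    have hγc (z) : γ i (c i z) = cyclesHom f i (i + 1) z := Subtype.ext (hdα' i z).symm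
    obtain ⟨ψ, hψ⟩ := exists_factor (hcp i) (hp i) (cyclesHom g i (i + 1) ∘ₗ γ i)
      (LinearMap.ext fun z => by
        rw [LinearMap.comp_apply, LinearMap.comp_apply, hγc, h₂.apply_apply_eq_zero]
        rfl)
    have hψ' (x) : ψ (p i x) = cyclesHom g i (i + 1) (γ i x) := LinearMap.congr_fun hψ x
    refine IsHUnitaryFlat.of_linearEquiv (M₁ := F i) (hF i) (LinearEquiv.ofBijective ψ
      ⟨(injective_iff_map_eq_zero ψ).2 fun x hx => ?_, fun x => ?_⟩)
    · obtain ⟨x, rfl⟩ := hp i x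
      rw [hψ'] at hx
      obtain ⟨z, hz⟩ := (h₂ _).1 hx
      rw [← hγc] at hz
      rw [← (hγ i).1 hz, (hcp i).apply_apply_eq_zero]
    · obtain ⟨x, rfl⟩ := h₃ x
      obtain ⟨x, rfl⟩ := (hγ i).2 x
      exact ⟨p i x, hψ' x⟩
  have hZ' (i j : ℤ) (hij : i + 1 = j) : IsHUnitaryFlat A (LinearMap.ker (X.d i j).hom) := by
    subst hij
    exact hZ i
  refine ⟨K, f, hKC, flatExtension_of_shortExact hS ⟨fun i => ?_, fun C hC =>
    subsingleton_ext_of_acyclic hXa hZ' hC⟩⟩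
  obtain ⟨g, -, hg, hg'⟩ := exists_cycles_shortExact hXa (rfl : i + 1 = _) rfl
  exact IsHUnitaryFlat.mid (Submodule.subtype_injective _) hg hg' (hZ i) (hZ (i + 1))

/-- Every complex of h-unitary modules has a special preenvelope in `cotorsionComplex A`. -/
theorem exists_cotorsionComplex_preenvelope {Y : CochainComplex (ModuleCat.{u} R) ℤ}
    (hY : hUnitaryComplex A Y) :
    ∃ (C F : CochainComplex (ModuleCat.{u} R) ℤ) (f : Y ⟶ C) (g : C ⟶ F) (w : f ≫ g = 0),
      (ShortComplex.mk f g w).ShortExact ∧ cotorsionComplex A C ∧ dgFlatComplex A F := by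
  obtain ⟨Y', f, hY', hYa, hf⟩ := exists_acyclic_extension hY
  obtain ⟨C, f', hC, hf'⟩ := exists_cotorsionComplex_extension hY' hYa
  obtain ⟨F, g, w, hS, hF⟩ := (hf.comp hf').exists_shortExact
  exact ⟨C, F, f ≫ f', g, w, hS, hC,
    dgFlatComplex_iff.2 ⟨hUnitaryComplex_right hS hC.2.1 hY hC.1, hF⟩⟩

end CotorsionExtensions

end HUnitary

namespace HUnitary

/-! ### Special precovers by Salce's pushout, and the left orthogonal class. -/

section AbelianPushout

variable {𝓐 : Type*} [Category 𝓐] [Abelian 𝓐]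

/-- The pushout of a short exact sequence. -/
theorem exists_shortExact_of_isPushout {X₁ X₂ X₃ B W : 𝓐} {f : X₁ ⟶ X₂} {g : X₂ ⟶ X₃}
    {w : f ≫ g = 0} (hS : (ShortComplex.mk f g w).ShortExact) {v : X₁ ⟶ B} {j : X₂ ⟶ W}
    {i : B ⟶ W} (sq : IsPushout f v j i) :
    ∃ (p : W ⟶ X₃) (hp : i ≫ p = 0), (ShortComplex.mk i p hp).ShortExact := by
  have : Mono f := hS.mono_f
  have : Epi g := hS.epi_g
  have hw : f ≫ g = v ≫ 0 := by rw [w, comp_zero]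
  have hj : j ≫ sq.desc g 0 hw = g := sq.inl_desc _ _ _
  have hi : i ≫ sq.desc g 0 hw = 0 := sq.inr_desc _ _ _
  have hmono : Mono i := by
    have h := (MorphismProperty.monomorphisms 𝓐).of_isPushout sq.flip
      (MorphismProperty.monomorphisms.infer_property f)
    exact h
  have hepi : Epi (sq.desc g 0 hw) := epi_of_epi_fac hj
  refine ⟨sq.desc g 0 hw, hi, ShortComplex.ShortExact.mk' ?_ hmono hepi⟩
  refine ShortComplex.exact_of_g_is_cokernel _ (CokernelCofork.IsColimit.ofπ' _ _ fun {Z} k hk => ?_)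
  have hk' : i ≫ k = 0 := hk
  have hl : f ≫ j ≫ k = 0 := by rw [reassoc_of% sq.w, hk', comp_zero]
  refine ⟨hS.exact.desc _ hl, sq.hom_ext ?_ ?_⟩
  · refine (reassoc_of% hj) _ |>.trans ?_
    exact hS.exact.g_desc _ _
  · refine ((reassoc_of% hi) _).trans ?_
    rw [zero_comp, hk']

theorem nonempty_splitting_of_section {S : ShortComplex 𝓐} (hS : S.ShortExact) {s : S.X₃ ⟶ S.X₂}
    (hs : s ≫ S.g = 𝟙 _) : Nonempty S.Splitting := by
  have := hS.mono_f
  exact ⟨ShortComplex.Splitting.ofExactOfSection _ hS.exact s hs this⟩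

end AbelianPushout

section Covers

open Abelian

variable {R : Type u} [Ring R] {A : Ideal R} [A.IsTwoSided]

/-- For each complex of h-unitary modules there is a surjection onto it from an acyclic
dg-flat complex. -/
theorem exists_acyclic_cover {Y : CochainComplex (ModuleCat.{u} R) ℤ}
    (hY : hUnitaryComplex A Y) :
    ∃ (P : CochainComplex (ModuleCat.{u} R) ℤ) (q : P ⟶ Y), Epi q ∧ P.Acyclic ∧
      orthogonalFlatComplex A P := by
  obtain ⟨V, hV, p, hp⟩ := exists_uniform_cover (fun n => Y.X n) fun n => hY.isHUnitary_X n
  let T := constComplex V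
  -- Twisting by the identity gives the differential `(y, t) ↦ (t, 0)`, an acyclic complex. On it
  -- `q` is `d ∘ p` on the first component and `p` on the second, which makes it a chain map.
  let π (i j : ℤ) : T.X i →ₗ[R] T.X j := (LinearMap.id : V →ₗ[R] V)
  have hπ (i j k : ℤ) (hij : i + 1 = j) (hjk : j + 1 = k) (t : T.X i) :
      (T.d j k).hom (π i j t) + π j k ((T.d i j).hom t) = 0 := add_zero (0 : V)
  let P := extend T T π hπ
  have hd {i j : ℤ} (hij : i + 1 = j) (x : P.X i) : (P.d i j).hom x = ((x.2 : V), (0 : V)) :=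
    (extend_d hπ hij x.1 x.2).trans (Prod.ext (zero_add (x.2 : V)) rfl)
  have hT (C) (hC : cotorsionComplex A C) : Subsingleton (Ext.{u} T C 1) :=
    subsingleton_ext_of_d_eq_zero (fun _ _ => rfl) (fun _ => hV) hC
  let q : P ⟶ Y :=
    { f := fun i => ModuleCat.ofHom (((Y.d (i - 1) i).hom ∘ₗ p (i - 1)).coprod (p i))
      comm' := by
        rintro i _ rfl
        refine ModuleCat.hom_ext (LinearMap.ext fun x => ?_)
        change (Y.d i (i + 1)).hom ((Y.d (i - 1) i).hom (p (i - 1) x.1) + p i x.2) =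
          ((Y.d (i + 1 - 1) (i + 1)).hom ∘ₗ p (i + 1 - 1)).coprod (p (i + 1))
            ((P.d i (i + 1)).hom x)
        rw [hd rfl, map_add, d_d_apply, zero_add, add_sub_cancel_right]
        refine ((LinearMap.coprod_apply _ _ _).trans ?_).symm
        rw [map_zero, add_zero]
        rfl }
  have hq : Epi q := by
    have (i : ℤ) : Epi (q.f i) := (ModuleCat.epi_iff_surjective _).2 fun y => by
      obtain ⟨x, rfl⟩ := hp i y
      refine ⟨((0 : V), (x : V)), (LinearMap.coprod_apply _ _ _).trans ?_⟩
      rw [map_zero, zero_add]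
      rfl
    exact HomologicalComplex.epi_of_epi_f q this
  refine ⟨P, q, hq, acyclic_iff.2 fun i j k hij hjk x => ⟨fun hx => ?_, ?_⟩,
    fun _ => IsHUnitaryFlat.mid (f := LinearMap.inl R V V) (g := LinearMap.snd R V V)
      LinearMap.inl_injective Function.Exact.inl_snd LinearMap.snd_surjective hV hV,
    fun C hC => subsingleton_ext_mid (extend_shortExact hπ) (hT C hC) (hT C hC)⟩
  · rw [hd hjk] at hx
    refine ⟨((0 : V), (x.1 : V)), (hd hij _).trans (Prod.ext rfl ?_)⟩
    exact (congrArg Prod.fst hx).symm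
  · rintro ⟨y, rfl⟩
    exact d_d_apply _ _ _ _ y

/-- Every complex of h-unitary modules has a special precover by a dg-flat complex. -/
theorem exists_dgFlatComplex_precover {Y : CochainComplex (ModuleCat.{u} R) ℤ}
    (hY : hUnitaryComplex A Y) :
    ∃ (C F : CochainComplex (ModuleCat.{u} R) ℤ) (f : C ⟶ F) (g : F ⟶ Y) (w : f ≫ g = 0),
      (ShortComplex.mk f g w).ShortExact ∧ cotorsionComplex A C ∧ dgFlatComplex A F := by
  obtain ⟨P, q, hq, hPa, hP⟩ := exists_acyclic_cover hY
  have hS : (ShortComplex.mk (kernel.ι q) q (kernel.condition q)).ShortExact :=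
    { exact := ShortComplex.exact_of_f_is_kernel _ (kernelIsKernel q) }
  have hPQ : hUnitaryComplex A P := hUnitaryComplex_of_acyclic hPa fun i => (hP.1 i).1
  obtain ⟨C, F, f, g, w, hT, hC, hF⟩ :=
    exists_cotorsionComplex_preenvelope (hUnitaryComplex_left hS hPa hPQ hY)
  -- The pushout of `P` and the preenvelope `C` of the kernel is at once an extension of `Y` by `C`
  -- and an extension of the dg-flat `F` by the orthogonal flat `P`.
  have sq := IsPushout.of_hasPushout (kernel.ι q) f
  obtain ⟨p, hp, hW⟩ := exists_shortExact_of_isPushout hS sq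
  obtain ⟨p', hp', hW'⟩ := exists_shortExact_of_isPushout hT sq.flip
  have hF' := dgFlatComplex_iff.1 hF
  refine ⟨C, _, _, p, hp, hW, hC, dgFlatComplex_iff.2 ⟨hUnitaryComplex_mid hW hC.2.1 hC.1 hY,
    fun i => ?_, fun D hD => subsingleton_ext_mid hW' (hP.2 D hD) (hF'.2.2 D hD)⟩⟩
  obtain ⟨h₁, h₂, h₃⟩ := shortExact_complex_iff.1 hW' i
  exact IsHUnitaryFlat.mid h₁ h₂ h₃ (hP.1 i) (hF'.2.1 i)

theorem extOneVanishes_of_subsingleton_ext {X Y : CochainComplex (ModuleCat.{u} R) ℤ}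
    (h : Subsingleton (Ext.{u} X Y 1)) (Q : ObjectProperty (CochainComplex (ModuleCat.{u} R) ℤ)) :
    ExtOneVanishes Q X Y := fun _ _ _ _ _ hS => by
  obtain ⟨s, hs⟩ := exists_lift_of_subsingleton_ext hS h (𝟙 X)
  exact nonempty_splitting_of_section hS hs

theorem subsingleton_ext_of_extOneVanishes {X Y : CochainComplex (ModuleCat.{u} R) ℤ}
    (hX : hUnitaryComplex A X) (hY : hUnitaryComplex A Y) (hYa : Y.Acyclic)
    (h : ExtOneVanishes (hUnitaryComplex A) X Y) : Subsingleton (Ext.{u} X Y 1) :=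
  subsingleton_ext_one_of_splits fun E f g w hS => by
    obtain ⟨σ⟩ := h E f g w (hUnitaryComplex_mid hS hYa hY hX) hS
    exact ⟨σ.s, σ.s_g⟩

/-- Orthogonality passes from relative to absolute Ext since cotorsion complexes are acyclic.
Flatness of the terms holds because the special precover splits, making `X` a retract of a dg-flat
complex. -/
theorem leftPerp_cotorsionComplex :
    leftPerp (hUnitaryComplex A) (cotorsionComplex A) = dgFlatComplex A := by
  ext X
  constructor
  · intro hX
    obtain ⟨C, F, f, g, w, hS, hC, hF⟩ := exists_dgFlatComplex_precover hX.1
    obtain ⟨σ⟩ := hX.2 C hC F f g w hF.1 hS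
    refine dgFlatComplex_iff.2 ⟨hX.1, fun i => ?_, fun D hD =>
      subsingleton_ext_of_extOneVanishes hX.1 hD.1 hD.2.1 (hX.2 D hD)⟩
    have hs : (σ.s.f i) ≫ g.f i = 𝟙 _ := HomologicalComplex.congr_hom σ.s_g i
    exact IsHUnitaryFlat.of_retract (hF.2.1 i) (σ.s.f i).hom (g.f i).hom
      (congrArg ModuleCat.Hom.hom hs)
  · intro hX
    exact ⟨hX.1, fun C hC => extOneVanishes_of_subsingleton_ext
      ((dgFlatComplex_iff.1 hX).2.2 C hC) _⟩

end Covers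

end HUnitary

namespace HUnitary

/-! ### Spheres and the extensions they define. -/

section Spheres

open Abelian

variable {R : Type u} [Ring R] {A : Ideal R} [A.IsTwoSided]

theorem hUnitaryComplex_of_d_eq_zero {X : CochainComplex (ModuleCat.{u} R) ℤ}
    (hd : ∀ i j, X.d i j = 0) (hX : ∀ i, IsHUnitary A (X.X i)) : hUnitaryComplex A X :=
  hUnitaryComplex_iff.2 fun i j _ => by
    have h : LinearMap.ker (X.d i j).hom = ⊤ := by
      rw [hd]
      exact LinearMap.ker_zero
    exact ⟨by rw [h]; exact (hX i).of_linearEquiv Submodule.topEquiv.symm, hX i⟩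

theorem isHUnitaryFlat_of_isZero {M : ModuleCat.{u} R} (h : IsZero M) : hUnitaryFlat A M := by
  have := ModuleCat.subsingleton_of_isZero h
  obtain ⟨G, hG⟩ := exists_isFlatGenerator A
  exact IsHUnitaryFlat.of_retract hG.mem (0 : M →ₗ[R] G) 0 (Subsingleton.elim _ _)

theorem hUnitaryFlat_of_iso {M N : ModuleCat.{u} R} (hM : hUnitaryFlat A M) (e : M ≅ N) :
    hUnitaryFlat A N :=
  IsHUnitaryFlat.of_linearEquiv hM e.toLinearEquiv

theorem hUnitaryFlat_single {F : ModuleCat.{u} R} (hF : hUnitaryFlat A F) (m i : ℤ) :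
    hUnitaryFlat A
      (((HomologicalComplex.single (ModuleCat.{u} R) (ComplexShape.up ℤ) m).obj F).X i) := by
  by_cases hi : i = m
  · subst hi
    exact hUnitaryFlat_of_iso hF (HomologicalComplex.singleObjXSelf _ _ _).symm
  · exact isHUnitaryFlat_of_isZero (HomologicalComplex.isZero_single_obj_X _ _ _ _ hi)

theorem sphereComplex_le_dgFlatComplex {G : ModuleCat.{u} R} (hG : hUnitaryFlat A G)
    (κ : Cardinal.{u}) : sphereComplex A G κ ≤ dgFlatComplex A := by
  rintro K ⟨m, F, hF, ⟨e⟩⟩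
  have hF' : hUnitaryFlat A F := hF.elim And.left fun h => h ▸ hG
  have hd (i j : ℤ) : K.d i j = 0 := by
    have h := e.hom.comm i j
    rw [show ((CochainComplex.singleFunctor (ModuleCat.{u} R) m).obj F).d i j = 0 from rfl,
      comp_zero] at h
    rw [← cancel_mono (e.hom.f j), ← h, zero_comp]
  have hX (i : ℤ) : hUnitaryFlat A (K.X i) := hUnitaryFlat_of_iso (hUnitaryFlat_single hF' m i)
    ((HomologicalComplex.eval _ _ i).mapIso e.symm)
  exact dgFlatComplex_iff.2 ⟨hUnitaryComplex_of_d_eq_zero hd fun i => (hX i).1, hX,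
    fun C hC => subsingleton_ext_of_d_eq_zero hd hX hC⟩

theorem essentiallySmall_sphereComplex (G : ModuleCat.{u} R) (κ : Cardinal.{u}) :
    ObjectProperty.EssentiallySmall.{u} (sphereComplex A G κ) := by
  obtain ⟨I, X, hX⟩ := exists_representatives R κ
  let S (x : ULift.{u} ℤ × Option I) : CochainComplex (ModuleCat.{u} R) ℤ :=
    (CochainComplex.singleFunctor (ModuleCat.{u} R) x.1.down).obj (x.2.elim G X)
  refine ⟨ObjectProperty.ofObj S, inferInstance, ?_⟩
  rintro K ⟨m, F, hF, ⟨e⟩⟩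
  have : ∃ y : Option I, Nonempty (F ≅ y.elim G X) := by
    rcases hF with hF | rfl
    · obtain ⟨i, hi⟩ := hX F hF.2
      exact ⟨some i, hi⟩
    · exact ⟨none, ⟨Iso.refl _⟩⟩
  obtain ⟨y, ⟨e'⟩⟩ := this
  exact ⟨S (⟨m⟩, y), ⟨_⟩, ⟨e ≪≫ (CochainComplex.singleFunctor (ModuleCat.{u} R) m).mapIso e'⟩⟩

/-- The extension of a complex `T` of h-unitary modules with zero differential by a complex `Y`
of h-unitary modules. -/
theorem hUnitaryComplex_extend {T Y : CochainComplex (ModuleCat.{u} R) ℤ}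
    {π : ∀ i j : ℤ, T.X i →ₗ[R] Y.X j} (hπ : ∀ i j k : ℤ, i + 1 = j → j + 1 = k →
      ∀ t, (Y.d j k).hom (π i j t) + π j k ((T.d i j).hom t) = 0)
    (hT : ∀ i, IsHUnitary A (T.X i)) (hd : ∀ i j, T.d i j = 0) (hY : hUnitaryComplex A Y)
    (h : ∀ i j : ℤ, i + 1 = j →
      IsHUnitary A ↥(LinearMap.range (Y.d i j).hom ⊔ LinearMap.range (π i j))) :
    hUnitaryComplex A (extend T Y π hπ) :=
  hUnitaryComplex_iff.2 fun i j hij => by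
    have hX : IsHUnitary A ((extend T Y π hπ).X i) := isHUnitary_prod (hY.isHUnitary_X i) (hT i)
    refine ⟨?_, hX⟩
    let g₀ : (extend T Y π hπ).X i →ₗ[R] Y.X j := (Y.d i j).hom.coprod (π i j)
    have hr : LinearMap.range g₀ = LinearMap.range (Y.d i j).hom ⊔ LinearMap.range (π i j) :=
      LinearMap.range_coprod _ _
    have hg (x : (extend T Y π hπ).X i) :
        ((extend T Y π hπ).d i j).hom x = ((g₀ x : Y.X j), (0 : T.X j)) := by
      refine (extend_d hπ hij x.1 x.2).trans (Prod.ext rfl ?_)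
      rw [hd]
      rfl
    have hk : LinearMap.ker ((extend T Y π hπ).d i j).hom = LinearMap.ker g₀ :=
      Submodule.ext fun x => by
        rw [LinearMap.mem_ker, LinearMap.mem_ker, hg]
        exact ⟨fun h => congrArg Prod.fst h, fun h => Prod.ext h rfl⟩
    rw [hk]
    refine IsHUnitary.left (Submodule.subtype_injective _) (g := g₀.rangeRestrict) ?_
      g₀.surjective_rangeRestrict hX ?_
    · rw [LinearMap.exact_iff, LinearMap.ker_rangeRestrict, Submodule.range_subtype]
    · rw [hr]
      exact h i j hij

/-- If an h-unitary flat module `F` and a map `φ` to the cycles of `Y` in degree `j` define an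
extension in `hUnitaryComplex A`, then the values of `φ` are boundaries. -/
theorem exists_boundary_of_perp_sphere {Y : CochainComplex (ModuleCat.{u} R) ℤ}
    (hY : hUnitaryComplex A Y) {F : ModuleCat.{u} R} (hF : hUnitaryFlat A F) {i j k : ℤ}
    (hij : i + 1 = j) (hjk : j + 1 = k) (φ : F →ₗ[R] Y.X j)
    (hφ : ∀ t, (Y.d j k).hom (φ t) = 0)
    (h : ExtOneVanishes (hUnitaryComplex A)
      ((HomologicalComplex.single (ModuleCat.{u} R) (ComplexShape.up ℤ) i).obj F) Y)
    (hr : IsHUnitary A ↥(LinearMap.range (Y.d i j).hom ⊔ LinearMap.range φ)) (t : F) :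
    ∃ y, (Y.d i j).hom y = φ t := by
  let T := (HomologicalComplex.single (ModuleCat.{u} R) (ComplexShape.up ℤ) i).obj F
  -- The twist is concentrated in the single pair of degrees `i`, `j`, where up to the canonical
  -- identifications it is `φ`.
  let π (a b : ℤ) : T.X a →ₗ[R] Y.X b := if h : a = i ∧ b = j then
    ((HomologicalComplex.singleObjXIsoOfEq _ i F a h.1).hom ≫ ModuleCat.ofHom φ ≫
      (Y.XIsoOfEq h.2).inv).hom else 0
  let e : T.X i ≃ₗ[R] F := (HomologicalComplex.singleObjXSelf _ i F).toLinearEquiv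
  have hπ₁ (t : T.X i) : π i j t = φ (e t) := by
    have : π i j = ((HomologicalComplex.singleObjXIsoOfEq _ i F i rfl).hom ≫ ModuleCat.ofHom φ ≫
      (Y.XIsoOfEq rfl).inv).hom := dif_pos ⟨rfl, rfl⟩
    rw [this, HomologicalComplex.XIsoOfEq_rfl]
    rfl
  have hπ₀ (a b : ℤ) (h : ¬ (a = i ∧ b = j)) : π a b = 0 := dif_neg h
  have hπ (a b c : ℤ) (hab : a + 1 = b) (hbc : b + 1 = c) (t : T.X a) :
      (Y.d b c).hom (π a b t) + π b c ((T.d a b).hom t) = 0 := by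
    have h0 : (T.d a b).hom t = 0 := rfl
    rw [h0, map_zero, add_zero]
    by_cases hb : a = i ∧ b = j
    · obtain ⟨rfl, rfl⟩ := hb
      obtain rfl : c = k := hbc.symm.trans hjk
      rw [hπ₁, hφ]
    · rw [hπ₀ a b hb]
      exact map_zero _
  have hE : hUnitaryComplex A (extend T Y π hπ) := by
    refine hUnitaryComplex_extend hπ (fun a => (hUnitaryFlat_single hF i a).1) (fun _ _ => rfl) hY
      fun a b hab => ?_
    by_cases hb : a = i ∧ b = j
    · obtain ⟨rfl, rfl⟩ := hb
      have : LinearMap.range (π a b) = LinearMap.range φ := by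
        rw [show π a b = φ ∘ₗ e.toLinearMap from LinearMap.ext hπ₁, LinearMap.range_comp,
          LinearEquiv.range, Submodule.map_top]
      rw [this]
      exact hr
    · rw [hπ₀ a b hb, LinearMap.range_zero, sup_bot_eq]
      exact hY.isHUnitary_range hab
  obtain ⟨σ⟩ := h _ _ _ _ hE (extend_shortExact hπ)
  have hs (a : ℤ) (t : T.X a) : ((σ.s.f a).hom t).2 = t :=
    LinearMap.congr_fun (congrArg ModuleCat.Hom.hom (HomologicalComplex.congr_hom σ.s_g a)) t
  have h1 := hom_d_apply σ.s i j (e.symm t)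
  -- The differential of the sphere vanishes, so compatibility of the section with the differentials
  -- reads `d y + φ t = 0`, where `y` is the component of the section in `Y`.
  have h2 : (Y.d i j).hom ((σ.s.f i).hom (e.symm t)).1 + π i j ((σ.s.f i).hom (e.symm t)).2 = 0 :=
    congrArg Prod.fst (((extend_d hπ hij _ _).symm.trans h1).trans (map_zero (σ.s.f j).hom))
  rw [hs, hπ₁, LinearEquiv.apply_symm_apply] at h2
  exact ⟨-((σ.s.f i).hom (e.symm t)).1, by rw [map_neg]; exact neg_eq_of_add_eq_zero_right h2⟩

end Spheres

end HUnitary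

namespace HUnitary

/-! ### Cogeneration by spheres, and assembly of the theorem. -/

section Cogeneration

open Abelian

variable {R : Type u} [Ring R] {A : Ideal R} [A.IsTwoSided] {G : ModuleCat.{u} R}
  {κ : Cardinal.{u}}

theorem isHUnitary_sup_map {Z : Type u} [AddCommGroup Z] [Module R Z] (B U : Submodule R Z)
    (hB : IsHUnitary A B) (hU : IsHUnitary A (U.map B.mkQ)) : IsHUnitary A ↥(B ⊔ U) := by
  have hm : (B ⊔ U).map B.mkQ = U.map B.mkQ := by
    rw [Submodule.map_sup, Submodule.mkQ_map_self, bot_sup_eq]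
  rw [← hm] at hU
  refine IsHUnitary.mid (f := Submodule.inclusion le_sup_left)
    (g := B.mkQ.submoduleMap (B ⊔ U)) (Submodule.inclusion_injective _) (fun x => ?_)
    (B.mkQ.submoduleMap_surjective _) hB hU
  constructor
  · intro hx
    exact ⟨⟨x.1, (Submodule.Quotient.mk_eq_zero B).1 (congrArg Subtype.val hx)⟩, rfl⟩
  · rintro ⟨y, rfl⟩
    exact Subtype.ext ((Submodule.Quotient.mk_eq_zero B).2 y.2)

/-- A cycle `x` is hit, modulo boundaries, by a small partial sum `F` of copies of `G` whose image
in cohomology is h-unitary. Then boundaries together with the image of `F` form an h-unitary module,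
so the extension of a sphere defined by `F` lies in the subcategory, and its splitting makes `x` a
boundary. -/
theorem acyclic_of_perp_sphereComplex (hG : IsFlatGenerator A G) (hκ : ℵ₀ ≤ κ) (hGκ : #G ≤ κ)
    {Y : CochainComplex (ModuleCat.{u} R) ℤ}
    (hY : rightPerp (hUnitaryComplex A) (sphereComplex A G κ) Y) : Y.Acyclic := by
  refine acyclic_iff.2 fun i j k hij hjk x => ⟨fun hx => ?_, ?_⟩
  · let Z := LinearMap.ker (Y.d j k).hom
    have hZ : IsHUnitary A Z := hY.1.isHUnitary_ker hjk
    let ρ : LinearMap.range (Y.d i j).hom →ₗ[R] Z := Submodule.inclusion (by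
      rintro _ ⟨y, rfl⟩
      exact d_d_apply _ _ _ _ y)
    have hρ : Function.Injective ρ := Submodule.inclusion_injective _
    let B := LinearMap.range ρ
    have hB : IsHUnitary A B :=
      (hY.1.isHUnitary_range hij).of_linearEquiv (LinearEquiv.ofInjective ρ hρ)
    have hH : IsHUnitary A (Z ⧸ B) := IsHUnitary.right hρ (LinearMap.exact_map_mkQ_range ρ)
      (Submodule.mkQ_surjective _) (hY.1.isHUnitary_range hij) hZ
    obtain ⟨ι, p, hp⟩ := hG.generates (ModuleCat.of R Z) hZ
    obtain ⟨s, hs, ⟨t, hts, ht⟩, hU⟩ := hG.exists_small_submodule hκ hGκ (ModuleCat.of R (Z ⧸ B)) hH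
      ι (B.mkQ ∘ₗ p) ((Submodule.mkQ_surjective _).comp hp) (B.mkQ ⟨x, hx⟩)
    let F := ModuleCat.of R (Finsupp.supported G R s)
    have hF : hUnitaryFlat A F := IsHUnitaryFlat.of_linearEquiv
      (isHUnitaryFlat_finsupp hG.mem) (Finsupp.supportedEquivFinsupp s).symm
    rw [Submodule.map_comp] at hU
    have hBU := isHUnitary_sup_map B _ hB hU
    let φ : F →ₗ[R] Y.X j := Z.subtype ∘ₗ p ∘ₗ (Finsupp.supported G R s).subtype
    have hr : LinearMap.range (Y.d i j).hom ⊔ LinearMap.range φ =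
        (B ⊔ (Finsupp.supported G R s).map p).map Z.subtype := by
      have hρr : Z.subtype ∘ₗ ρ = (LinearMap.range (Y.d i j).hom).subtype := rfl
      rw [Submodule.map_sup, ← LinearMap.range_comp, hρr, Submodule.range_subtype,
        LinearMap.range_comp, LinearMap.range_comp, Submodule.range_subtype]
    obtain ⟨y, hy⟩ := exists_boundary_of_perp_sphere hY.1 hF hij hjk φ
      (fun t => (p t.1).2) (hY.2 _ ⟨i, F, Or.inl ⟨hF, mk_supported_le (R := R) hκ hs hGκ⟩,
        ⟨Iso.refl _⟩⟩) (by
        rw [hr]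
        exact hBU.of_linearEquiv (Submodule.equivMapOfInjective _ Z.subtype_injective _))
      ⟨t, hts⟩
    have hxt : p t - ⟨x, hx⟩ ∈ B := (Submodule.Quotient.eq B).1 ht
    obtain ⟨⟨_, y', rfl⟩, hy'⟩ := hxt
    refine ⟨y - y', ?_⟩
    have h1 : (Y.d i j).hom y' = (p t).1 - x := congrArg Subtype.val hy'
    have h2 : (Y.d i j).hom y = (p t).1 := hy
    rw [map_sub, h1, h2, sub_sub_cancel]
  · rintro ⟨y, rfl⟩
    exact d_d_apply _ _ _ _ y

/-- If `Ext¹(S^m(F), Y) = 0` for complexes, then `Ext¹(F, Z_m Y) = 0`. -/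
theorem extVanishes_cycles {Y : CochainComplex (ModuleCat.{u} R) ℤ} {F : ModuleCat.{u} R}
    (m : ℤ) (h : Subsingleton (Ext.{u}
      ((HomologicalComplex.single (ModuleCat.{u} R) (ComplexShape.up ℤ) m).obj F) Y 1)) :
    ExtVanishes R 1 F (LinearMap.ker (Y.d m (m + 1)).hom) := by
  refine extVanishes_one_of_splits _ fun N _ _ f g hf hfg hg => ?_
  let Z := LinearMap.ker (Y.d m (m + 1)).hom
  have hS := (moduleCat_shortExact hf hfg hg).map_of_exact
    (HomologicalComplex.single (ModuleCat.{u} R) (ComplexShape.up ℤ) m)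
  -- The inclusion of the cycles is a map from a sphere to `Y`. It extends over the sphere on `N`,
  -- which lands in cycles again and so retracts `N` onto `Z`.
  let φ : (HomologicalComplex.single (ModuleCat.{u} R) (ComplexShape.up ℤ) m).obj
      (ModuleCat.of R Z) ⟶ Y :=
    HomologicalComplex.mkHomFromSingle (ModuleCat.ofHom Z.subtype) (by
      rintro _ rfl
      exact ModuleCat.hom_ext (LinearMap.ext fun x => x.2))
  obtain ⟨l, hl⟩ : ∃ l : (HomologicalComplex.single (ModuleCat.{u} R) (ComplexShape.up ℤ) m).obj
      (ModuleCat.of R N) ⟶ Y, (HomologicalComplex.single (ModuleCat.{u} R) (ComplexShape.up ℤ) m).map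
        (ModuleCat.ofHom f) ≫ l = φ := exists_extension_of_subsingleton_ext hS h φ
  let e := HomologicalComplex.singleObjXSelf (ComplexShape.up ℤ) m (ModuleCat.of R N)
  have hl' : ModuleCat.ofHom f ≫ e.inv ≫ l.f m = ModuleCat.ofHom Z.subtype := by
    have := HomologicalComplex.congr_hom hl m
    rw [HomologicalComplex.comp_f, HomologicalComplex.single_map_f_self,
      HomologicalComplex.mkHomFromSingle_f, Category.assoc, Category.assoc] at this
    exact (cancel_epi _).1 this
  let r : N →ₗ[R] Z := (e.inv ≫ l.f m).hom.codRestrict _ fun x => LinearMap.mem_ker.2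
    ((hom_d_apply l m (m + 1) _).trans (map_zero (l.f (m + 1)).hom))
  have hr (z : Z) : r (f z) = z :=
    Subtype.ext (LinearMap.congr_fun (congrArg ModuleCat.Hom.hom hl') z)
  obtain ⟨s, hs⟩ := exists_factor hfg hg (LinearMap.id - f ∘ₗ r) (LinearMap.ext fun z => by
    simp [hr])
  refine ⟨s, LinearMap.ext fun x => ?_⟩
  obtain ⟨x, rfl⟩ := hg x
  have := LinearMap.congr_fun hs x
  rw [LinearMap.comp_apply] at this
  rw [LinearMap.comp_apply, this, LinearMap.sub_apply, map_sub, LinearMap.comp_apply,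
    hfg.apply_apply_eq_zero, sub_zero]
  rfl

/-- Acyclicity comes first: only then does the relative condition give absolute `Ext¹` vanishing on
spheres, hence on cycles for small flat modules, and by deconstruction for all of them. -/
theorem rightPerp_sphereComplex_le (hG : IsFlatGenerator A G) (hκ : ℵ₀ ≤ κ) (hGκ : #G ≤ κ) :
    rightPerp (hUnitaryComplex A) (sphereComplex A G κ) ≤ cotorsionComplex A := by
  intro Y hY
  have hYa := acyclic_of_perp_sphereComplex hG hκ hGκ hY
  refine ⟨hY.1, hYa, fun m => (hUnitaryCotorsion_iff (cyclesModule Y m)).2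
    ⟨hY.1.isHUnitary_ker rfl, fun F hF => hG.extVanishes_one hκ hGκ (fun S hS hSκ => ?_) hF⟩⟩
  have hL : sphereComplex A G κ
      ((HomologicalComplex.single (ModuleCat.{u} R) (ComplexShape.up ℤ) m).obj S) :=
    ⟨m, S, Or.inl ⟨hS, hSκ⟩, ⟨Iso.refl _⟩⟩
  exact extVanishes_cycles m (subsingleton_ext_of_extOneVanishes
    (sphereComplex_le_dgFlatComplex hG.mem κ _ hL).1 hY.1 hYa (hY.2 _ hL))

theorem cotorsionComplex_le_rightPerp :
    cotorsionComplex A ≤ rightPerp (hUnitaryComplex A) (dgFlatComplex A) := fun C hC =>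
  ⟨hC.1, fun _ hF => extOneVanishes_of_subsingleton_ext ((dgFlatComplex_iff.1 hF).2.2 C hC) _⟩

theorem rightPerp_antitone {𝓐 : Type*} [Category 𝓐] [Abelian 𝓐] (Q : ObjectProperty 𝓐)
    {D D' : ObjectProperty 𝓐} (h : D ≤ D') : rightPerp Q D' ≤ rightPerp Q D :=
  fun _ hY => ⟨hY.1, fun X hX => hY.2 X (h X hX)⟩

theorem rightPerp_dgFlatComplex :
    rightPerp (hUnitaryComplex A) (dgFlatComplex A) = cotorsionComplex A := by
  obtain ⟨G, hG⟩ := exists_isFlatGenerator A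
  exact le_antisymm ((rightPerp_antitone _ (sphereComplex_le_dgFlatComplex hG.mem (max #G ℵ₀))).trans
    (rightPerp_sphereComplex_le hG (le_max_right _ _) (le_max_left _ _)))
    cotorsionComplex_le_rightPerp

variable (A) in
theorem isCompleteCotorsionPair : IsCompleteCotorsionPair (hUnitaryComplex A) (dgFlatComplex A)
    (cotorsionComplex A) where
  rightPerp_eq := rightPerp_dgFlatComplex
  leftPerp_eq := leftPerp_cotorsionComplex
  enoughInjectives _ hY := by
    obtain ⟨C, F, f, g, w, hS, hC, hF⟩ := exists_cotorsionComplex_preenvelope hY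
    exact ⟨_, hS, rfl, hC, hF⟩
  enoughProjectives _ hY := by
    obtain ⟨C, F, f, g, w, hS, hC, hF⟩ := exists_dgFlatComplex_precover hY
    exact ⟨_, hS, hC, hF, rfl⟩

theorem IsFlatGenerator.isCogeneratedBySet (hG : IsFlatGenerator A G) (hκ : max #G ℵ₀ ≤ κ) :
    IsCogeneratedBySet.{u} (hUnitaryComplex A) (dgFlatComplex A) (sphereComplex A G κ) where
  le := sphereComplex_le_dgFlatComplex hG.mem κ
  essentiallySmall := essentiallySmall_sphereComplex G κ
  perp_eq := le_antisymm ((rightPerp_sphereComplex_le hG ((le_max_right _ _).trans hκ)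
    ((le_max_left _ _).trans hκ)).trans cotorsionComplex_le_rightPerp)
    (rightPerp_antitone _ (sphereComplex_le_dgFlatComplex hG.mem κ))

end Cogeneration

end HUnitary

theorem mainTheorem4 (R : Type u) [Ring R] (A : Ideal R) [A.IsTwoSided] :
    HUnitary.IsCompleteCotorsionPair (HUnitary.hUnitaryComplex A)
      (HUnitary.dgFlatComplex A) (HUnitary.cotorsionComplex A) ∧
    (∃ G : ModuleCat.{u} R, HUnitary.IsFlatGenerator A G) ∧
    ∀ G : ModuleCat.{u} R, HUnitary.IsFlatGenerator A G →
      ∀ κ : Cardinal.{u}, max (Cardinal.mk G) Cardinal.aleph0 ≤ κ →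
        HUnitary.IsCogeneratedBySet.{u} (HUnitary.hUnitaryComplex A)
          (HUnitary.dgFlatComplex A) (HUnitary.sphereComplex A G κ) :=
  ⟨HUnitary.isCompleteCotorsionPair A, HUnitary.exists_isFlatGenerator A,
    fun _ hG _ hκ => hG.isCogeneratedBySet hκ⟩
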